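/- Let $k$ be a field, $P=k[x,y]$, $R=k[\![x,y]\!]$, and let $\tau$ be a term ordering on $P$ with $x>_\tau y$. Let $\overline\tau$ be the local ordering on monomials with $m>_{\overline\tau}m'$ iff $\deg m<\deg m'$, or $\deg m=\deg m'$ and $m>_\tau m'$. For an ideal $J\subset R$ let $\operatorname{Lt}_{\overline\tau}(J)\subset P$ be the monomial ideal generated by the leading terms of the elements of $J$, and let $\mu(J)$ be the minimal number of generators of $J$. Let $L=(x^t,x^{t-1}y^{m_1},\dots,y^{m_t})$ with $t\ge1$ and $0=m_0<m_1<\dots<m_t$ be a lex-segment ideal, and let $h=(1,2,\dots,t,h_t,\dots,h_s,0,0,\dots)$ be the Hilbert function of $R/L$ (so $L=\operatorname{Lex}(h)$). Put $\Delta(h)=\max_{i\ge1}|h_i-h_{i-1}|$ (the last jump, from $h_s$ to $0$, is included), $n=\sum_i h_i$, let $n_l$ be the number of $i\ge1$ with $|h_i-h_{i-1}|=l$, and let $D=n-t-\sum_{l\ge2}n_l\binom l2$. Put $d_j=m_j-m_{j-1}$ and $u_{i,j}=m_j-m_{i-1}+i-j$ for $1\le i\le t+1$, $1\le j\le t$.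 Let $H$ be the $(t+1)\times t$ matrix with entries $y^{d_j}$ at $(j,j)$, $-x$ at $(j+1,j)$ and $0$ elsewhere. Let $\mathcal M(L)$ be the set of $(t+1)\times t$ matrices $N=(n_{i,j})$ over $k[y]$ such that $n_{i,j}=0$ for $i\le j$ and, for $i>j$, either $n_{i,j}=0$ or $u_{i,j}\le\operatorname{ord}(n_{i,j})\le\deg(n_{i,j})<d_j$. Let $V(L)=\{J\subset R:\operatorname{Lt}_{\overline\tau}(J)=L\}$ and $V_d(L)=\{J\in V(L):\mu(J)=d\}$. For a matrix $M$ let $I_r(M)$ be the ideal generated by its $r\times r$ minors, with $I_0(M)=(1)$, and let $\mathcal V(I)$ be the zero set of the ideal $I$. Then the free coefficients of the matrices in $\mathcal M(L)$ are $D$ in number, they identify $\mathcal M(L)$ with $\mathbb A^D=k^D$, and $N\mapsto I_t(H+N)$ is a bijection $\mathcal M(L)\to V(L)$; identify $V(L)$ with $\mathbb A^D$ in this way. Let $\bar N$ be the matrix over $k[c_1,\dots,c_D]$ of the constant terms (in $y$) of the generic matrix of $\mathcal M(L)$. For every $d$ with $\Delta(h)+1\le d\le t+1$, $$V_d(L)=\mathcal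 V(I_{t+2-d}(\bar N))\setminus\mathcal V(I_{t+1-d}(\bar N))\subset\mathbb A^D.$$ In particular, $V_{t+1}(L)=\mathcal V(I_1(\bar N))$ is an affine space (the ideal $I_1(\bar N)$ is generated by some of the coordinates, so $V_{t+1}(L)$ is a coordinate subspace and $k[c_1,\dots,c_D]/I_1(\bar N)$ is a polynomial ring), and $$V_{\Delta(h)+1}(L)=\mathbb A^D\setminus\mathcal V(I_{t-\Delta(h)}(\bar N))$$ is of dimension $D$: the open subset of $\operatorname{Spec}k[c_1,\dots,c_D]$ complementary to $V(I_{t-\Delta(h)}(\bar N))$ has Krull dimension $D$, and, if $k$ is infinite, so has the coordinate ring of the Zariski closure in $k^D$ of the set of points $V_{\Delta(h)+1}(L)$. -/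

import Mathlib

open scoped MonomialOrder

namespace BettiStrata

noncomputable section

/-! ### Local term orderings, leading term ideals, Groebner cells -/

/-- The ring `P = k[x, y]`, with `x = X 0` and `y = X 1`. -/
abbrev P (k : Type*) [Field k] := MvPolynomial (Fin 2) k

/-- The ring `R = k⟦x, y⟧`, with `x = X 0` and `y = X 1`. -/
abbrev R (k : Type*) [Field k] := MvPowerSeries (Fin 2) k

/-- The local term ordering induced by `τ`, on exponents: `LocalGT τ a b` says that the monomial
with exponent `a` is larger than the one with exponent `b`, that is, it has smaller degree, or the
same degree and it is larger with respect to `τ`. -/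
def LocalGT (τ : MonomialOrder (Fin 2)) (a b : Fin 2 →₀ ℕ) : Prop :=
  a.degree < b.degree ∨ (a.degree = b.degree ∧ b ≺[τ] a)

/-- `a` is the exponent of the leading term of the power series `f` for the local ordering. -/
def IsLeadingExp {k : Type*} [Field k] (τ : MonomialOrder (Fin 2)) (f : R k) (a : Fin 2 →₀ ℕ) :
    Prop :=
  MvPowerSeries.coeff a f ≠ 0 ∧ ∀ b, MvPowerSeries.coeff b f ≠ 0 → b ≠ a → LocalGT τ a b

/-- The leading term ideal of an ideal `J` of `R`, a monomial ideal of `P`. -/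
def leadingIdeal {k : Type*} [Field k] (τ : MonomialOrder (Fin 2)) (J : Ideal (R k)) :
    Ideal (P k) :=
  Ideal.span {p | ∃ f ∈ J, ∃ a, IsLeadingExp τ f a ∧ p = MvPolynomial.monomial a 1}

/-- The Groebner cell `V(E)` of a monomial ideal `E`. -/
def groebnerCell {k : Type*} [Field k] (τ : MonomialOrder (Fin 2)) (E : Ideal (P k)) :
    Set (Ideal (R k)) :=
  {J | leadingIdeal τ J = E}

/-- The `d`-Betti stratum `V_d(E)`: the ideals in the cell with minimal number of generators
`d`. -/
def bettiStratum {k : Type*} [Field k] (τ : MonomialOrder (Fin 2)) (E : Ideal (P k)) (d : ℕ) :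
    Set (Ideal (R k)) :=
  {J | J ∈ groebnerCell τ E ∧ Submodule.spanRank J = (d : Cardinal)}

/-! ### Lex-segment ideals and Hilbert functions -/

/-- The exponents `m 0, …, m t` describe a lex-segment ideal different from the unit ideal:
`0 = m 0 < m 1 < ⋯ < m t` and `t ≥ 1`. -/
def IsLexSegment {t : ℕ} (m : Fin (t + 1) → ℕ) : Prop :=
  1 ≤ t ∧ m 0 = 0 ∧ StrictMono m

/-- The monomial ideal `(x ^ t, …, x ^ (t - i) * y ^ (m i), …, y ^ (m t))` of `P`. -/
def monIdeal (k : Type*) [Field k] {t : ℕ} (m : Fin (t + 1) → ℕ) : Ideal (P k) :=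
  Ideal.span (Set.range fun i : Fin (t + 1) =>
    (MvPolynomial.X 0 ^ (t - (i : ℕ)) * MvPolynomial.X 1 ^ m i : P k))

/-- The same monomial ideal in `R`. -/
def monIdealR (k : Type*) [Field k] {t : ℕ} (m : Fin (t + 1) → ℕ) : Ideal (R k) :=
  (monIdeal k m).map MvPolynomial.coeToMvPowerSeries.ringHom

/-- The Hilbert function of the local ring `A = R / J`, `j ↦ dim_k (𝔪_A ^ j / 𝔪_A ^ (j + 1))`.
The quotient is the image of `𝔪 ^ j` in `R / (𝔪 ^ (j + 1) + J)`. -/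
def hilbertFunction {k : Type*} [Field k] (J : Ideal (R k)) (j : ℕ) : ℕ :=
  Module.finrank k
    ((IsLocalRing.maximalIdeal (R k) ^ j).map
      (Ideal.Quotient.mk (IsLocalRing.maximalIdeal (R k) ^ (j + 1) ⊔ J)))

/-- The height `|h (i + 1) - h i|` of the jump of `h` from `i` to `i + 1`. -/
def jump (h : ℕ → ℕ) (i : ℕ) : ℕ := ((h (i + 1) : ℤ) - (h i : ℤ)).natAbs

/-- The maximal jump `Δ(h)`; the final jump, down to the value `0`, is included. -/
def maxJump (h : ℕ → ℕ) : ℕ := ⨆ i : ℕ, jump h i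

/-- `D = n - t - ∑_{l ≥ 2} n_l * (l choose 2)`, where `n = ∑ i, h i` and `n_l` is the number of
jumps of `h` of height `l`. (As `h ≤ t`, no jump is higher than `t`.) -/
def cellDim (h : ℕ → ℕ) (t : ℕ) : ℤ :=
  ((∑ᶠ i : ℕ, h i : ℕ) : ℤ) - (t : ℤ)
    - ∑ l ∈ Finset.Icc 2 t, (Nat.card {i : ℕ // jump h i = l} : ℤ) * (l.choose 2 : ℤ)

/-! ### Canonical Hilbert-Burch matrices

Rows and columns are numbered from `0`. -/

/-- The differences: `diff m j = m (j + 1) - m j`, with `j` counted from `0`. -/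
def diff {t : ℕ} (m : Fin (t + 1) → ℕ) (j : Fin t) : ℕ := m j.succ - m j.castSucc

/-- The degree matrix: `m_j - m_{i - 1} + i - j` when rows and columns are numbered from `1`. -/
def degMatrix {t : ℕ} (m : Fin (t + 1) → ℕ) (i : Fin (t + 1)) (j : Fin t) : ℤ :=
  (m j.succ : ℤ) - (m i : ℤ) + ((i : ℕ) : ℤ) - ((j : ℕ) : ℤ)

/-- The canonical Hilbert-Burch matrix of the monomial ideal with exponents `m`, over `R`. -/
def hbMatrix (k : Type*) [Field k] {t : ℕ} (m : Fin (t + 1) → ℕ) :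
    Matrix (Fin (t + 1)) (Fin t) (R k) :=
  fun i j =>
    if i = j.castSucc then (MvPowerSeries.X 1 : R k) ^ diff m j
    else if i = j.succ then -(MvPowerSeries.X 0 : R k)
    else 0

/-- The set `𝓜(E)` of matrices over `k[y]`. -/
def canonicalSet (k : Type*) [Field k] {t : ℕ} (m : Fin (t + 1) → ℕ) :
    Set (Matrix (Fin (t + 1)) (Fin t) (Polynomial k)) :=
  {N | ∀ (i : Fin (t + 1)) (j : Fin t),
    ((i : ℕ) ≤ (j : ℕ) → N i j = 0) ∧
    ((j : ℕ) < (i : ℕ) → N i j ≠ 0 →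
      degMatrix m i j ≤ ((N i j).natTrailingDegree : ℤ) ∧ (N i j).natDegree < diff m j)}

/-- The ideal `I_r(M)` generated by the minors of size `r` of `M`; `I_0(M)` is the unit ideal. -/
def minorIdeal {A : Type*} [CommRing A] {p q : ℕ} (r : ℕ) (M : Matrix (Fin p) (Fin q) A) :
    Ideal A :=
  Ideal.span {a | ∃ (f : Fin r ↪o Fin p) (g : Fin r ↪o Fin q), a = (M.submatrix f g).det}

/-- The map `Φ` which sends `N` to the ideal `I_t(H + N)` of `R`; the variable of `k[y]` becomes
`y = X 1`. -/
def idealOf {k : Type*} [Field k] {t : ℕ} (m : Fin (t + 1) → ℕ)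
    (N : Matrix (Fin (t + 1)) (Fin t) (Polynomial k)) : Ideal (R k) :=
  minorIdeal t (hbMatrix k m + N.map fun p => Polynomial.aeval (MvPowerSeries.X 1 : R k) p)

/-! ### The affine space of coefficients and the generic matrix -/

/-- `(i, j, l)` is the position of a free coefficient: the coefficient of `y ^ l` in the entry
`(i, j)` of a matrix in `𝓜(E)`. -/
def IsFree {t : ℕ} (m : Fin (t + 1) → ℕ) (i : Fin (t + 1)) (j : Fin t) (l : ℕ) : Prop :=
  (j : ℕ) < (i : ℕ) ∧ degMatrix m i j ≤ (l : ℤ) ∧ l < diff m j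

/-- The index set of the coordinates `c_1, …, c_D`. -/
def Coord {t : ℕ} (m : Fin (t + 1) → ℕ) : Type :=
  {s : Fin (t + 1) × Fin t × ℕ // IsFree m s.1 s.2.1 s.2.2}

open Classical in
/-- The matrix `N ∈ 𝓜(E)` in general form, over `k[c_1, …, c_D][y]`. -/
def genericMatrix (k : Type*) [Field k] {t : ℕ} (m : Fin (t + 1) → ℕ) :
    Matrix (Fin (t + 1)) (Fin t) (Polynomial (MvPolynomial (Coord m) k)) :=
  fun i j => ∑ l ∈ Finset.range (diff m j),
    if hl : IsFree m i j l then
      Polynomial.monomial l (MvPolynomial.X (⟨(i, j, l), hl⟩ : Coord m))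
    else 0

/-- The matrix of constant terms (in `y`) of the generic matrix, over `k[c_1, …, c_D]`. -/
def genericConst (k : Type*) [Field k] {t : ℕ} (m : Fin (t + 1) → ℕ) :
    Matrix (Fin (t + 1)) (Fin t) (MvPolynomial (Coord m) k) :=
  (genericMatrix k m).map fun p => p.coeff 0

/-- The value of the generic matrix at a point `c` of the affine space. -/
def matrixAt {k : Type*} [Field k] {t : ℕ} (m : Fin (t + 1) → ℕ) (c : Coord m → k) :
    Matrix (Fin (t + 1)) (Fin t) (Polynomial k) :=
  (genericMatrix k m).map (Polynomial.map (MvPolynomial.eval c))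

/-- The identification of the affine space with the cell: `c ↦ I_t(H + N(c))`. -/
def cellMap {k : Type*} [Field k] {t : ℕ} (m : Fin (t + 1) → ℕ) (c : Coord m → k) :
    Ideal (R k) :=
  idealOf m (matrixAt m c)

end

end BettiStrata

open BettiStrata

namespace BettiStrata

/-! ### The local ordering as an enumeration of the exponents -/

/-! In two variables every `τ` with x > y induces the same local ordering, enumerated by `locRank`,
and J lies in V(L) exactly when the set of its leading exponents is that of L
(`mem_groebnerCell_iff`). An ideal with these leading exponents contains a power of the maximal
ideal 𝔪 (`ordGE_le_of_isLead`), so division in R is only needed up to high order and no limits are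
taken.

Bijection. The signed maximal minors g_i of H + N satisfy g_t = y^{m_t} and y^{d_j} g_j = x g_{j+1}
- ∑_{i>j} n_{ij} g_i (indices from 0), and these relations determine them by descending induction.
Put δ_i = deg x^{t-i} y^{m_i} (`genDeg`). The order condition on N reads ord n_{ij} ≥ δ_{j+1} - δ_i
+ 1, which is what lets the recursion preserve the lead x^{t-i} y^{m_i} and the degree t - i in x
(`isStd_signedMinor`). Column operations make all coefficients of a combination of the g_i except
the first free of x, up to high order; the terms then have distinct leads, so nothing cancels. This
puts I_t(H + N) in the cell (`isLead_idealOf_iff`) and shows that the constant terms of any syzygy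
lie in the column space of H + N modulo 𝔪 (`exists_mulVec_eq_coeff_zero`). Conversely, for J in the
cell, dividing the coefficients by y^{d_j} produces the columns of N one at a time, from the last to
the first (`exists_column`); remainders of degree < d_j are unique, which gives injectivity
(`injOn_idealOf`).

Betti strata. H vanishes modulo 𝔪, so J/𝔪J is the cokernel of N̄ at the point, and μ(J) = t + 1 -
rank N̄ (`spanFinrank_cellMap`). Ranks are read off from minors.

The generic stratum. A constant term is free at (i, j) iff δ_{j+1} < δ_i. The jumps of h from degree
t - 1 on count the generators, the first one left out, of each degree. A degree shared by Δ(h) of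
them forces rank N̄ ≤ t - Δ(h) (`rank_constAt_add_maxJump_le`). The entries on the diagonal i = j +
Δ(h) + 1 are all free, and setting them to 1 attains this rank (`exists_minor_eval_eq_one`). This
rational point makes the open stratum nonempty over any field; the chain of primes below it gives
the dimension. -/

/-- The position of an exponent in the local ordering. -/
def locRank (e : Fin 2 →₀ ℕ) : ℕ := (e 0 + e 1 + 1).choose 2 + e 1

theorem expo_ext {a b : Fin 2 →₀ ℕ} (h0 : a 0 = b 0) (h1 : a 1 = b 1) : a = b := by
  ext i; fin_cases i <;> assumption

theorem locRank_lt_of_lt {a b : Fin 2 →₀ ℕ} (h : a 0 + a 1 < b 0 + b 1) :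
    locRank a < locRank b := by
  have h1 : (a 0 + a 1 + 1 + 1).choose 2 ≤ (b 0 + b 1 + 1).choose 2 := Nat.choose_mono 2 (by omega)
  have h2 : (a 0 + a 1 + 1 + 1).choose 2 = (a 0 + a 1 + 1) + (a 0 + a 1 + 1).choose 2 := by
    rw [Nat.choose_succ_succ' _ 1, Nat.choose_one_right]
  unfold locRank
  omega

theorem locRank_lt_iff {a b : Fin 2 →₀ ℕ} :
    locRank a < locRank b ↔ a 0 + a 1 < b 0 + b 1 ∨ (a 0 + a 1 = b 0 + b 1 ∧ a 1 < b 1) := by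
  rcases lt_trichotomy (a 0 + a 1) (b 0 + b 1) with h | h | h
  · exact ⟨fun _ => Or.inl h, fun _ => locRank_lt_of_lt h⟩
  · unfold locRank; rw [h]; omega
  · have := locRank_lt_of_lt h
    omega

theorem locRank_injective : Function.Injective locRank := by
  intro a b h
  have h1 := (locRank_lt_iff (a := a) (b := b)).not.mp (by omega)
  have h2 := (locRank_lt_iff (a := b) (b := a)).not.mp (by omega)
  apply expo_ext <;> omega

theorem locRank_add_lt {a b : Fin 2 →₀ ℕ} (c : Fin 2 →₀ ℕ) (h : locRank a < locRank b) :
    locRank (a + c) < locRank (b + c) := by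
  rw [locRank_lt_iff] at *
  simp only [Finsupp.add_apply]
  omega

theorem locRank_le_add (a c : Fin 2 →₀ ℕ) : locRank a ≤ locRank (a + c) := by
  by_contra! h
  rw [locRank_lt_iff] at h
  simp only [Finsupp.add_apply] at h
  omega

theorem degree_le_locRank (a : Fin 2 →₀ ℕ) : a 0 + a 1 ≤ locRank a := by
  unfold locRank
  have : (a 0 + a 1 + 1).choose 2 = (a 0 + a 1).choose 1 + (a 0 + a 1).choose 2 :=
    Nat.choose_succ_succ' _ 1
  rw [Nat.choose_one_right] at this
  omega

theorem locRank_lt_bound {a : Fin 2 →₀ ℕ} {d : ℕ} (h : a 0 + a 1 < d) :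
    locRank a < (d + 1).choose 2 := by
  have h1 : (a 0 + a 1 + 1 + 1).choose 2 ≤ (d + 1).choose 2 := Nat.choose_mono 2 (by omega)
  have h2 : (a 0 + a 1 + 1 + 1).choose 2 = (a 0 + a 1 + 1) + (a 0 + a 1 + 1).choose 2 := by
    rw [Nat.choose_succ_succ' _ 1, Nat.choose_one_right]
  unfold locRank
  omega

/-- After cancelling the common factor, two monomials of equal degree become a power of x and the
same power of y, so x > y decides. -/
theorem monomialOrder_lt_iff {τ : MonomialOrder (Fin 2)}
    (hτ : Finsupp.single 1 1 ≺[τ] Finsupp.single 0 1) {a b : Fin 2 →₀ ℕ}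
    (hab : a 0 + a 1 = b 0 + b 1) : b ≺[τ] a ↔ a 1 < b 1 := by
  have key : ∀ a b : Fin 2 →₀ ℕ, a 0 + a 1 = b 0 + b 1 → a 1 < b 1 → b ≺[τ] a := by
    intro a b hab h
    have ha : a = (Finsupp.single 0 (b 0) + Finsupp.single 1 (a 1)) +
        (b 1 - a 1) • Finsupp.single 0 1 := by
      apply expo_ext <;> simp
      omega
    have hb : b = (Finsupp.single 0 (b 0) + Finsupp.single 1 (a 1)) +
        (b 1 - a 1) • Finsupp.single 1 1 := by
      apply expo_ext <;> simp
      omega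
    have hlt : (b 1 - a 1) • Finsupp.single 1 1 ≺[τ] (b 1 - a 1) • Finsupp.single 0 1 := by
      rw [map_nsmul, map_nsmul]
      exact nsmul_lt_nsmul_right (by omega) hτ
    calc τ.toSyn b = _ := congrArg τ.toSyn hb
      _ < _ := by
        rw [map_add, map_add τ.toSyn _ ((b 1 - a 1) • Finsupp.single 0 1)]
        exact add_lt_add_right hlt _
      _ = τ.toSyn a := (congrArg τ.toSyn ha).symm
  refine ⟨fun h => ?_, key a b hab⟩
  by_contra! h'
  rcases h'.lt_or_eq with h1 | h1
  · exact lt_asymm h (key b a hab.symm h1)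
  · have : a = b := expo_ext (by omega) h1.symm
    subst this
    exact lt_irrefl _ h

/-- This eliminates `τ`: from here on the ordering is comparison of natural numbers. -/
theorem localGT_iff {τ : MonomialOrder (Fin 2)}
    (hτ : Finsupp.single 1 1 ≺[τ] Finsupp.single 0 1) {a b : Fin 2 →₀ ℕ} :
    LocalGT τ a b ↔ locRank a < locRank b := by
  have hd : ∀ e : Fin 2 →₀ ℕ, e.degree = e 0 + e 1 := fun e => by
    rw [Finsupp.degree_eq_sum, Fin.sum_univ_two]
  rw [locRank_lt_iff, LocalGT, hd, hd]
  refine or_congr Iff.rfl ⟨fun h => ⟨h.1, (monomialOrder_lt_iff hτ h.1).mp h.2⟩,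
    fun h => ⟨h.1, (monomialOrder_lt_iff hτ h.1).mpr h.2⟩⟩

/-! ### Leading exponents and the associated filtration -/

section Lead

variable {k : Type*} [Field k]

/-- The ideal of the power series all of whose exponents have position at least `n`. -/
def locFil (k : Type*) [Field k] (n : ℕ) : Ideal (R k) where
  carrier := {f | ∀ e, locRank e < n → MvPowerSeries.coeff e f = 0}
  zero_mem' := by simp
  add_mem' := by
    intro f g hf hg e he
    rw [map_add, hf e he, hg e he, add_zero]
  smul_mem' := by
    intro c f hf e he
    classical
    rw [smul_eq_mul, MvPowerSeries.coeff_mul]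
    refine Finset.sum_eq_zero fun p hp => ?_
    rw [Finset.HasAntidiagonal.mem_antidiagonal] at hp
    rw [hf p.2, mul_zero]
    refine lt_of_le_of_lt ?_ he
    rw [← hp, add_comm]
    exact locRank_le_add _ _

theorem locFil_anti {n n' : ℕ} (h : n ≤ n') : locFil k n' ≤ locFil k n :=
  fun _ hf e he => hf e (he.trans_le h)

theorem smul_mem_locFil {n : ℕ} {f : R k} (hf : f ∈ locFil k n) (c : k) : c • f ∈ locFil k n := by
  intro e he
  rw [MvPowerSeries.coeff_smul, hf e he, mul_zero]

/-- `a` is the leading exponent of `f`. -/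
def IsLead (f : R k) (a : Fin 2 →₀ ℕ) : Prop :=
  MvPowerSeries.coeff a f ≠ 0 ∧ f ∈ locFil k (locRank a)

theorem isLeadingExp_iff {τ : MonomialOrder (Fin 2)}
    (hτ : Finsupp.single 1 1 ≺[τ] Finsupp.single 0 1) {f : R k} {a : Fin 2 →₀ ℕ} :
    IsLeadingExp τ f a ↔ IsLead f a := by
  refine and_congr Iff.rfl ⟨fun h e he => ?_, fun h b hb hba => ?_⟩
  · by_contra hne
    have hea : e ≠ a := fun h => by subst h; exact lt_irrefl _ he
    exact lt_asymm he ((localGT_iff hτ).mp (h e hne hea))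
  · rw [localGT_iff hτ]
    have h1 : ¬ locRank b < locRank a := fun hlt => hb (h b hlt)
    rcases (not_lt.mp h1).lt_or_eq with h2 | h2
    · exact h2
    · exact absurd (locRank_injective h2.symm) hba

theorem exists_isLead {f : R k} (hf : f ≠ 0) : ∃ a, IsLead f a := by
  have hne : ∃ n, ∃ a, locRank a = n ∧ MvPowerSeries.coeff a f ≠ 0 := by
    by_contra! h
    exact hf (MvPowerSeries.ext fun a => h _ a rfl)
  classical
  obtain ⟨a, ha, hfa⟩ := Nat.find_spec hne
  refine ⟨a, hfa, fun e he => ?_⟩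
  by_contra hne'
  exact Nat.find_min hne (ha ▸ he) ⟨e, rfl, hne'⟩

theorem IsLead.ne_zero {f : R k} {a : Fin 2 →₀ ℕ} (h : IsLead f a) : f ≠ 0 := by
  rintro rfl
  exact h.1 (map_zero _)

theorem IsLead.mem_locFil_iff {f : R k} {a : Fin 2 →₀ ℕ} (h : IsLead f a) {n : ℕ} :
    f ∈ locFil k n ↔ n ≤ locRank a := by
  refine ⟨fun hf => ?_, fun hn => locFil_anti hn h.2⟩
  by_contra! hlt
  exact h.1 (hf a hlt)

theorem IsLead.unique {f : R k} {a b : Fin 2 →₀ ℕ} (ha : IsLead f a) (hb : IsLead f b) :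
    a = b :=
  locRank_injective (le_antisymm (hb.mem_locFil_iff.mp ha.2) (ha.mem_locFil_iff.mp hb.2))

theorem IsLead.congr {f g : R k} {a : Fin 2 →₀ ℕ} (h : IsLead f a) {n : ℕ} (hn : locRank a < n)
    (hfg : f - g ∈ locFil k n) : IsLead g a := by
  have hc : ∀ e, locRank e < n → MvPowerSeries.coeff e f = MvPowerSeries.coeff e g := by
    intro e he
    have := hfg e he
    rwa [map_sub, sub_eq_zero] at this
  refine ⟨hc a hn ▸ h.1, fun e he => ?_⟩
  rw [← hc e (he.trans hn)]
  exact h.2 e he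

theorem IsLead.mul {f g : R k} {a b : Fin 2 →₀ ℕ} (hf : IsLead f a) (hg : IsLead g b) :
    IsLead (f * g) (a + b) := by
  classical
  -- Both exponents start at or after their leads, and addition is strictly monotone for `locRank`,
  -- so every pair other than (a, b) contributes strictly after a + b.
  have key : ∀ p : (Fin 2 →₀ ℕ) × (Fin 2 →₀ ℕ), locRank (p.1 + p.2) ≤ locRank (a + b) →
      p ≠ (a, b) → MvPowerSeries.coeff p.1 f * MvPowerSeries.coeff p.2 g = 0 := by
    rintro ⟨p, q⟩ hpq hne
    by_contra hmul
    have hp : locRank a ≤ locRank p := by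
      by_contra! h
      exact (left_ne_zero_of_mul hmul) (hf.2 p h)
    have hq : locRank b ≤ locRank q := by
      by_contra! h
      exact (right_ne_zero_of_mul hmul) (hg.2 q h)
    rcases hp.lt_or_eq with h1 | h1
    · have h2 := locRank_add_lt q h1
      rcases hq.lt_or_eq with h3 | h3
      · have h4 := locRank_add_lt a h3
        rw [add_comm b, add_comm q a] at h4
        simp only at hpq
        omega
      · rw [← locRank_injective h3] at h2
        simp only [← locRank_injective h3] at hpq
        omega
    · have hpa := (locRank_injective h1).symm
      subst hpa
      rcases hq.lt_or_eq with h3 | h3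
      · have h4 := locRank_add_lt p h3
        rw [add_comm b, add_comm q p] at h4
        simp only at hpq
        omega
      · exact hne (by rw [locRank_injective h3])
  refine ⟨?_, fun e he => ?_⟩
  · rw [MvPowerSeries.coeff_mul, Finset.sum_eq_single (a, b)]
    · exact mul_ne_zero hf.1 hg.1
    · intro p hp hne
      rw [Finset.HasAntidiagonal.mem_antidiagonal] at hp
      exact key p (by rw [hp]) hne
    · intro h
      rw [Finset.HasAntidiagonal.mem_antidiagonal] at h
      exact absurd rfl h
  · rw [MvPowerSeries.coeff_mul]
    refine Finset.sum_eq_zero fun p hp => ?_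
    have hpe : p.1 + p.2 = e := Finset.HasAntidiagonal.mem_antidiagonal.mp hp
    refine key p (hpe ▸ he.le) fun h => ?_
    subst h
    simp only at hpe
    subst hpe
    exact lt_irrefl _ he

/-- In a finite sum of power series with distinct leading exponents, no cancellation occurs. -/
theorem exists_isLead_sum {ι : Type*} {s : Finset ι} {B : ι → R k}
    (hB : ∀ i ∈ s, ∀ j ∈ s, ∀ a, IsLead (B i) a → IsLead (B j) a → i = j)
    (hne : ∃ i ∈ s, B i ≠ 0) :
    ∃ i ∈ s, ∃ a, IsLead (B i) a ∧ IsLead (∑ i ∈ s, B i) a ∧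
      ∀ j ∈ s, B j ∈ locFil k (locRank a) := by
  classical
  have hex : ∃ n, ∃ i ∈ s, ∃ a, locRank a = n ∧ IsLead (B i) a := by
    obtain ⟨i, hi, hBi⟩ := hne
    obtain ⟨a, ha⟩ := exists_isLead hBi
    exact ⟨_, i, hi, a, rfl, ha⟩
  obtain ⟨i, hi, a, han, ha⟩ := Nat.find_spec hex
  have hmem : ∀ j ∈ s, B j ∈ locFil k (locRank a) := by
    intro j hj
    by_cases hj0 : B j = 0
    · rw [hj0]; exact Ideal.zero_mem _
    · obtain ⟨b, hb⟩ := exists_isLead hj0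
      rw [hb.mem_locFil_iff, han]
      exact Nat.find_min' hex ⟨j, hj, b, rfl, hb⟩
  refine ⟨i, hi, a, ha, ⟨?_, Ideal.sum_mem _ hmem⟩, hmem⟩
  rw [map_sum, Finset.sum_eq_single i]
  · exact ha.1
  · intro j hj hji
    by_contra hc
    exact hji (hB j hj i hi a ⟨hc, hmem j hj⟩ ha)
  · exact fun h => absurd hi h

/-- The earliest lead among the terms is the lead of the sum, so a bound on the sum bounds every
term. This is how vanishing of coefficients is extracted from a relation. -/
theorem mem_locFil_of_sum_mem {ι : Type*} {s : Finset ι} {B : ι → R k}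
    (hB : ∀ i ∈ s, ∀ j ∈ s, ∀ a, IsLead (B i) a → IsLead (B j) a → i = j) {n : ℕ}
    (hsum : ∑ i ∈ s, B i ∈ locFil k n) : ∀ i ∈ s, B i ∈ locFil k n := by
  intro i hi
  by_cases hne : ∃ i ∈ s, B i ≠ 0
  · obtain ⟨j, -, a, -, hsa, hmem⟩ := exists_isLead_sum hB hne
    exact locFil_anti (hsa.mem_locFil_iff.mp hsum) (hmem i hi)
  · push Not at hne
    rw [hne i hi]
    exact Ideal.zero_mem _

theorem isLead_monomial (a : Fin 2 →₀ ℕ) {c : k} (hc : c ≠ 0) :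
    IsLead (MvPowerSeries.monomial a c) a := by
  refine ⟨by rwa [MvPowerSeries.coeff_monomial_same], fun e he => ?_⟩
  rw [MvPowerSeries.coeff_monomial_ne]
  rintro rfl
  exact lt_irrefl _ he

end Lead

/-! ### Exponents of the monomial ideal and membership in the cell -/

/-- `e` is the exponent of a monomial of `monIdeal k m`. -/
def InMon {t : ℕ} (m : Fin (t + 1) → ℕ) (e : Fin 2 →₀ ℕ) : Prop :=
  ∃ i : Fin (t + 1), t - (i : ℕ) ≤ e 0 ∧ m i ≤ e 1

/-- The exponent of the `i`-th generator of `monIdeal k m`. -/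
noncomputable def genExp {t : ℕ} (m : Fin (t + 1) → ℕ) (i : Fin (t + 1)) : Fin 2 →₀ ℕ :=
  Finsupp.single 0 (t - (i : ℕ)) + Finsupp.single 1 (m i)

@[simp] theorem genExp_zero {t : ℕ} (m : Fin (t + 1) → ℕ) (i : Fin (t + 1)) :
    genExp m i 0 = t - (i : ℕ) := by simp [genExp]

@[simp] theorem genExp_one {t : ℕ} (m : Fin (t + 1) → ℕ) (i : Fin (t + 1)) :
    genExp m i 1 = m i := by simp [genExp]

theorem expo_le_iff {a b : Fin 2 →₀ ℕ} : a ≤ b ↔ a 0 ≤ b 0 ∧ a 1 ≤ b 1 := by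
  rw [Finsupp.le_def, Fin.forall_fin_two]

theorem inMon_iff {t : ℕ} {m : Fin (t + 1) → ℕ} {e : Fin 2 →₀ ℕ} :
    InMon m e ↔ ∃ i, genExp m i ≤ e := by
  simp [InMon, expo_le_iff]

theorem inMon_genExp {t : ℕ} (m : Fin (t + 1) → ℕ) (i : Fin (t + 1)) : InMon m (genExp m i) :=
  inMon_iff.mpr ⟨i, le_rfl⟩

theorem InMon.mono {t : ℕ} {m : Fin (t + 1) → ℕ} {e e' : Fin 2 →₀ ℕ} (h : InMon m e)
    (hle : e ≤ e') : InMon m e' := by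
  obtain ⟨i, hi⟩ := inMon_iff.mp h
  exact inMon_iff.mpr ⟨i, hi.trans hle⟩

section Cell

variable {k : Type*} [Field k] {t : ℕ} {m : Fin (t + 1) → ℕ}

theorem monIdeal_eq (k : Type*) [Field k] (m : Fin (t + 1) → ℕ) : monIdeal k m =
    Ideal.span ((fun s => MvPolynomial.monomial s (1 : k)) '' Set.range (genExp m)) := by
  rw [monIdeal, ← Set.range_comp]
  congr 2
  funext i
  rw [MvPolynomial.X_pow_eq_monomial, MvPolynomial.X_pow_eq_monomial, MvPolynomial.monomial_mul,
    one_mul]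
  rfl

theorem monomial_mem_monIdeal {e : Fin 2 →₀ ℕ} :
    MvPolynomial.monomial e (1 : k) ∈ monIdeal k m ↔ InMon m e := by
  classical
  rw [monIdeal_eq, MvPolynomial.mem_ideal_span_monomial_image, inMon_iff,
    MvPolynomial.support_monomial, if_neg one_ne_zero]
  simp

/-- Leading exponents of an ideal are closed under adding exponents (multiply by a monomial), so a
monomial of the leading ideal is itself a leading term. Comparing monomial ideals thus reduces to
comparing sets of exponents. -/
theorem mem_groebnerCell_iff {τ : MonomialOrder (Fin 2)}
    (hτ : Finsupp.single 1 1 ≺[τ] Finsupp.single 0 1) {J : Ideal (R k)} :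
    J ∈ groebnerCell τ (monIdeal k m) ↔ ∀ e, (∃ f ∈ J, IsLead f e) ↔ InMon m e := by
  have hlead : leadingIdeal τ J =
      Ideal.span ((fun s => MvPolynomial.monomial s (1 : k)) '' {e | ∃ f ∈ J, IsLead f e}) := by
    rw [leadingIdeal]
    congr 1
    ext p
    simp only [isLeadingExp_iff hτ, Set.mem_ofPred_eq, Set.mem_image]
    constructor
    · rintro ⟨f, hf, a, ha, rfl⟩
      exact ⟨a, ⟨f, hf, ha⟩, rfl⟩
    · rintro ⟨a, ⟨f, hf, ha⟩, rfl⟩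
      exact ⟨f, hf, a, ha, rfl⟩
  have hmem : ∀ e, MvPolynomial.monomial e (1 : k) ∈ leadingIdeal τ J ↔ ∃ f ∈ J, IsLead f e := by
    classical
    intro e
    rw [hlead, MvPolynomial.mem_ideal_span_monomial_image, MvPolynomial.support_monomial,
      if_neg one_ne_zero]
    simp only [Finset.mem_singleton, forall_eq, Set.mem_ofPred_eq]
    constructor
    · rintro ⟨a, ⟨f, hf, ha⟩, hae⟩
      refine ⟨MvPowerSeries.monomial (e - a) 1 * f, J.mul_mem_left _ hf, ?_⟩
      have := (isLead_monomial (e - a) (one_ne_zero (α := k))).mul ha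
      rwa [tsub_add_cancel_of_le hae] at this
    · rintro h
      exact ⟨e, h, le_rfl⟩
  constructor
  · intro h e
    rw [← hmem, show leadingIdeal τ J = monIdeal k m from h, monomial_mem_monIdeal]
  · intro h
    change leadingIdeal τ J = monIdeal k m
    apply le_antisymm
    · rw [hlead, Ideal.span_le]
      rintro _ ⟨e, he, rfl⟩
      exact monomial_mem_monIdeal.mpr ((h e).mp he)
    · rw [monIdeal_eq, Ideal.span_le]
      rintro _ ⟨_, ⟨i, rfl⟩, rfl⟩
      exact (hmem _).mpr ((h _).mpr (inMon_genExp m i))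

end Cell

/-! ### Maximal minors of a `(t + 1) × t` matrix -/

section Minors

variable {A : Type*} [CommRing A] {t : ℕ}

/-- The maximal minor of `M` obtained by deleting the row `i`, with sign. -/
def signedMinor (M : Matrix (Fin (t + 1)) (Fin t) A) (i : Fin (t + 1)) : A :=
  (-1) ^ ((i : ℕ) + t) * (M.submatrix i.succAbove id).det

/-- Laplace expansion along the first column of the square matrix in which column j is repeated in
front; its determinant is 0. -/
theorem sum_signedMinor_mul (M : Matrix (Fin (t + 1)) (Fin t) A) (j : Fin t) :
    ∑ i, signedMinor M i * M i j = 0 := by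
  have hdet : (Matrix.of fun i => Fin.cons (M i j) (M i) :
      Matrix (Fin (t + 1)) (Fin (t + 1)) A).det = 0 := by
    refine Matrix.det_zero_of_column_eq (i := 0) (j := j.succ) (Fin.succ_ne_zero j).symm ?_
    intro i
    simp
  rw [Matrix.det_succ_column_zero] at hdet
  have := congrArg (fun a => (-1) ^ t * a) hdet
  simp only [mul_zero, Finset.mul_sum] at this
  rw [← this]
  refine Finset.sum_congr rfl fun i _ => ?_
  rw [signedMinor, pow_add]
  have hsub : ((Matrix.of fun i => Fin.cons (M i j) (M i) :
      Matrix (Fin (t + 1)) (Fin (t + 1)) A).submatrix i.succAbove Fin.succ) =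
      M.submatrix i.succAbove id := by
    ext a b
    simp
  rw [hsub]
  simp
  ring

theorem orderEmb_fin_eq_id (g : Fin t ↪o Fin t) : (g : Fin t → Fin t) = id :=
  (StrictMono.range_inj g.strictMono strictMono_id).mp (by
    rw [Set.range_id, Set.range_eq_univ]
    exact Finite.surjective_of_injective g.injective)

theorem exists_eq_succAbove (f : Fin t ↪o Fin (t + 1)) :
    ∃ i : Fin (t + 1), (f : Fin t → Fin (t + 1)) = i.succAbove := by
  classical
  have hcard : (Finset.univ.image f)ᶜ.card = 1 := by
    rw [Finset.card_compl, Finset.card_image_of_injective _ f.injective]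
    simp
  obtain ⟨i, hi⟩ := Finset.card_eq_one.mp hcard
  refine ⟨i, (StrictMono.range_inj f.strictMono (Fin.strictMono_succAbove i)).mp ?_⟩
  rw [Fin.range_succAbove]
  have := congrArg (fun s : Finset (Fin (t + 1)) => ((sᶜ : Finset (Fin (t + 1))) : Set (Fin (t + 1)))) hi
  simpa using this

theorem minorIdeal_eq_span (M : Matrix (Fin (t + 1)) (Fin t) A) :
    minorIdeal t M = Ideal.span (Set.range (signedMinor M)) := by
  have hunit : ∀ i : Fin (t + 1), (M.submatrix i.succAbove id).det =
      (-1) ^ ((i : ℕ) + t) * signedMinor M i := by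
    intro i
    rw [signedMinor, ← mul_assoc, ← pow_add, ← two_mul, pow_mul]
    simp
  apply le_antisymm
  · rw [minorIdeal, Ideal.span_le]
    rintro _ ⟨f, g, rfl⟩
    obtain ⟨i, hi⟩ := exists_eq_succAbove f
    rw [hi, orderEmb_fin_eq_id g, hunit]
    exact Ideal.mul_mem_left _ _ (Ideal.subset_span ⟨i, rfl⟩)
  · rw [Ideal.span_le]
    rintro _ ⟨i, rfl⟩
    refine Ideal.mul_mem_left _ _ (Ideal.subset_span ⟨Fin.succAboveOrderEmb i, RelEmbedding.refl _, ?_⟩)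
    rfl

/-- Deleting the last row leaves a lower triangular matrix. The sign is normalised by (-1)^t so that
this minor carries no sign. -/
theorem signedMinor_last (M : Matrix (Fin (t + 1)) (Fin t) A)
    (hM : ∀ (i : Fin (t + 1)) (j : Fin t), (i : ℕ) < j → M i j = 0) :
    signedMinor M (Fin.last t) = ∏ j, M j.castSucc j := by
  rw [signedMinor, Fin.val_last, ← two_mul, pow_mul]
  rw [Matrix.det_of_isLowerTriangular]
  · simp
  · intro i j hij
    exact hM _ _ (by simpa using hij)

/-- A row vector killed by a lower triangular matrix with regular diagonal is determined by its
last entry. -/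
theorem eq_of_sum_mul_eq_zero {M : Matrix (Fin (t + 1)) (Fin t) A}
    (hM : ∀ (i : Fin (t + 1)) (j : Fin t), (i : ℕ) < j → M i j = 0)
    (hd : ∀ j, IsLeftRegular (M j.castSucc j)) {g g' : Fin (t + 1) → A}
    (hg : ∀ j, ∑ i, g i * M i j = 0) (hg' : ∀ j, ∑ i, g' i * M i j = 0)
    (hlast : g (Fin.last t) = g' (Fin.last t)) : g = g' := by
  suffices h : ∀ n, ∀ i : Fin (t + 1), t - (i : ℕ) ≤ n → g i = g' i from
    funext fun i => h t i (Nat.sub_le _ _)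
  intro n
  induction n with
  | zero =>
    intro i hi
    have : i = Fin.last t := by ext; simp; omega
    rw [this, hlast]
  | succ n ih =>
    intro i hi
    induction i using Fin.lastCases with
    | last => exact hlast
    | cast j =>
      have h1 : ∑ i, (g i - g' i) * M i j = 0 := by
        simp only [sub_mul, Finset.sum_sub_distrib, hg, hg', sub_zero]
      rw [Finset.sum_eq_single j.castSucc] at h1
      · rw [mul_comm] at h1
        exact sub_eq_zero.mp (hd j (by simpa using h1))
      · intro i _ hij
        rcases lt_or_ge (i : ℕ) j with h2 | h2
        · rw [hM i j h2, mul_zero]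
        · have h3 : (i : ℕ) ≠ j := fun h => hij (Fin.ext (by simpa using h))
          have := i.2
          simp only [Fin.val_castSucc] at hi
          rw [ih i (by omega), sub_self, zero_mul]
      · simp

end Minors

theorem sum_diff {t : ℕ} {m : Fin (t + 1) → ℕ} (hm : StrictMono m) :
    ∑ j, diff m j + m 0 = m (Fin.last t) := by
  induction t with
  | zero => simp
  | succ t ih =>
    have h1 := ih (m := m ∘ Fin.castSucc) (hm.comp (Fin.strictMono_castSucc))
    rw [Fin.sum_univ_castSucc]
    have h2 : m (Fin.last t).castSucc < m (Fin.last (t + 1)) := hm (Fin.castSucc_lt_last _)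
    have h3 : ∀ j : Fin t, diff m j.castSucc = diff (m ∘ Fin.castSucc) j := by
      intro j
      simp only [diff, Function.comp_apply, Fin.succ_castSucc]
    simp only [h3]
    have h4 : diff m (Fin.last t) = m (Fin.last (t + 1)) - m (Fin.last t).castSucc := rfl
    simp only [Function.comp_apply, Fin.castSucc_zero] at h1
    omega

theorem diff_pos {t : ℕ} {m : Fin (t + 1) → ℕ} (hm : StrictMono m) (j : Fin t) :
    0 < diff m j := Nat.sub_pos_of_lt (hm (Fin.castSucc_lt_succ))

theorem add_diff {t : ℕ} {m : Fin (t + 1) → ℕ} (hm : StrictMono m) (j : Fin t) :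
    m j.castSucc + diff m j = m j.succ :=
  Nat.add_sub_cancel' (hm (Fin.castSucc_lt_succ)).le

/-! ### The matrix `H + N` -/

section HB

variable {k : Type*} [Field k] {t : ℕ}

/-- The embedding `k[y] → k⟦x, y⟧`. -/
noncomputable def yEmb (k : Type*) [Field k] : Polynomial k →ₐ[k] R k :=
  Polynomial.aeval (MvPowerSeries.X 1 : R k)

/-- The matrix `H + N`. -/
noncomputable def fullMatrix (m : Fin (t + 1) → ℕ)
    (N : Matrix (Fin (t + 1)) (Fin t) (Polynomial k)) : Matrix (Fin (t + 1)) (Fin t) (R k) :=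
  hbMatrix k m + N.map fun p => Polynomial.aeval (MvPowerSeries.X 1 : R k) p

theorem fullMatrix_apply (m : Fin (t + 1) → ℕ) (N : Matrix (Fin (t + 1)) (Fin t) (Polynomial k))
    (i : Fin (t + 1)) (j : Fin t) :
    fullMatrix m N i j = hbMatrix k m i j + yEmb k (N i j) := rfl

/-- A row vector killed by `H + N` satisfies a recursion. -/
theorem sum_mul_fullMatrix (m : Fin (t + 1) → ℕ) (N : Matrix (Fin (t + 1)) (Fin t) (Polynomial k))
    (g : Fin (t + 1) → R k) (j : Fin t) :
    ∑ i, g i * fullMatrix m N i j = MvPowerSeries.X 1 ^ diff m j * g j.castSucc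
      - MvPowerSeries.X 0 * g j.succ + ∑ i, yEmb k (N i j) * g i := by
  have h1 : ∀ i, g i * hbMatrix k m i j =
      (if i = j.castSucc then MvPowerSeries.X 1 ^ diff m j * g j.castSucc else 0) +
      (if i = j.succ then -(MvPowerSeries.X 0 * g j.succ) else 0) := by
    intro i
    unfold hbMatrix
    by_cases h : i = j.castSucc
    · subst h
      rw [if_pos rfl, if_pos rfl, if_neg (Fin.castSucc_lt_succ).ne, add_zero, mul_comm]
    · rw [if_neg h, if_neg h, zero_add]
      by_cases h' : i = j.succ
      · subst h'
        rw [if_pos rfl, if_pos rfl, mul_neg, mul_comm]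
      · rw [if_neg h', if_neg h', mul_zero]
  simp only [fullMatrix_apply, mul_add, h1, Finset.sum_add_distrib, Finset.sum_ite_eq',
    Finset.mem_univ, if_true, sub_eq_add_neg]
  congr 1
  exact Finset.sum_congr rfl fun i _ => mul_comm _ _

theorem fullMatrix_of_lt {m : Fin (t + 1) → ℕ} {N : Matrix (Fin (t + 1)) (Fin t) (Polynomial k)}
    (hN : ∀ (i : Fin (t + 1)) (j : Fin t), (i : ℕ) ≤ j → N i j = 0)
    (i : Fin (t + 1)) (j : Fin t) (h : (i : ℕ) < j) : fullMatrix m N i j = 0 := by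
  rw [fullMatrix_apply, hN i j h.le, map_zero, add_zero, hbMatrix, if_neg, if_neg]
  · rintro rfl
    simp only [Fin.val_succ] at h
    omega
  · rintro rfl
    simp at h

theorem fullMatrix_diag {m : Fin (t + 1) → ℕ} {N : Matrix (Fin (t + 1)) (Fin t) (Polynomial k)}
    (hN : ∀ (i : Fin (t + 1)) (j : Fin t), (i : ℕ) ≤ j → N i j = 0) (j : Fin t) :
    fullMatrix m N j.castSucc j = MvPowerSeries.X 1 ^ diff m j := by
  rw [fullMatrix_apply, hN _ j (by simp), map_zero, add_zero, hbMatrix, if_pos rfl]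

theorem signedMinor_fullMatrix_last {m : Fin (t + 1) → ℕ} (hm : IsLexSegment m)
    {N : Matrix (Fin (t + 1)) (Fin t) (Polynomial k)}
    (hN : ∀ (i : Fin (t + 1)) (j : Fin t), (i : ℕ) ≤ j → N i j = 0) :
    signedMinor (fullMatrix m N) (Fin.last t) = MvPowerSeries.X 1 ^ m (Fin.last t) := by
  rw [signedMinor_last _ (fullMatrix_of_lt hN)]
  simp only [fullMatrix_diag hN]
  rw [Finset.prod_pow_eq_pow_sum, ← sum_diff hm.2.2, hm.2.1, add_zero]

theorem idealOf_eq_span (m : Fin (t + 1) → ℕ) (N : Matrix (Fin (t + 1)) (Fin t) (Polynomial k)) :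
    idealOf m N = Ideal.span (Set.range (signedMinor (fullMatrix m N))) :=
  minorIdeal_eq_span _

/-- The syzygy of column j, solved for its diagonal term. For N strictly lower triangular the right
side involves only minors with index above j. -/
theorem signedMinor_fullMatrix_rec (m : Fin (t + 1) → ℕ)
    (N : Matrix (Fin (t + 1)) (Fin t) (Polynomial k)) (j : Fin t) :
    MvPowerSeries.X 1 ^ diff m j * signedMinor (fullMatrix m N) j.castSucc =
      MvPowerSeries.X 0 * signedMinor (fullMatrix m N) j.succ -
        ∑ i, yEmb k (N i j) * signedMinor (fullMatrix m N) i := by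
  have h1 := sum_mul_fullMatrix m N (signedMinor (fullMatrix m N)) j
  rw [sum_signedMinor_mul] at h1
  linear_combination h1.symm

theorem isLeftRegular_X_pow (n : ℕ) : IsLeftRegular (MvPowerSeries.X 1 ^ n : R k) :=
  (IsLeftCancelMulZero.mul_left_cancel_of_ne_zero (pow_ne_zero n (by
    intro h
    have := MvPowerSeries.coeff_index_single_self_X (R := k) (1 : Fin 2)
    rw [h, map_zero] at this
    exact zero_ne_one this)))

/-- The signed maximal minors of `H + N` are characterised by a recursion. -/
theorem eq_signedMinor_of_rec {m : Fin (t + 1) → ℕ} (hm : IsLexSegment m)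
    {N : Matrix (Fin (t + 1)) (Fin t) (Polynomial k)}
    (hN : ∀ (i : Fin (t + 1)) (j : Fin t), (i : ℕ) ≤ j → N i j = 0) {g : Fin (t + 1) → R k}
    (hlast : g (Fin.last t) = MvPowerSeries.X 1 ^ m (Fin.last t))
    (hg : ∀ j : Fin t, MvPowerSeries.X 1 ^ diff m j * g j.castSucc =
      MvPowerSeries.X 0 * g j.succ - ∑ i, yEmb k (N i j) * g i) :
    g = signedMinor (fullMatrix m N) := by
  refine eq_of_sum_mul_eq_zero (fullMatrix_of_lt hN) (fun j => ?_) (fun j => ?_)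
    (sum_signedMinor_mul _) ?_
  · rw [fullMatrix_diag hN]
    exact isLeftRegular_X_pow _
  · rw [sum_mul_fullMatrix, hg j]
    ring
  · rw [signedMinor_fullMatrix_last hm hN, hlast]

end HB

/-! ### Filtrations by degree in x and by order, and the image of k[y] -/

section Filtrations

variable {k : Type*} [Field k]

/-- The power series of degree at most `s` in `x`. -/
def xDegLE (k : Type*) [Field k] (s : ℕ) : Submodule k (R k) where
  carrier := {f | ∀ e : Fin 2 →₀ ℕ, s < e 0 → MvPowerSeries.coeff e f = 0}
  zero_mem' := by simp
  add_mem' := by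
    intro f g hf hg e he
    rw [map_add, hf e he, hg e he, add_zero]
  smul_mem' := by
    intro c f hf e he
    rw [MvPowerSeries.coeff_smul, hf e he, mul_zero]

theorem mul_mem_xDegLE {s s' : ℕ} {f g : R k} (hf : f ∈ xDegLE k s) (hg : g ∈ xDegLE k s') :
    f * g ∈ xDegLE k (s + s') := by
  classical
  intro e he
  rw [MvPowerSeries.coeff_mul]
  refine Finset.sum_eq_zero fun p hp => ?_
  rw [Finset.HasAntidiagonal.mem_antidiagonal] at hp
  subst hp
  rw [Finsupp.add_apply] at he
  rcases lt_or_ge s (p.1 0) with h | h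
  · rw [hf _ h, zero_mul]
  · rw [hg p.2 (by omega), mul_zero]

theorem xDegLE_mono {s s' : ℕ} (h : s ≤ s') : xDegLE k s ≤ xDegLE k s' :=
  fun _ hf e he => hf e (h.trans_lt he)

/-- The ideal of the power series of order at least `n`. -/
def ordGE (k : Type*) [Field k] (n : ℕ) : Ideal (R k) where
  carrier := {f | ∀ e : Fin 2 →₀ ℕ, e 0 + e 1 < n → MvPowerSeries.coeff e f = 0}
  zero_mem' := by simp
  add_mem' := by
    intro f g hf hg e he
    rw [map_add, hf e he, hg e he, add_zero]
  smul_mem' := by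
    intro c f hf e he
    classical
    rw [smul_eq_mul, MvPowerSeries.coeff_mul]
    refine Finset.sum_eq_zero fun p hp => ?_
    rw [Finset.HasAntidiagonal.mem_antidiagonal] at hp
    subst hp
    simp only [Finsupp.add_apply] at he
    rw [hf p.2 (by omega), mul_zero]

theorem mul_mem_ordGE {n n' : ℕ} {f g : R k} (hf : f ∈ ordGE k n) (hg : g ∈ ordGE k n') :
    f * g ∈ ordGE k (n + n') := by
  classical
  intro e he
  rw [MvPowerSeries.coeff_mul]
  refine Finset.sum_eq_zero fun p hp => ?_
  rw [Finset.HasAntidiagonal.mem_antidiagonal] at hp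
  subst hp
  simp only [Finsupp.add_apply] at he
  rcases lt_or_ge (p.1 0 + p.1 1) n with h | h
  · rw [hf _ h, zero_mul]
  · rw [hg p.2 (by omega), mul_zero]

theorem ordGE_anti {n n' : ℕ} (h : n ≤ n') : ordGE k n' ≤ ordGE k n :=
  fun _ hf e he => hf e (he.trans_le h)

theorem ordGE_le_locFil (n : ℕ) : ordGE k n ≤ locFil k n :=
  fun _ hf e he => hf e ((degree_le_locRank e).trans_lt he)

theorem locFil_choose_le_ordGE (d : ℕ) : locFil k ((d + 1).choose 2) ≤ ordGE k d :=
  fun _ hf e he => hf e (locRank_lt_bound he)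

theorem ordGE_le_locFil_choose (d : ℕ) : ordGE k d ≤ locFil k ((d + 1).choose 2) := by
  intro f hf e he
  refine hf e ?_
  by_contra! h
  have h1 : (d + 1).choose 2 ≤ (e 0 + e 1 + 1).choose 2 := Nat.choose_mono 2 (by omega)
  unfold locRank at he
  omega

theorem coeff_yEmb (p : Polynomial k) (e : Fin 2 →₀ ℕ) :
    MvPowerSeries.coeff e (yEmb k p) = if e 0 = 0 then p.coeff (e 1) else 0 := by
  classical
  induction p using Polynomial.induction_on' with
  | add p q hp hq =>
    rw [map_add, map_add, hp, hq, Polynomial.coeff_add]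
    split_ifs <;> simp
  | monomial n a =>
    rw [yEmb, Polynomial.aeval_monomial, MvPowerSeries.X_pow_eq, ← Algebra.smul_def,
      MvPowerSeries.coeff_smul, MvPowerSeries.coeff_monomial, Polynomial.coeff_monomial]
    by_cases h : e = Finsupp.single 1 n
    · subst h; simp
    · rw [if_neg h, mul_zero]
      by_cases h0 : e 0 = 0
      · rw [if_pos h0, if_neg]
        rintro rfl
        exact h (expo_ext (by simp [h0]) (by simp))
      · rw [if_neg h0]

theorem yEmb_mem_xDegLE (p : Polynomial k) : yEmb k p ∈ xDegLE k 0 := by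
  intro e he
  rw [coeff_yEmb, if_neg he.ne']

theorem yEmb_mem_ordGE {p : Polynomial k} {n : ℕ} (h : ∀ l < n, p.coeff l = 0) :
    yEmb k p ∈ ordGE k n := by
  intro e he
  rw [coeff_yEmb]
  split_ifs
  · exact h _ (by omega)
  · rfl

theorem isLead_yEmb {p : Polynomial k} (hp : p ≠ 0) :
    IsLead (yEmb k p) (Finsupp.single 1 p.natTrailingDegree) := by
  refine ⟨?_, fun e he => ?_⟩
  · rw [coeff_yEmb]
    simpa using hp
  · rw [coeff_yEmb]
    split_ifs with h
    · apply Polynomial.coeff_eq_zero_of_lt_natTrailingDegree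
      rw [locRank_lt_iff] at he
      simp only [h, Finsupp.single_apply] at he
      simp at he
      omega
    · rfl

theorem yEmb_X_pow (n : ℕ) : yEmb k (Polynomial.X ^ n) = MvPowerSeries.X 1 ^ n := by
  rw [yEmb, map_pow, Polynomial.aeval_X]

/-- If `p(y) g` is of high order, then so is every coefficient of `p`. -/
theorem coeff_eq_zero_of_yEmb_mul_mem {p : Polynomial k} {g : R k} {a : Fin 2 →₀ ℕ}
    (hg : IsLead g a) {n : ℕ} (h : yEmb k p * g ∈ locFil k n) {l : ℕ}
    (hl : locRank (a + Finsupp.single 1 l) < n) : p.coeff l = 0 := by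
  by_contra hne
  have hp : p ≠ 0 := by rintro rfl; simp at hne
  have h1 := ((isLead_yEmb hp).mul hg).mem_locFil_iff.mp h
  have h2 : p.natTrailingDegree ≤ l := Polynomial.natTrailingDegree_le_of_ne_zero hne
  have h3 : a + Finsupp.single 1 l = (Finsupp.single 1 p.natTrailingDegree + a) +
      Finsupp.single 1 (l - p.natTrailingDegree) := by
    apply expo_ext <;> simp
    omega
  rw [h3] at hl
  have := locRank_le_add (Finsupp.single 1 p.natTrailingDegree + a)
    (Finsupp.single 1 (l - p.natTrailingDegree))
  omega

theorem X_zero_mem_xDegLE : (MvPowerSeries.X 0 : R k) ∈ xDegLE k 1 := by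
  classical
  intro e he
  rw [MvPowerSeries.coeff_X, if_neg]
  rintro rfl
  simp at he

theorem X_mem_ordGE (s : Fin 2) : (MvPowerSeries.X s : R k) ∈ ordGE k 1 := by
  classical
  intro e he
  rw [MvPowerSeries.coeff_X, if_neg]
  rintro rfl
  fin_cases s <;> simp at he

theorem coeff_X_one_pow_mul (d : ℕ) (f : R k) (e : Fin 2 →₀ ℕ) :
    MvPowerSeries.coeff (e + Finsupp.single 1 d) (MvPowerSeries.X 1 ^ d * f) =
      MvPowerSeries.coeff e f := by
  rw [MvPowerSeries.X_pow_eq, add_comm, MvPowerSeries.coeff_add_monomial_mul, one_mul]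

theorem coeff_X_zero_mul (f : R k) (e : Fin 2 →₀ ℕ) :
    MvPowerSeries.coeff (e + Finsupp.single 0 1) (MvPowerSeries.X 0 * f) =
      MvPowerSeries.coeff e f := by
  rw [MvPowerSeries.X_def, add_comm, MvPowerSeries.coeff_add_monomial_mul, one_mul]

end Filtrations

/-! ### Lex-segment exponents -/

section Std

variable {k : Type*} [Field k] {t : ℕ} {m : Fin (t + 1) → ℕ}

/-- The degree of the `i`-th generator of the lex-segment ideal. -/
def genDeg (m : Fin (t + 1) → ℕ) (i : Fin (t + 1)) : ℕ := t - (i : ℕ) + m i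

theorem genDeg_eq (m : Fin (t + 1) → ℕ) (i : Fin (t + 1)) :
    genExp m i 0 + genExp m i 1 = genDeg m i := by
  rw [genExp_zero, genExp_one, genDeg]

theorem strictMono_gap (hm : StrictMono m) {i j : Fin (t + 1)} (hij : i ≤ j) :
    m i + ((j : ℕ) - i) ≤ m j := by
  have key : ∀ n (i j : Fin (t + 1)), (j : ℕ) = i + n → m i + n ≤ m j := by
    intro n
    induction n with
    | zero =>
      intro i j h
      rw [show i = j from Fin.ext (by omega)]
      omega
    | succ n ih =>
      intro i j h
      have h1 := ih i ⟨i + n, by omega⟩ rfl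
      have h2 : m ⟨i + n, by omega⟩ < m j := hm (by rw [Fin.lt_def]; simp; omega)
      omega
  exact key _ i j (by rw [Fin.le_def] at hij; omega)

/-- Each step lowers the exponent of x by one and raises that of y by at least one. This is the only
way in which the lex-segment hypothesis enters the comparison of degrees. -/
theorem genDeg_mono (hm : StrictMono m) : Monotone (genDeg m) := by
  intro i j hij
  have := strictMono_gap hm hij
  have := i.2
  have := j.2
  rw [Fin.le_def] at hij
  unfold genDeg
  omega

theorem genDeg_succ (hm : StrictMono m) (j : Fin t) :
    genDeg m j.succ + 1 = genDeg m j.castSucc + diff m j := by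
  have := add_diff hm j
  have := j.2
  unfold genDeg
  simp only [Fin.val_succ, Fin.val_castSucc]
  omega

/-- In this form the bound on the order of the (i, j) entry says that its product with a series of
order `genDeg m i` has order at least that of x times the generator j + 1. -/
theorem degMatrix_eq (m : Fin (t + 1) → ℕ) (i : Fin (t + 1)) (j : Fin t) :
    degMatrix m i j = (genDeg m j.succ : ℤ) - genDeg m i + 1 := by
  unfold degMatrix genDeg
  have := i.2
  have := j.2
  simp only [Fin.val_succ]
  push_cast
  rw [Nat.cast_sub (by omega), Nat.cast_sub (by omega)]
  push_cast
  ring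

/-- `f` is of degree `t - i` in `x`, with leading coefficient `y ^ m i`, and its order is the
degree of `x ^ (t - i) * y ^ m i`. -/
structure IsStd (m : Fin (t + 1) → ℕ) (i : Fin (t + 1)) (f : R k) : Prop where
  mem_xDegLE : f ∈ xDegLE k (t - i)
  coeff_eq : ∀ e : Fin 2 →₀ ℕ, e 0 = t - i →
    MvPowerSeries.coeff e f = if e 1 = m i then 1 else 0
  mem_ordGE : f ∈ ordGE k (genDeg m i)

theorem IsStd.coeff_genExp {i : Fin (t + 1)} {f : R k} (h : IsStd m i f) :
    MvPowerSeries.coeff (genExp m i) f = 1 := by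
  rw [h.coeff_eq _ (genExp_zero m i), if_pos (genExp_one m i)]

/-- An earlier exponent either has smaller degree, excluded by the order, or the same degree and a
smaller exponent of y, hence degree in x above t - i. -/
theorem IsStd.isLead {i : Fin (t + 1)} {f : R k} (h : IsStd m i f) : IsLead f (genExp m i) := by
  refine ⟨by rw [h.coeff_genExp]; exact one_ne_zero, fun e he => ?_⟩
  rw [locRank_lt_iff, genDeg_eq] at he
  rcases he with he | ⟨he, he1⟩
  · exact h.mem_ordGE e he
  · refine h.mem_xDegLE e ?_
    rw [genExp_one] at he1
    unfold genDeg at he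
    omega

theorem isStd_last (m : Fin (t + 1) → ℕ) :
    IsStd m (Fin.last t) (MvPowerSeries.X 1 ^ m (Fin.last t) : R k) := by
  classical
  rw [MvPowerSeries.X_pow_eq]
  refine ⟨fun e he => ?_, fun e he => ?_, fun e he => ?_⟩
  · rw [MvPowerSeries.coeff_monomial_ne]
    rintro rfl
    simp at he
  · rw [MvPowerSeries.coeff_monomial]
    simp only [Fin.val_last, tsub_self] at he
    refine if_congr ⟨?_, fun h => expo_ext (by simp [he]) (by simp [h])⟩ rfl rfl
    rintro rfl
    simp
  · rw [MvPowerSeries.coeff_monomial_ne]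
    rintro rfl
    simp [genDeg] at he

/-- The recursion satisfied by the signed minors of `H + N` preserves `IsStd`. -/
theorem isStd_castSucc_of_rec (hm : StrictMono m) {j : Fin t} {r : Fin (t + 1) → Polynomial k}
    (hr0 : ∀ i : Fin (t + 1), (i : ℕ) ≤ j → r i = 0)
    (hr : ∀ i : Fin (t + 1), ∀ l : ℕ, l + genDeg m i < genDeg m j.succ + 1 → (r i).coeff l = 0)
    {g : Fin (t + 1) → R k} (hg : ∀ i : Fin (t + 1), (j : ℕ) < i → IsStd m i (g i)) {f : R k}
    (hrec : MvPowerSeries.X 1 ^ diff m j * f =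
      MvPowerSeries.X 0 * g j.succ - ∑ i, yEmb k (r i) * g i) :
    IsStd m j.castSucc f := by
  have hsucc := hg j.succ (by simp)
  have hj := j.2
  have hterm : ∀ i, yEmb k (r i) * g i ∈ xDegLE k (t - (j + 1)) := by
    intro i
    by_cases hi : (j : ℕ) < i
    · have := mul_mem_xDegLE (yEmb_mem_xDegLE (r i)) (hg i hi).mem_xDegLE
      exact xDegLE_mono (by omega) this
    · rw [hr0 i (by omega), map_zero, zero_mul]
      exact Submodule.zero_mem _
  -- The correction terms stay below degree t - j in x, so the coefficient of x^{t-j} on the right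
  -- comes from x g_{j+1} alone.
  have hsum : ∑ i, yEmb k (r i) * g i ∈ xDegLE k (t - (j + 1)) :=
    Submodule.sum_mem _ fun i _ => hterm i
  refine ⟨fun e he => ?_, fun e he => ?_, fun e he => ?_⟩
  · rw [← coeff_X_one_pow_mul (diff m j), hrec]
    have h1 : MvPowerSeries.X 0 * g j.succ - ∑ i, yEmb k (r i) * g i ∈ xDegLE k (t - j) := by
      refine Submodule.sub_mem _ ?_ (xDegLE_mono (by omega) hsum)
      refine xDegLE_mono ?_ (mul_mem_xDegLE X_zero_mem_xDegLE hsucc.mem_xDegLE)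
      simp only [Fin.val_succ]
      omega
    refine h1 _ ?_
    simpa using he
  · rw [← coeff_X_one_pow_mul (diff m j), hrec, map_sub, hsum _ (by simp at he ⊢; omega), sub_zero]
    simp only [Fin.val_castSucc] at he
    have h1 : e + Finsupp.single 1 (diff m j) =
        (Finsupp.single 0 (t - (j + 1)) + Finsupp.single 1 (e 1 + diff m j)) +
          Finsupp.single 0 1 := by
      apply expo_ext <;> simp
      omega
    rw [h1, coeff_X_zero_mul, hsucc.coeff_eq _ (by simp)]
    refine if_congr ?_ rfl rfl
    have := add_diff hm j
    simp
    omega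
  · rw [← coeff_X_one_pow_mul (diff m j), hrec]
    have h1 : MvPowerSeries.X 0 * g j.succ - ∑ i, yEmb k (r i) * g i ∈
        ordGE k (genDeg m j.succ + 1) := by
      refine Ideal.sub_mem _ ?_ (Ideal.sum_mem _ fun i _ => ?_)
      · rw [add_comm]
        exact mul_mem_ordGE (X_mem_ordGE 0) hsucc.mem_ordGE
      · by_cases hi : (j : ℕ) < i
        · refine ordGE_anti ?_ (mul_mem_ordGE (yEmb_mem_ordGE (n := genDeg m j.succ + 1 - genDeg m i)
            fun l hl => hr i l (by omega)) (hg i hi).mem_ordGE)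
          omega
        · rw [hr0 i (by omega), map_zero, zero_mul]
          exact Ideal.zero_mem _
    refine h1 _ ?_
    have := genDeg_succ hm j
    simp
    omega

/-- The order condition, written additively in ℕ; it covers the zero entries as well. -/
theorem coeff_eq_zero_of_mem_canonicalSet {N : Matrix (Fin (t + 1)) (Fin t) (Polynomial k)}
    (hN : N ∈ canonicalSet k m) (i : Fin (t + 1)) (j : Fin t) (l : ℕ)
    (hl : l + genDeg m i < genDeg m j.succ + 1) : (N i j).coeff l = 0 := by
  by_contra hne
  have h0 : N i j ≠ 0 := by
    intro h
    rw [h] at hne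
    simp at hne
  rcases lt_or_ge (j : ℕ) i with h | h
  · have h1 := ((hN i j).2 h h0).1
    have h2 := Polynomial.natTrailingDegree_le_of_ne_zero hne
    rw [degMatrix_eq] at h1
    omega
  · exact h0 ((hN i j).1 h)

/-- The signed minors of `H + N` have the expected leading exponents. -/
theorem isStd_signedMinor (hm : IsLexSegment m)
    {N : Matrix (Fin (t + 1)) (Fin t) (Polynomial k)} (hN : N ∈ canonicalSet k m)
    (i : Fin (t + 1)) : IsStd m i (signedMinor (fullMatrix m N) i) := by
  have hN0 : ∀ (i : Fin (t + 1)) (j : Fin t), (i : ℕ) ≤ j → N i j = 0 := fun i j => (hN i j).1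
  suffices h : ∀ n, ∀ i : Fin (t + 1), t - (i : ℕ) ≤ n →
      IsStd m i (signedMinor (fullMatrix m N) i) from h t i (Nat.sub_le _ _)
  intro n
  induction n with
  | zero =>
    intro i hi
    have : i = Fin.last t := by ext; simp; omega
    rw [this, signedMinor_fullMatrix_last hm hN0]
    exact isStd_last m
  | succ n ih =>
    intro i hi
    induction i using Fin.lastCases with
    | last => exact ih _ (by simp)
    | cast j =>
      refine isStd_castSucc_of_rec hm.2.2 (r := fun i => N i j) (fun i hi => hN0 i j hi)
        (fun i l hl => coeff_eq_zero_of_mem_canonicalSet hN i j l hl) (fun i hi' => ih i ?_)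
        (signedMinor_fullMatrix_rec m N j)
      simp only [Fin.val_castSucc] at hi
      omega

end Std

/-! ### Elimination of x from coefficient vectors, leading terms and syzygies of the minors -/

section Approx

variable {k : Type*} [Field k]

theorem exists_truncation (n : ℕ) (f : R k) :
    ∃ s : Finset (Fin 2 →₀ ℕ),
      f - ∑ e ∈ s, MvPowerSeries.monomial e (MvPowerSeries.coeff e f) ∈ ordGE k n := by
  classical
  have hfin : {e : Fin 2 →₀ ℕ | e 0 + e 1 < n}.Finite := by
    refine (Set.finite_Iic (Finsupp.single 0 n + Finsupp.single 1 n)).subset fun e he => ?_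
    rw [Set.mem_Iic, expo_le_iff]
    simp only [Set.mem_ofPred_eq] at he
    simp
    omega
  refine ⟨hfin.toFinset, fun e he => ?_⟩
  rw [map_sub, map_sum, Finset.sum_eq_single e]
  · rw [MvPowerSeries.coeff_monomial_same, sub_self]
  · intro b _ hb
    rw [MvPowerSeries.coeff_monomial_ne hb.symm]
  · intro h
    exact absurd (hfin.mem_toFinset.mpr he) h

variable {t : ℕ} {m : Fin (t + 1) → ℕ}

/-- Modulo the columns of `H + N`, every vector is congruent to one whose entries except the first
are power series in `y`, up to terms of high order. -/
theorem exists_column_reduction (m : Fin (t + 1) → ℕ)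
    (N : Matrix (Fin (t + 1)) (Fin t) (Polynomial k))
    (f : Fin (t + 1) → R k) (n : ℕ) :
    ∃ (v : Fin t → R k) (f' : Fin (t + 1) → R k), (∀ i, i ≠ 0 → f' i ∈ xDegLE k 0) ∧
      ∀ i, f i - (fullMatrix m N).mulVec v i - f' i ∈ ordGE k n := by
  classical
  let M := fullMatrix m N
  -- The vectors that reduce exactly. It suffices to show that Z contains all monomial vectors, for
  -- which closure under multiplication by y and by x is enough.
  let Z : Submodule k (Fin (t + 1) → R k) :=
    { carrier := {f | ∃ (v : Fin t → R k) (f' : Fin (t + 1) → R k),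
        (∀ i, i ≠ 0 → f' i ∈ xDegLE k 0) ∧ f = M.mulVec v + f'}
      zero_mem' := ⟨0, 0, fun i _ => Submodule.zero_mem _, by simp⟩
      add_mem' := by
        rintro _ _ ⟨v, f, hf, rfl⟩ ⟨w, g, hg, rfl⟩
        refine ⟨v + w, f + g, fun i hi => Submodule.add_mem _ (hf i hi) (hg i hi), ?_⟩
        rw [Matrix.mulVec_add]
        abel
      smul_mem' := by
        rintro c _ ⟨v, f, hf, rfl⟩
        refine ⟨c • v, c • f, fun i hi => Submodule.smul_mem _ _ (hf i hi), ?_⟩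
        rw [Matrix.mulVec_smul, smul_add] }
  have hX1 : ∀ f ∈ Z, (MvPowerSeries.X 1 : R k) • f ∈ Z := by
    rintro _ ⟨v, f, hf, rfl⟩
    refine ⟨(MvPowerSeries.X 1 : R k) • v, (MvPowerSeries.X 1 : R k) • f, fun i hi => ?_, ?_⟩
    · have h1 : (MvPowerSeries.X 1 : R k) ∈ xDegLE k 0 := by
        have := yEmb_mem_xDegLE (Polynomial.X : Polynomial k)
        rwa [yEmb, Polynomial.aeval_X] at this
      exact mul_mem_xDegLE h1 (hf i hi)
    · rw [Matrix.mulVec_smul, smul_add]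
  have hX0 : ∀ f ∈ Z, (MvPowerSeries.X 0 : R k) • f ∈ Z := by
    rintro _ ⟨v, f, hf, rfl⟩
    -- Column j has -x in row j + 1, so M v' contains x f_i in every row i ≥ 1; subtracting it
    -- cancels these terms. The other entries in those rows are polynomials in y, and row 0 is
    -- unrestricted.
    let v' : Fin t → R k := fun j => -f j.succ
    refine ⟨(MvPowerSeries.X 0 : R k) • v + v',
      (MvPowerSeries.X 0 : R k) • f - M.mulVec v', fun i hi => ?_, ?_⟩
    · obtain ⟨i, rfl⟩ := Fin.exists_succ_eq.mpr hi
      have hM : ∀ j, M i.succ j =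
          (if i.succ = j.castSucc then (MvPowerSeries.X 1 : R k) ^ diff m j else 0) +
          (if j = i then -(MvPowerSeries.X 0 : R k) else 0) + yEmb k (N i.succ j) := by
        intro j
        change fullMatrix m N i.succ j = _
        rw [fullMatrix_apply, hbMatrix]
        congr 1
        by_cases h : i.succ = j.castSucc
        · have h2 : j ≠ i := by
            rintro rfl
            exact (Fin.castSucc_lt_succ).ne' h
          rw [if_pos h, if_pos h, if_neg h2, add_zero]
        · rw [if_neg h, if_neg h, zero_add]
          exact if_congr (by rw [Fin.succ_inj, eq_comm]) rfl rfl
      have hval : ((MvPowerSeries.X 0 : R k) • f - M.mulVec v') i.succ =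
          ∑ j, ((if i.succ = j.castSucc then (MvPowerSeries.X 1 : R k) ^ diff m j else 0) +
            yEmb k (N i.succ j)) * f j.succ := by
        rw [Pi.sub_apply, Pi.smul_apply, Matrix.mulVec, dotProduct]
        have h1 : ∑ j, (if j = i then -(MvPowerSeries.X 0 : R k) else 0) * v' j =
            MvPowerSeries.X 0 * f i.succ := by
          rw [Finset.sum_eq_single i]
          · rw [if_pos rfl]
            simp only [v']
            ring
          · intro j _ hj
            rw [if_neg hj, zero_mul]
          · simp
        rw [smul_eq_mul, ← h1, ← Finset.sum_sub_distrib]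
        refine Finset.sum_congr rfl fun j _ => ?_
        rw [hM]
        simp only [v']
        ring
      rw [hval]
      refine Submodule.sum_mem _ fun j _ => ?_
      refine mul_mem_xDegLE (Submodule.add_mem _ ?_ (yEmb_mem_xDegLE _))
        (hf j.succ (Fin.succ_ne_zero j))
      split_ifs
      · rw [← yEmb_X_pow]
        exact yEmb_mem_xDegLE _
      · exact Submodule.zero_mem _
    · rw [Matrix.mulVec_add, Matrix.mulVec_smul, smul_add]
      abel
  have hsingle : ∀ (i : Fin (t + 1)) (f : R k), Pi.single i (MvPowerSeries.X 0 * f) =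
      (MvPowerSeries.X 0 : R k) • (Pi.single i f : Fin (t + 1) → R k) := by
    intro i f
    rw [← Pi.single_smul, smul_eq_mul]
  have hsingle' : ∀ (i : Fin (t + 1)) (f : R k), Pi.single i (MvPowerSeries.X 1 * f) =
      (MvPowerSeries.X 1 : R k) • (Pi.single i f : Fin (t + 1) → R k) := by
    intro i f
    rw [← Pi.single_smul, smul_eq_mul]
  have hone : ∀ i, (Pi.single i (1 : R k) : Fin (t + 1) → R k) ∈ Z := by
    intro i
    refine ⟨0, Pi.single i 1, fun j _ => ?_, by simp⟩
    have h1 : (1 : R k) ∈ xDegLE k 0 := by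
      have := yEmb_mem_xDegLE (1 : Polynomial k)
      rwa [map_one] at this
    by_cases hij : j = i
    · subst hij
      rwa [Pi.single_eq_same]
    · rw [Pi.single_eq_of_ne hij]
      exact Submodule.zero_mem _
  have hpow : ∀ (i : Fin (t + 1)) (a b : ℕ),
      Pi.single i ((MvPowerSeries.X 0 : R k) ^ a * MvPowerSeries.X 1 ^ b) ∈ Z := by
    intro i a b
    induction a with
    | zero =>
      rw [pow_zero, one_mul]
      induction b with
      | zero => rw [pow_zero]; exact hone i
      | succ b ih =>
        rw [pow_succ', hsingle']
        exact hX1 _ ih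
    | succ a ih =>
      rw [pow_succ', mul_assoc, hsingle]
      exact hX0 _ ih
  have hmon : ∀ (i : Fin (t + 1)) (e : Fin 2 →₀ ℕ) (c : k),
      Pi.single i (MvPowerSeries.monomial e c) ∈ Z := by
    intro i e c
    have h1 : MvPowerSeries.monomial e c =
        c • ((MvPowerSeries.X 0 : R k) ^ (e 0) * MvPowerSeries.X 1 ^ (e 1)) := by
      rw [MvPowerSeries.X_pow_eq, MvPowerSeries.X_pow_eq, MvPowerSeries.monomial_mul_monomial,
        one_mul, ← map_smul, smul_eq_mul, mul_one]
      congr 2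
      apply expo_ext <;> simp
    rw [h1, Pi.single_smul]
    exact Z.smul_mem _ (hpow i _ _)
  choose s hs using fun i => exists_truncation n (f i)
  have hmem : ∑ i, ∑ e ∈ s i, Pi.single i (MvPowerSeries.monomial e
      (MvPowerSeries.coeff e (f i))) ∈ Z :=
    Z.sum_mem fun i _ => Z.sum_mem fun e _ => hmon i e _
  obtain ⟨v, f', hf', heq⟩ := hmem
  refine ⟨v, f', hf', fun i => ?_⟩
  have h2 := congrFun heq i
  have h3 : (∑ i, ∑ e ∈ s i, Pi.single i (MvPowerSeries.monomial e
      (MvPowerSeries.coeff e (f i))) : Fin (t + 1) → R k) i =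
      ∑ e ∈ s i, MvPowerSeries.monomial e (MvPowerSeries.coeff e (f i)) := by
    rw [Finset.sum_apply, Finset.sum_eq_single i]
    · simp
    · intro j _ hj
      rw [Finset.sum_apply]
      exact Finset.sum_eq_zero fun e _ => Pi.single_eq_of_ne hj.symm _
    · simp
  rw [h3, Pi.add_apply] at h2
  have h4 := hs i
  rw [h2] at h4
  rwa [sub_sub]

/-- The terms of a standard representation have distinct leading exponents. -/
theorem eq_of_isLead_mul {g : Fin (t + 1) → R k} (hg : ∀ i, IsLead (g i) (genExp m i))
    {f : Fin (t + 1) → R k} (hf : ∀ i, i ≠ 0 → f i ∈ xDegLE k 0) {i j : Fin (t + 1)}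
    {a : Fin 2 →₀ ℕ} (hi : IsLead (f i * g i) a) (hj : IsLead (f j * g j) a) : i = j := by
  -- The exponent of x in the lead identifies the index: it is t - i for i ≠ 0 and at least t for i
  -- = 0.
  have key : ∀ i, IsLead (f i * g i) a → (t - (i : ℕ) ≤ a 0 ∧ (i ≠ 0 → a 0 = t - (i : ℕ))) := by
    intro i hi
    have hfi : f i ≠ 0 := left_ne_zero_of_mul hi.ne_zero
    obtain ⟨p, hp⟩ := exists_isLead hfi
    have ha := hi.unique (hp.mul (hg i))
    subst ha
    rw [Finsupp.add_apply, genExp_zero]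
    refine ⟨by omega, fun hi0 => ?_⟩
    have : p 0 = 0 := by
      by_contra hp0
      exact hp.1 (hf i hi0 p (Nat.pos_of_ne_zero hp0))
    omega
  have h1 := key i hi
  have h2 := key j hj
  have hi2 := i.2
  have hj2 := j.2
  by_cases hi0 : i = 0
  · by_cases hj0 : j = 0
    · rw [hi0, hj0]
    · have h3 := h2.2 hj0
      have h4 : (j : ℕ) ≠ 0 := fun h => hj0 (Fin.ext h)
      rw [hi0] at h1
      simp only [Fin.val_zero] at h1
      omega
  · have h3 := h1.2 hi0
    have h4 : (i : ℕ) ≠ 0 := fun h => hi0 (Fin.ext h)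
    by_cases hj0 : j = 0
    · rw [hj0] at h2
      simp only [Fin.val_zero] at h2
      omega
    · have h5 := h2.2 hj0
      exact Fin.ext (by omega)

theorem sum_mul_mulVec (N : Matrix (Fin (t + 1)) (Fin t) (Polynomial k)) (v : Fin t → R k) :
    ∑ i, (fullMatrix m N).mulVec v i * signedMinor (fullMatrix m N) i = 0 := by
  simp only [Matrix.mulVec, dotProduct, Finset.sum_mul]
  rw [Finset.sum_comm]
  refine Finset.sum_eq_zero fun j _ => ?_
  have := congrArg (fun a => v j * a) (sum_signedMinor_mul (fullMatrix m N) j)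
  simp only [mul_zero, Finset.mul_sum] at this
  rw [← this]
  exact Finset.sum_congr rfl fun i _ => by ring

/-- `I_t(H + N)` lies in the cell. -/
theorem isLead_idealOf_iff (hm : IsLexSegment m)
    {N : Matrix (Fin (t + 1)) (Fin t) (Polynomial k)} (hN : N ∈ canonicalSet k m)
    (e : Fin 2 →₀ ℕ) : (∃ f ∈ idealOf m N, IsLead f e) ↔ InMon m e := by
  classical
  have hlead := fun i => (isStd_signedMinor hm hN i).isLead
  rw [idealOf_eq_span]
  constructor
  · rintro ⟨f, hf, hfe⟩
    obtain ⟨a, rfl⟩ := (Submodule.mem_span_range_iff_exists_fun _).mp hf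
    -- Precision one past the position of e, so that the reduced combination still has lead e.
    obtain ⟨v, f', hf', happ⟩ := exists_column_reduction m N a (locRank e + 1)
    have hcong : (∑ i, a i • signedMinor (fullMatrix m N) i) -
        ∑ i, f' i * signedMinor (fullMatrix m N) i ∈ locFil k (locRank e + 1) := by
      have h1 : (∑ i, a i • signedMinor (fullMatrix m N) i) -
          ∑ i, f' i * signedMinor (fullMatrix m N) i =
          ∑ i, (a i - (fullMatrix m N).mulVec v i - f' i) * signedMinor (fullMatrix m N) i := by
        simp only [sub_mul, Finset.sum_sub_distrib, sum_mul_mulVec, sub_zero, smul_eq_mul]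
      rw [h1]
      exact Ideal.sum_mem _ fun i _ => Ideal.mul_mem_right _ _ (ordGE_le_locFil _ (happ i))
    have hL := hfe.congr (Nat.lt_succ_self _) hcong
    have hne : ∃ i ∈ Finset.univ, f' i * signedMinor (fullMatrix m N) i ≠ 0 := by
      by_contra! h
      exact hL.ne_zero (Finset.sum_eq_zero h)
    obtain ⟨i, -, b, hb, hb', -⟩ := exists_isLead_sum
      (fun i _ j _ a hi hj => eq_of_isLead_mul hlead hf' hi hj) hne
    have hbe := hb'.unique hL
    subst hbe
    have hfi : f' i ≠ 0 := left_ne_zero_of_mul hb.ne_zero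
    obtain ⟨p, hp⟩ := exists_isLead hfi
    rw [hb.unique (hp.mul (hlead i))]
    exact (inMon_genExp m i).mono le_add_self
  · intro he
    obtain ⟨i, hi⟩ := inMon_iff.mp he
    refine ⟨MvPowerSeries.monomial (e - genExp m i) 1 * signedMinor (fullMatrix m N) i,
      Ideal.mul_mem_left _ _ (Ideal.subset_span ⟨i, rfl⟩), ?_⟩
    have := (isLead_monomial (e - genExp m i) (one_ne_zero (α := k))).mul (hlead i)
    rwa [tsub_add_cancel_of_le hi] at this

/-- Syzygies of the maximal minors of `H + N`, modulo the maximal ideal. -/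
theorem exists_mulVec_eq_coeff_zero (hm : IsLexSegment m)
    {N : Matrix (Fin (t + 1)) (Fin t) (Polynomial k)} (hN : N ∈ canonicalSet k m)
    {a : Fin (t + 1) → R k} (ha : ∑ i, a i * signedMinor (fullMatrix m N) i = 0) :
    ∃ v : Fin t → k, ∀ i, MvPowerSeries.constantCoeff (a i) =
      ((fullMatrix m N).map MvPowerSeries.constantCoeff).mulVec v i := by
  classical
  have hlead := fun i => (isStd_signedMinor hm hN i).isLead
  obtain ⟨K, hK⟩ : ∃ K, ∀ i, locRank (genExp m i) < K := by
    refine ⟨∑ i, locRank (genExp m i) + 1, fun i => Nat.lt_succ_of_le ?_⟩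
    exact Finset.single_le_sum (f := fun i => locRank (genExp m i)) (fun _ _ => Nat.zero_le _)
      (Finset.mem_univ i)
  have hK0 : 0 < K := (Nat.zero_le _).trans_lt (hK 0)
  obtain ⟨v, f', hf', happ⟩ := exists_column_reduction m N a K
  have hmem : ∑ i, f' i * signedMinor (fullMatrix m N) i ∈ locFil k K := by
    have h1 : ∑ i, f' i * signedMinor (fullMatrix m N) i =
        -∑ i, (a i - (fullMatrix m N).mulVec v i - f' i) * signedMinor (fullMatrix m N) i := by
      simp only [sub_mul, Finset.sum_sub_distrib, sum_mul_mulVec, ha]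
      ring
    rw [h1]
    exact neg_mem (Ideal.sum_mem _ fun i _ => Ideal.mul_mem_right _ _ (ordGE_le_locFil _ (happ i)))
  -- A nonzero constant term would give the i-th summand the lead `genExp m i`, at a position below
  -- K, whereas each summand lies in `locFil k K` because leads are distinct.
  have hzero : ∀ i, MvPowerSeries.constantCoeff (f' i) = 0 := by
    intro i
    by_contra hne
    have hL : IsLead (f' i) 0 := ⟨hne, fun e he => by simp [locRank_lt_iff] at he⟩
    have h2 := mem_locFil_of_sum_mem
      (fun i _ j _ a hi hj => eq_of_isLead_mul hlead hf' hi hj) hmem i (Finset.mem_univ i)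
    have h3 := (hL.mul (hlead i)).mem_locFil_iff.mp h2
    rw [zero_add] at h3
    exact absurd (hK i) (not_lt.mpr h3)
  refine ⟨fun j => MvPowerSeries.constantCoeff (v j), fun i => ?_⟩
  have h4 := happ i 0 (by simpa using hK0)
  rw [MvPowerSeries.coeff_zero_eq_constantCoeff_apply, map_sub, map_sub, hzero, sub_zero,
    sub_eq_zero] at h4
  rw [h4]
  simp [Matrix.mulVec, dotProduct]

end Approx

/-! ### Powers of the maximal ideal -/

section Powers

variable {k : Type*} [Field k]

/-- The terms that involve x are divisible by x; the others form a series in y of positive order,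
hence divisible by y. Both quotients lose only one degree. -/
theorem ordGE_succ_le (n : ℕ) :
    ordGE k (n + 1) ≤ IsLocalRing.maximalIdeal (R k) * ordGE k n := by
  classical
  have hX : ∀ s : Fin 2, (MvPowerSeries.X s : R k) ∈ IsLocalRing.maximalIdeal (R k) := by
    intro s
    rw [IsLocalRing.mem_maximalIdeal, mem_nonunits_iff, MvPowerSeries.isUnit_iff_constantCoeff]
    simp
  intro f hf
  let f0 : R k := fun e => if e 0 = 0 then 0 else MvPowerSeries.coeff e f
  have hf0 : ∀ e, MvPowerSeries.coeff e f0 = if e 0 = 0 then 0 else MvPowerSeries.coeff e f :=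
    fun e => rfl
  have h0 : (MvPowerSeries.X 0 : R k) ∣ f0 := by
    rw [MvPowerSeries.X_dvd_iff]
    intro e he
    rw [hf0, if_pos he]
  have h1 : (MvPowerSeries.X 1 : R k) ∣ f - f0 := by
    rw [MvPowerSeries.X_dvd_iff]
    intro e he
    rw [map_sub, hf0]
    split_ifs with h
    · rw [sub_zero]
      exact hf e (by omega)
    · rw [sub_self]
  have hord : f0 ∈ ordGE k (n + 1) := by
    intro e he
    rw [hf0, hf e he, ite_self]
  obtain ⟨a, ha⟩ := h0
  obtain ⟨b, hb⟩ := h1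
  have ha' : a ∈ ordGE k n := by
    intro e he
    rw [← coeff_X_zero_mul, ← ha]
    exact hord _ (by simp; omega)
  have hb' : b ∈ ordGE k n := by
    intro e he
    rw [← coeff_X_one_pow_mul 1, pow_one, ← hb]
    exact Ideal.sub_mem _ hf hord _ (by simp; omega)
  have : f = MvPowerSeries.X 0 * a + MvPowerSeries.X 1 * b := by
    rw [← ha, ← hb]
    ring
  rw [this]
  exact Ideal.add_mem _ (Ideal.mul_mem_mul (hX 0) ha') (Ideal.mul_mem_mul (hX 1) hb')

theorem maximalIdeal_le_ordGE : IsLocalRing.maximalIdeal (R k) ≤ ordGE k 1 := by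
  intro f hf e he
  rw [IsLocalRing.mem_maximalIdeal, mem_nonunits_iff, MvPowerSeries.isUnit_iff_constantCoeff,
    isUnit_iff_ne_zero, not_not] at hf
  have : e = 0 := expo_ext (by simp; omega) (by simp; omega)
  rw [this]
  exact hf

theorem maximalIdeal_pow (n : ℕ) : IsLocalRing.maximalIdeal (R k) ^ n = ordGE k n := by
  induction n with
  | zero =>
    rw [pow_zero, Ideal.one_eq_top, eq_comm, Ideal.eq_top_iff_one]
    intro e he
    omega
  | succ n ih =>
    rw [pow_succ', ih]
    refine le_antisymm (Ideal.mul_le.mpr fun a ha b hb => ?_) (ordGE_succ_le n)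
    rw [add_comm]
    exact mul_mem_ordGE (maximalIdeal_le_ordGE ha) hb

end Powers

/-! ### Division and standard elements in ideals of the cell -/

section CellElements

variable {k : Type*} [Field k] {t : ℕ} {m : Fin (t + 1) → ℕ}

/-- Division by an ideal with prescribed leading exponents: the remainder has no exponent in the
monomial ideal. -/
theorem exists_normalForm {J : Ideal (R k)} (hJ : ∀ e, InMon m e → ∃ f ∈ J, IsLead f e) {n₀ : ℕ}
    {f : R k} (hf : f ∈ locFil k n₀) (n : ℕ) :
    ∃ j ∈ J, ∃ r ∈ locFil k n₀, (∀ e, InMon m e → MvPowerSeries.coeff e r = 0) ∧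
      f - j - r ∈ locFil k n := by
  induction n with
  | zero =>
    exact ⟨0, J.zero_mem, 0, Ideal.zero_mem _, fun _ _ => map_zero _, fun e he => by omega⟩
  | succ n ih =>
    by_cases hn : n + 1 ≤ n₀
    · refine ⟨0, J.zero_mem, 0, Ideal.zero_mem _, fun _ _ => map_zero _, ?_⟩
      rw [sub_zero, sub_zero]
      exact locFil_anti hn hf
    obtain ⟨j, hj, r, hr, hr', h⟩ := ih
    by_cases hex : ∃ e, locRank e = n
    swap
    · refine ⟨j, hj, r, hr, hr', fun e he => h e ?_⟩
      exact lt_of_le_of_ne (Nat.lt_succ_iff.mp he) fun h => hex ⟨e, h⟩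
    obtain ⟨e, he⟩ := hex
    have hstep : ∀ g : R k, g ∈ locFil k n →
        MvPowerSeries.coeff e g = MvPowerSeries.coeff e (f - j - r) →
        f - j - r - g ∈ locFil k (n + 1) := by
      intro g hg hge e' he'
      rcases (Nat.lt_succ_iff.mp he').lt_or_eq with h1 | h1
      · rw [map_sub, h e' h1, hg e' h1, sub_zero]
      · have : e' = e := locRank_injective (h1.trans he.symm)
        rw [this, map_sub, hge, sub_self]
    -- At most one exponent has position n. It is removed by an element of J if it lies in the
    -- monomial ideal, and moved to the remainder otherwise.
    by_cases hin : InMon m e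
    · obtain ⟨fe, hfe, hlead⟩ := hJ e hin
      let c := MvPowerSeries.coeff e (f - j - r) / MvPowerSeries.coeff e fe
      have hc : c • fe ∈ J := by
        rw [MvPowerSeries.smul_eq_C_mul]
        exact J.mul_mem_left _ hfe
      refine ⟨j + c • fe, J.add_mem hj hc, r, hr, hr', ?_⟩
      have := hstep (c • fe) (smul_mem_locFil (he ▸ hlead.2) c) (by
        rw [MvPowerSeries.coeff_smul]
        exact div_mul_cancel₀ _ hlead.1)
      convert this using 1
      ring
    · let g : R k := MvPowerSeries.monomial e (MvPowerSeries.coeff e (f - j - r))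
      have hg : g ∈ locFil k n := by
        intro e' he'
        refine MvPowerSeries.coeff_monomial_ne ?_ _
        rintro rfl
        omega
      refine ⟨j, hj, r + g, Ideal.add_mem _ hr (locFil_anti (by omega) hg), fun e' he' => ?_, ?_⟩
      · rw [map_add, hr' e' he', zero_add]
        refine MvPowerSeries.coeff_monomial_ne ?_ _
        rintro rfl
        exact hin he'
      · have := hstep g hg (MvPowerSeries.coeff_monomial_same _ _)
        convert this using 1
        ring

theorem inMon_of_degree (hm : IsLexSegment m) {e : Fin 2 →₀ ℕ}
    (he : t + m (Fin.last t) ≤ e 0 + e 1) : InMon m e := by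
  by_cases h : t ≤ e 0
  · exact ⟨0, by simpa using h, by rw [hm.2.1]; exact Nat.zero_le _⟩
  · exact ⟨Fin.last t, by simp, by omega⟩

/-- Ideals with the given leading exponents contain a power of the maximal ideal. -/
theorem ordGE_le_of_isLead (hm : IsLexSegment m) {J : Ideal (R k)}
    (hJ : ∀ e, InMon m e → ∃ f ∈ J, IsLead f e) : ordGE k (t + m (Fin.last t)) ≤ J := by
  set K := t + m (Fin.last t)
  -- Nakayama: modulo J, a series of order K only has to be brought to order K + 1. Its remainder
  -- has order at least K and no exponent in the monomial ideal, hence is 0.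
  refine Submodule.le_of_le_smul_of_le_jacobson_bot (I := IsLocalRing.maximalIdeal (R k))
    (IsNoetherian.noetherian _) (IsLocalRing.maximalIdeal_le_jacobson _) fun f hf => ?_
  obtain ⟨j, hj, r, hr, hr', h⟩ := exists_normalForm hJ (ordGE_le_locFil_choose K hf)
    ((K + 1 + 1).choose 2)
  have hr0 : r = 0 := by
    ext e
    rw [map_zero]
    rcases lt_or_ge (e 0 + e 1) K with h1 | h1
    · exact locFil_choose_le_ordGE K hr e h1
    · exact hr' e (inMon_of_degree hm h1)
  rw [hr0, sub_zero] at h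
  have h2 := ordGE_succ_le K (locFil_choose_le_ordGE (K + 1) h)
  rw [← add_sub_cancel j f]
  exact Submodule.add_mem_sup hj h2

/-- The elements of the cell contain elements satisfying `IsStd`. -/
theorem exists_isStd (hm : IsLexSegment m) {J : Ideal (R k)}
    (hJ : ∀ e, InMon m e → ∃ f ∈ J, IsLead f e) (i : Fin (t + 1)) : ∃ f ∈ J, IsStd m i f := by
  classical
  obtain ⟨fi, hfi, hlead⟩ := hJ _ (inMon_genExp m i)
  let c := (MvPowerSeries.coeff (genExp m i) fi)⁻¹
  have hc : c • fi ∈ J := by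
    rw [MvPowerSeries.smul_eq_C_mul]
    exact J.mul_mem_left _ hfi
  let x : R k := MvPowerSeries.monomial (genExp m i) 1
  have hx : x - c • fi ∈ locFil k (locRank (genExp m i) + 1) := by
    intro e he
    rcases (Nat.lt_succ_iff.mp he).lt_or_eq with h1 | h1
    · rw [map_sub, (isLead_monomial (genExp m i) one_ne_zero).2 e h1,
        smul_mem_locFil hlead.2 c e h1, sub_zero]
    · rw [locRank_injective h1, map_sub, MvPowerSeries.coeff_monomial_same,
        MvPowerSeries.coeff_smul, inv_mul_cancel₀ hlead.1, sub_self]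
  set K := t + m (Fin.last t)
  obtain ⟨j, hj, r, hr, hr', h⟩ := exists_normalForm hJ hx ((K + 1).choose 2)
  have hrest := ordGE_le_of_isLead hm hJ (locFil_choose_le_ordGE K h)
  refine ⟨x - r, ?_, ?_⟩
  · have : x - r = (x - c • fi - j - r) + j + c • fi := by ring
    rw [this]
    exact J.add_mem (J.add_mem hrest hj) hc
  -- The remainder has exponents only outside the monomial ideal and after the i-th generator. By
  -- the gaps of m, such an exponent must have degree in x less than t - i, which yields `IsStd` for
  -- x - r.
  have hri : ∀ e, MvPowerSeries.coeff e r ≠ 0 →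
      ¬ InMon m e ∧ (genDeg m i < e 0 + e 1 ∨ genDeg m i = e 0 + e 1 ∧ m i < e 1) := by
    intro e he
    refine ⟨fun h => he (hr' e h), ?_⟩
    have h1 : locRank (genExp m i) < locRank e := by
      by_contra! h
      exact he (hr e (by omega))
    rwa [locRank_lt_iff, genDeg_eq, genExp_one] at h1
  have hx' : ∀ e, MvPowerSeries.coeff e x = if e = genExp m i then 1 else 0 :=
    fun e => MvPowerSeries.coeff_monomial _ _ _
  refine ⟨fun e he => ?_, fun e he => ?_, fun e he => ?_⟩
  · rw [map_sub, hx', if_neg (by rintro rfl; simp at he), zero_sub, neg_eq_zero]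
    by_contra hne
    obtain ⟨h1, h2⟩ := hri e hne
    refine h1 ?_
    rcases le_or_gt t (e 0) with h3 | h3
    · exact ⟨0, by simpa using h3, by rw [hm.2.1]; exact Nat.zero_le _⟩
    · refine ⟨⟨t - e 0, by omega⟩, by simp; omega, ?_⟩
      have h4 := strictMono_gap hm.2.2 (i := ⟨t - e 0, by omega⟩) (j := i)
        (by rw [Fin.le_def]; simp; omega)
      unfold genDeg at h2
      simp only at h4
      have := i.2
      omega
  · have h0 : MvPowerSeries.coeff e r = 0 := by
      by_contra hne
      obtain ⟨h1, h2⟩ := hri e hne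
      refine h1 ⟨i, he.ge, ?_⟩
      unfold genDeg at h2
      omega
    rw [map_sub, hx', h0, sub_zero]
    refine if_congr ⟨?_, fun h => expo_ext (by simp [he]) (by simp [h])⟩ rfl rfl
    rintro rfl
    simp
  · rw [map_sub, hx', if_neg, zero_sub, neg_eq_zero]
    · by_contra hne
      have := (hri e hne).2
      omega
    · rintro rfl
      rw [genDeg_eq] at he
      exact lt_irrefl _ he

/-- Elements of low degree in `x` of an ideal of the cell are combinations over `k[y]` of the
generators of low degree in `x`, up to terms of high order. -/
theorem exists_approx_combination (hm : StrictMono m) {J : Ideal (R k)}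
    (hJ : ∀ e, (∃ f ∈ J, IsLead f e) → InMon m e) {i₀ : Fin (t + 1)} {g : Fin (t + 1) → R k}
    (hgJ : ∀ i, i₀ ≤ i → g i ∈ J) (hg : ∀ i, i₀ ≤ i → IsStd m i (g i)) {w : R k} (hwJ : w ∈ J)
    (hw : w ∈ xDegLE k (t - i₀)) (n : ℕ) :
    ∃ c : Fin (t + 1) → Polynomial k, (∀ i, i < i₀ → c i = 0) ∧
      w - ∑ i, yEmb k (c i) * g i ∈ locFil k n := by
  classical
  induction n with
  | zero => exact ⟨0, fun _ _ => rfl, fun e he => by omega⟩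
  | succ n ih =>
    obtain ⟨c, hc, h⟩ := ih
    set w' := w - ∑ i, yEmb k (c i) * g i with hw'
    by_cases hex : ∃ e, locRank e = n ∧ MvPowerSeries.coeff e w' ≠ 0
    swap
    · push Not at hex
      refine ⟨c, hc, fun e he => ?_⟩
      rcases (Nat.lt_succ_iff.mp he).lt_or_eq with h1 | h1
      · exact h e h1
      · exact hex e h1
    obtain ⟨e, he, hne⟩ := hex
    have hsumJ : ∑ i, yEmb k (c i) * g i ∈ J := by
      refine Ideal.sum_mem _ fun i _ => ?_
      rcases lt_or_ge i i₀ with h1 | h1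
      · rw [hc i h1, map_zero, zero_mul]; exact J.zero_mem
      · exact J.mul_mem_left _ (hgJ i h1)
    have hsumX : ∑ i, yEmb k (c i) * g i ∈ xDegLE k (t - i₀) := by
      refine Submodule.sum_mem _ fun i _ => ?_
      rcases lt_or_ge i i₀ with h1 | h1
      · rw [hc i h1, map_zero, zero_mul]; exact Submodule.zero_mem _
      · rw [Fin.le_def] at h1
        exact xDegLE_mono (by omega) (mul_mem_xDegLE (yEmb_mem_xDegLE (c i)) (hg i h1).mem_xDegLE)
    have hin : InMon m e := hJ e ⟨w', J.sub_mem hwJ hsumJ, hne, he ▸ h⟩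
    have he0 : e 0 ≤ t - i₀ := by
      by_contra! hlt
      exact hne (Submodule.sub_mem _ hw hsumX e hlt)
    have hi₀ := i₀.2
    -- The generator with the same exponent of x as e. It divides the monomial of e: any generator
    -- dividing that monomial has index at least t - e 0, and m is monotone.
    let i : Fin (t + 1) := ⟨t - e 0, by omega⟩
    have hi : i₀ ≤ i := by rw [Fin.le_def]; simp [i]; omega
    have hmi : m i ≤ e 1 := by
      obtain ⟨i', h1, h2⟩ := hin
      refine le_trans (hm.monotone ?_) h2
      rw [Fin.le_def]
      simp only [i]
      omega
    let p : Polynomial k := Polynomial.monomial (e 1 - m i) (MvPowerSeries.coeff e w')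
    have hp : yEmb k p = MvPowerSeries.monomial (Finsupp.single 1 (e 1 - m i))
        (MvPowerSeries.coeff e w') := by
      rw [yEmb, Polynomial.aeval_monomial, MvPowerSeries.X_pow_eq, ← Algebra.smul_def, ← map_smul,
        smul_eq_mul, mul_one]
    have hee : Finsupp.single 1 (e 1 - m i) + genExp m i = e := by
      apply expo_ext <;> simp [i]
      · omega
      · exact Nat.sub_add_cancel hmi
    refine ⟨c + Pi.single i p, fun i' hi' => ?_, ?_⟩
    · rw [Pi.add_apply, hc i' hi', Pi.single_eq_of_ne (hi'.trans_le hi).ne, add_zero]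
    · have hsum : ∑ i', yEmb k ((c + Pi.single i p : Fin (t + 1) → Polynomial k) i') * g i' =
          ∑ i', yEmb k (c i') * g i' + yEmb k p * g i := by
        simp only [Pi.add_apply, map_add, add_mul, Finset.sum_add_distrib]
        congr 1
        rw [Finset.sum_eq_single i]
        · rw [Pi.single_eq_same]
        · intro b _ hb
          rw [Pi.single_eq_of_ne hb, map_zero, zero_mul]
        · simp
      rw [hsum, ← sub_sub, ← hw', hp]
      have hL := (isLead_monomial (Finsupp.single 1 (e 1 - m i)) hne).mul (hg i hi).isLead
      rw [hee] at hL
      intro e' he'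
      rcases (Nat.lt_succ_iff.mp he').lt_or_eq with h1 | h1
      · rw [map_sub, h e' h1, hL.2 e' (he.symm ▸ h1), sub_zero]
      · have h2 : e' = e := locRank_injective (h1.trans he.symm)
        rw [h2, map_sub]
        nth_rewrite 2 [← hee]
        rw [MvPowerSeries.coeff_add_monomial_mul, (hg i hi).coeff_genExp, mul_one, sub_self]

/-- Coefficients of small combinations over `k[y]` of standard elements vanish. -/
theorem coeff_eq_zero_of_sum_mem {i₀ : Fin (t + 1)} {g : Fin (t + 1) → R k}
    (hg : ∀ i, i₀ ≤ i → IsStd m i (g i)) {c : Fin (t + 1) → Polynomial k}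
    (hc : ∀ i, i < i₀ → c i = 0) {n : ℕ} (h : ∑ i, yEmb k (c i) * g i ∈ locFil k n)
    (i : Fin (t + 1)) {l : ℕ} (hl : locRank (genExp m i + Finsupp.single 1 l) < n) :
    (c i).coeff l = 0 := by
  rcases lt_or_ge i i₀ with h1 | h1
  · rw [hc i h1, Polynomial.coeff_zero]
  refine coeff_eq_zero_of_yEmb_mul_mem (hg i h1).isLead ?_ hl
  -- Coefficients in y do not change the exponent of x in the lead, so the summands have distinct
  -- leads.
  have key : ∀ i a, IsLead (yEmb k (c i) * g i) a → a 0 = t - i := by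
    intro i a ha
    have hci : c i ≠ 0 := by
      intro h0
      exact ha.ne_zero (by rw [h0, map_zero, zero_mul])
    have hi : i₀ ≤ i := by
      by_contra! hlt
      exact hci (hc i hlt)
    rw [ha.unique ((isLead_yEmb hci).mul (hg i hi).isLead)]
    simp
  refine mem_locFil_of_sum_mem (s := Finset.univ) (fun i _ j _ a hi hj => ?_) h i
    (Finset.mem_univ i)
  have h2 := key i a hi
  have h3 := key j a hj
  have := i.2
  have := j.2
  exact Fin.ext (by omega)

end CellElements

/-! ### Existence and uniqueness of the canonical matrix -/

section Bijection

variable {k : Type*} [Field k] {t : ℕ} {m : Fin (t + 1) → ℕ}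

theorem coeff_eq_zero_of_diff_le {N : Matrix (Fin (t + 1)) (Fin t) (Polynomial k)}
    (hN : N ∈ canonicalSet k m) (i : Fin (t + 1)) (j : Fin t) {l : ℕ} (hl : diff m j ≤ l) :
    (N i j).coeff l = 0 := by
  by_cases h0 : N i j = 0
  · rw [h0, Polynomial.coeff_zero]
  rcases lt_or_ge (j : ℕ) i with h | h
  · exact Polynomial.coeff_eq_zero_of_natDegree_lt ((((hN i j).2 h h0).2).trans_le hl)
  · exact absurd ((hN i j).1 h) h0

/-- Descending induction on columns. If all later minors agree, the difference w of the j-th minors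
lies in J and has smaller degree in x, so w ≡ ∑ q_i g_i with q_i in k[y]. The recursion gives
y^{d_j} w = ∑ (n'_{ij} - n_{ij}) g_i. Comparing coefficients, n'_{ij} - n_{ij} agrees with y^{d_j}
q_i in all degrees below d_j, so it vanishes there, and both entries have degree below d_j. -/
theorem injOn_idealOf (hm : IsLexSegment m) :
    Set.InjOn (idealOf m) (canonicalSet k m) := by
  classical
  intro N hN N' hN' hNN
  set J := idealOf m N with hJdef
  have hJ := isLead_idealOf_iff hm hN
  set g := signedMinor (fullMatrix m N) with hg
  set g' := signedMinor (fullMatrix m N') with hg'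
  have hgJ : ∀ i, g i ∈ J := fun i => by
    rw [hJdef, idealOf_eq_span]; exact Ideal.subset_span ⟨i, rfl⟩
  have hgJ' : ∀ i, g' i ∈ J := fun i => by
    rw [hNN, idealOf_eq_span]; exact Ideal.subset_span ⟨i, rfl⟩
  have hstd := isStd_signedMinor hm hN
  have hstd' := isStd_signedMinor hm hN'
  suffices h : ∀ n, (∀ i : Fin (t + 1), t - (i : ℕ) ≤ n → g i = g' i) ∧
      (∀ j : Fin t, t - (j : ℕ) ≤ n → ∀ i, N i j = N' i j) by
    ext1 i j
    exact (h t).2 j (Nat.sub_le _ _) i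
  intro n
  induction n with
  | zero =>
    refine ⟨fun i hi => ?_, fun j hj => ?_⟩
    · have : i = Fin.last t := by ext; simp; omega
      rw [this, hg, hg', signedMinor_fullMatrix_last hm fun i j => (hN i j).1,
        signedMinor_fullMatrix_last hm fun i j => (hN' i j).1]
    · have := j.2
      omega
  | succ n ih =>
    obtain ⟨ihg, ihN⟩ := ih
    have hstep : ∀ j : Fin t, t - (j : ℕ) ≤ n + 1 →
        (∀ i, N i j = N' i j) ∧ g j.castSucc = g' j.castSucc := by
      intro j hj
      have hgg : ∀ i : Fin (t + 1), (j : ℕ) < i → g i = g' i := fun i hi => ihg i (by omega)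
      have hjt := j.2
      set d := diff m j
      set w := g j.castSucc - g' j.castSucc with hw
      have hwx : w ∈ xDegLE k (t - j.succ) := by
        intro e he
        simp only [Fin.val_succ] at he
        rw [hw, map_sub]
        rcases lt_or_ge (t - (j : ℕ)) (e 0) with h | h
        · rw [(hstd _).mem_xDegLE e (by simpa using h), (hstd' _).mem_xDegLE e (by simpa using h),
            sub_zero]
        · have he0 : e 0 = t - (j.castSucc : ℕ) := by
            rw [Fin.val_castSucc]; omega
          rw [(hstd _).coeff_eq e he0, (hstd' _).coeff_eq e he0, sub_self]
      obtain ⟨q, hq, hqw⟩ := exists_approx_combination hm.2.2 (fun e he => (hJ e).mp he)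
        (i₀ := j.succ) (fun i _ => hgJ i) (fun i _ => hstd i)
        (J.sub_mem (hgJ j.castSucc) (hgJ' j.castSucc)) hwx
        -- Large enough to see every coefficient of degree l < d in front of any g_i, since
        -- generators have degree at most t + m_t.
        ((t + m (Fin.last t) + d + 1 + 1).choose 2)
      have hrel : MvPowerSeries.X 1 ^ d * w = ∑ i, yEmb k (N' i j - N i j) * g i := by
        have e1 := signedMinor_fullMatrix_rec m N j
        have e2 := signedMinor_fullMatrix_rec m N' j
        rw [← hg] at e1
        rw [← hg'] at e2
        have e3 : ∑ i, yEmb k (N' i j) * g' i = ∑ i, yEmb k (N' i j) * g i := by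
          refine Finset.sum_congr rfl fun i _ => ?_
          rcases lt_or_ge (j : ℕ) i with h | h
          · rw [hgg i h]
          · rw [(hN' i j).1 h, map_zero, zero_mul, zero_mul]
        rw [hw, mul_sub, e1, e2, hgg j.succ (by simp), e3]
        simp only [map_sub, sub_mul, Finset.sum_sub_distrib]
        ring
      have hsmall : ∑ i, yEmb k (N' i j - N i j - Polynomial.X ^ d * q i) * g i ∈
          locFil k ((t + m (Fin.last t) + d + 1 + 1).choose 2) := by
        have : ∑ i, yEmb k (N' i j - N i j - Polynomial.X ^ d * q i) * g i =
            MvPowerSeries.X 1 ^ d * (w - ∑ i, yEmb k (q i) * g i) := by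
          rw [mul_sub, hrel, Finset.mul_sum, ← Finset.sum_sub_distrib]
          refine Finset.sum_congr rfl fun i _ => ?_
          rw [map_sub, map_mul, yEmb_X_pow]
          ring
        rw [this]
        exact Ideal.mul_mem_left _ _ hqw
      have hcol : ∀ i, N i j = N' i j := by
        intro i
        ext l
        rcases lt_or_ge l d with hl | hl
        · have h1 := coeff_eq_zero_of_sum_mem (i₀ := j.succ) (fun i _ => hstd i) (fun i hi => by
            have hi' : (i : ℕ) ≤ j := by
              rw [Fin.lt_def, Fin.val_succ] at hi
              omega
            rw [hq i hi, (hN i j).1 hi', (hN' i j).1 hi', sub_zero, mul_zero, sub_zero])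
            hsmall i (l := l) (by
              apply locRank_lt_bound
              have := hm.2.2.monotone (Fin.le_last i)
              simp
              omega)
          rw [Polynomial.coeff_sub, Polynomial.coeff_sub, Polynomial.coeff_X_pow_mul',
            if_neg (by omega), sub_zero, sub_eq_zero] at h1
          exact h1.symm
        · rw [coeff_eq_zero_of_diff_le hN i j hl, coeff_eq_zero_of_diff_le hN' i j hl]
      refine ⟨hcol, ?_⟩
      have : MvPowerSeries.X 1 ^ d * w = MvPowerSeries.X 1 ^ d * 0 := by
        rw [hrel, mul_zero]
        exact Finset.sum_eq_zero fun i _ => by rw [hcol i, sub_self, map_zero, zero_mul]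
      exact sub_eq_zero.mp (isLeftRegular_X_pow d this)
    refine ⟨fun i hi => ?_, fun j hj => (hstep j hj).1⟩
    induction i using Fin.lastCases with
    | last => exact ihg _ (by simp)
    | cast j => exact (hstep j (by simpa using hi)).2

/-- One step of the construction of the canonical Hilbert-Burch matrix of an ideal. -/
theorem exists_column (hm : IsLexSegment m) {J : Ideal (R k)}
    (hJ : ∀ e, (∃ f ∈ J, IsLead f e) ↔ InMon m e) (j : Fin t) {g : Fin (t + 1) → R k}
    (hgJ : ∀ i : Fin (t + 1), (j : ℕ) < i → g i ∈ J)
    (hg : ∀ i : Fin (t + 1), (j : ℕ) < i → IsStd m i (g i)) :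
    ∃ (r : Fin (t + 1) → Polynomial k) (f : R k), f ∈ J ∧ IsStd m j.castSucc f ∧
      (∀ i : Fin (t + 1), (i : ℕ) ≤ j → r i = 0) ∧
      (∀ i : Fin (t + 1), ∀ l : ℕ, l + genDeg m i < genDeg m j.succ + 1 → (r i).coeff l = 0) ∧
      (∀ i, r i ≠ 0 → (r i).natDegree < diff m j) ∧
      MvPowerSeries.X 1 ^ diff m j * f =
        MvPowerSeries.X 0 * g j.succ - ∑ i, yEmb k (r i) * g i := by
  classical
  set d := diff m j with hd
  have hjt := j.2
  have hdpos : 0 < d := diff_pos hm.2.2 j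
  obtain ⟨f₀, hf₀J, hf₀⟩ := exists_isStd hm (fun e he => (hJ e).mpr he) j.castSucc
  have hsucc := hg j.succ (by simp)
  -- Both products have leading coefficient y^{m_{j+1}} at x^{t-j}, so the difference drops in
  -- degree in x and is a combination of the later g_i up to high order.
  set w := MvPowerSeries.X 0 * g j.succ - MvPowerSeries.X 1 ^ d * f₀ with hw
  have hwJ : w ∈ J :=
    J.sub_mem (J.mul_mem_left _ (hgJ j.succ (by simp))) (J.mul_mem_left _ hf₀J)
  have hlt : ∀ i : Fin (t + 1), j.succ ≤ i → (j : ℕ) < i := fun i hi => by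
    rw [Fin.le_def, Fin.val_succ] at hi; omega
  have hX1 : (MvPowerSeries.X 1 ^ d : R k) ∈ xDegLE k 0 := by
    rw [← yEmb_X_pow]; exact yEmb_mem_xDegLE _
  have hwx : w ∈ xDegLE k (t - j.succ) := by
    intro e he
    simp only [Fin.val_succ] at he
    rcases lt_or_ge (t - (j : ℕ)) (e 0) with h | h
    · have h1 : w ∈ xDegLE k (t - j) := by
        refine Submodule.sub_mem _ (xDegLE_mono ?_ (mul_mem_xDegLE X_zero_mem_xDegLE
          hsucc.mem_xDegLE)) (xDegLE_mono ?_ (mul_mem_xDegLE hX1 hf₀.mem_xDegLE))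
        · simp only [Fin.val_succ]; omega
        · simp
      exact h1 e h
    · have he0 : e 0 = t - (j : ℕ) := by omega
      have h1 : e = (Finsupp.single 0 (t - (j + 1)) + Finsupp.single 1 (e 1)) +
          Finsupp.single 0 1 := by
        apply expo_ext <;> simp
        omega
      have h2 : MvPowerSeries.coeff e (MvPowerSeries.X 0 * g j.succ) =
          if e 1 = m j.succ then 1 else 0 := by
        rw [h1, coeff_X_zero_mul, hsucc.coeff_eq _ (by simp)]
        simp
      have h3 : MvPowerSeries.coeff e (MvPowerSeries.X 1 ^ d * f₀) =
          if e 1 = m j.succ then 1 else 0 := by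
        have hadd := add_diff hm.2.2 j
        rcases le_or_gt d (e 1) with h4 | h4
        · have h5 : e = (Finsupp.single 0 (t - j) + Finsupp.single 1 (e 1 - d)) +
              Finsupp.single 1 d := by
            apply expo_ext <;> simp
            · omega
            · omega
          rw [h5, coeff_X_one_pow_mul, hf₀.coeff_eq _ (by simp)]
          refine if_congr ?_ rfl rfl
          simp
          omega
        · rw [if_neg (by omega), MvPowerSeries.X_pow_eq, MvPowerSeries.coeff_monomial_mul, if_neg]
          rw [expo_le_iff]
          simp
          omega
      rw [hw, map_sub, h2, h3, sub_self]
  have hword : w ∈ ordGE k (genDeg m j.succ + 1) := by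
    refine Ideal.sub_mem _ ?_ ?_
    · rw [add_comm]
      exact mul_mem_ordGE (X_mem_ordGE 0) hsucc.mem_ordGE
    · have h1 : (MvPowerSeries.X 1 ^ d : R k) ∈ ordGE k d := by
        rw [← maximalIdeal_pow]
        refine Ideal.pow_mem_pow ?_ _
        rw [← pow_one (IsLocalRing.maximalIdeal (R k)), maximalIdeal_pow]
        exact X_mem_ordGE 1
      have := genDeg_succ hm.2.2 j
      exact ordGE_anti (by omega) (mul_mem_ordGE h1 hf₀.mem_ordGE)
  set K := t + m (Fin.last t) with hK
  -- B ≥ t + d makes the error w', of degree at most t in x, divisible by y^d; B ≥ K + d puts the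
  -- quotient in J; B > `genDeg m j.succ` keeps the error from disturbing the order bounds on the
  -- c_i.
  set B := K + t + d + genDeg m j.succ + 1 with hB
  obtain ⟨c, hc, hcw⟩ := exists_approx_combination hm.2.2 (fun e he => (hJ e).mp he)
    (fun i hi => hgJ i (hlt i hi)) (fun i hi => hg i (hlt i hi)) hwJ hwx ((B + 1).choose 2)
  set w' := w - ∑ i, yEmb k (c i) * g i with hw'
  have hw'ord : w' ∈ ordGE k B := locFil_choose_le_ordGE B hcw
  have hc' : ∀ i : Fin (t + 1), ∀ l : ℕ, l + genDeg m i < genDeg m j.succ + 1 →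
      (c i).coeff l = 0 := by
    intro i l hl
    refine coeff_eq_zero_of_sum_mem (fun i hi => hg i (hlt i hi)) hc
      (n := (genDeg m j.succ + 1 + 1).choose 2) ?_ i ?_
    · refine ordGE_le_locFil_choose _ ?_
      have : ∑ i, yEmb k (c i) * g i = w - w' := by rw [hw']; ring
      rw [this]
      exact Ideal.sub_mem _ hword (ordGE_anti (by omega) hw'ord)
    · apply locRank_lt_bound
      have := genDeg_eq m i
      simp only [Finsupp.add_apply]
      simp at this ⊢
      omega
  have hw'x : w' ∈ xDegLE k (t - j.succ) := by
    refine Submodule.sub_mem _ hwx (Submodule.sum_mem _ fun i _ => ?_)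
    rcases lt_or_ge i j.succ with h | h
    · rw [hc i h, map_zero, zero_mul]; exact Submodule.zero_mem _
    · have := mul_mem_xDegLE (yEmb_mem_xDegLE (c i)) (hg i (hlt i h)).mem_xDegLE
      rw [Fin.le_def] at h
      exact xDegLE_mono (by omega) this
  obtain ⟨v, hv⟩ : (MvPowerSeries.X 1 ^ d : R k) ∣ w' := by
    rw [MvPowerSeries.X_pow_dvd_iff]
    intro e he
    rcases lt_or_ge (t - (j.succ : ℕ)) (e 0) with h | h
    · exact hw'x e h
    · exact hw'ord e (by omega)
  have hvJ : v ∈ J := by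
    refine ordGE_le_of_isLead hm (fun e he => (hJ e).mpr he) fun e he => ?_
    rw [← coeff_X_one_pow_mul d, ← hv]
    refine hw'ord _ ?_
    simp
    omega
  -- Division by y^d: the remainders of the c_i form the new column, while the quotients and the
  -- error are absorbed into f₀.
  let p : Polynomial k := Polynomial.X ^ d
  have hp : p.Monic := Polynomial.monic_X_pow d
  have hcq : ∀ i, c i %ₘ p + p * (c i /ₘ p) = c i := fun i => Polynomial.modByMonic_add_div (c i) p
  have hmod : ∀ i l, (c i %ₘ p).coeff l = if l < d then (c i).coeff l else 0 := by
    intro i l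
    split_ifs with hl
    · have := congrArg (fun q => Polynomial.coeff q l) (hcq i)
      simp only [Polynomial.coeff_add] at this
      rw [← this]
      simp only [p]
      rw [Polynomial.coeff_X_pow_mul', if_neg (by omega), add_zero]
    · apply Polynomial.coeff_eq_zero_of_degree_lt
      refine (Polynomial.degree_modByMonic_lt _ hp).trans_le ?_
      simp only [p]
      rw [Polynomial.degree_X_pow]
      exact_mod_cast not_lt.mp hl
  let r : Fin (t + 1) → Polynomial k := fun i => c i %ₘ p
  let f : R k := f₀ + ∑ i, yEmb k (c i /ₘ p) * g i + v
  have hr0 : ∀ i : Fin (t + 1), (i : ℕ) ≤ j → r i = 0 := by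
    intro i hi
    simp only [r]
    rw [hc i (by rw [Fin.lt_def, Fin.val_succ]; omega), Polynomial.zero_modByMonic]
  have hrord : ∀ i : Fin (t + 1), ∀ l : ℕ, l + genDeg m i < genDeg m j.succ + 1 →
      (r i).coeff l = 0 := by
    intro i l hl
    simp only [r]
    rw [hmod, hc' i l hl, ite_self]
  have hrec : MvPowerSeries.X 1 ^ d * f =
      MvPowerSeries.X 0 * g j.succ - ∑ i, yEmb k (r i) * g i := by
    have h1 : ∑ i, yEmb k (c i) * g i = ∑ i, yEmb k (r i) * g i +
        MvPowerSeries.X 1 ^ d * ∑ i, yEmb k (c i /ₘ p) * g i := by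
      rw [Finset.mul_sum, ← Finset.sum_add_distrib]
      refine Finset.sum_congr rfl fun i _ => ?_
      nth_rewrite 1 [← hcq i]
      rw [map_add, map_mul, yEmb_X_pow]
      ring
    simp only [f]
    rw [mul_add, mul_add, ← hv, hw', h1, hw]
    ring
  refine ⟨r, f, ?_, isStd_castSucc_of_rec hm.2.2 hr0 hrord hg hrec, hr0, hrord, fun i hi => ?_, hrec⟩
  · refine J.add_mem (J.add_mem hf₀J (J.sum_mem fun i _ => ?_)) hvJ
    rcases lt_or_ge i j.succ with h | h
    · rw [hc i h, Polynomial.zero_divByMonic, map_zero, zero_mul]; exact J.zero_mem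
    · exact J.mul_mem_left _ (hgJ i (hlt i h))
  · by_contra! hle
    have := hmod i (r i).natDegree
    rw [if_neg (by omega)] at this
    exact hi (Polynomial.leadingCoeff_eq_zero.mp this)

/-- The remainder of an element of J on division by I lies again in J, so its lead would be in the
monomial ideal, where a remainder has no exponents. Hence it is 0. -/
theorem eq_of_le_of_isLead (hm : IsLexSegment m) {I J : Ideal (R k)} (hIJ : I ≤ J)
    (hI : ∀ e, InMon m e → ∃ f ∈ I, IsLead f e) (hJ : ∀ e, (∃ f ∈ J, IsLead f e) → InMon m e) :
    I = J := by
  refine le_antisymm hIJ fun f hf => ?_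
  obtain ⟨j, hj, r, -, hr', h⟩ := exists_normalForm hI (n₀ := 0) (f := f) (fun e he => by omega)
    ((t + m (Fin.last t) + 1).choose 2)
  have h1 := ordGE_le_of_isLead hm hI (locFil_choose_le_ordGE _ h)
  have hrJ : r ∈ J := by
    have : r = f - j - (f - j - r) := by ring
    rw [this]
    exact J.sub_mem (J.sub_mem hf (hIJ hj)) (hIJ h1)
  have hr0 : r = 0 := by
    by_contra hne
    obtain ⟨a, ha⟩ := exists_isLead hne
    exact ha.1 (hr' a (hJ a ⟨r, hrJ, ha⟩))
  have : f = (f - j - r) + j + r := by ring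
  rw [this, hr0, add_zero, sub_zero]
  rw [hr0, sub_zero] at h1
  exact I.add_mem h1 hj

/-- Columns are produced from the last to the first by `exists_column`. The resulting series satisfy
the recursion of the minors, hence are the minors, so I_t(H + N) ⊆ J; equal leads force equality. -/
theorem exists_canonical (hm : IsLexSegment m) {J : Ideal (R k)}
    (hJ : ∀ e, (∃ f ∈ J, IsLead f e) ↔ InMon m e) : ∃ N ∈ canonicalSet k m, idealOf m N = J := by
  classical
  -- A standard element with index t has degree 0 in x and prescribed leading coefficient: it is
  -- y^{m_t}.
  have hlastJ : (MvPowerSeries.X 1 ^ m (Fin.last t) : R k) ∈ J := by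
    obtain ⟨f, hfJ, hf⟩ := exists_isStd hm (fun e he => (hJ e).mpr he) (Fin.last t)
    have hx : ∀ e : Fin 2 →₀ ℕ, MvPowerSeries.coeff e f =
        MvPowerSeries.coeff e (MvPowerSeries.X 1 ^ m (Fin.last t) : R k) := by
      intro e
      rcases Nat.eq_zero_or_pos (e 0) with h | h
      · rw [hf.coeff_eq e (by simp [h]), (isStd_last m).coeff_eq e (by simp [h])]
      · rw [hf.mem_xDegLE e (by simpa using h), (isStd_last m).mem_xDegLE e (by simpa using h)]
    rwa [← MvPowerSeries.ext hx]
  have key : ∀ n, ∃ (g : Fin (t + 1) → R k) (N : Matrix (Fin (t + 1)) (Fin t) (Polynomial k)),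
      g (Fin.last t) = MvPowerSeries.X 1 ^ m (Fin.last t) ∧
      (∀ i : Fin (t + 1), t - (i : ℕ) ≤ n → g i ∈ J ∧ IsStd m i (g i)) ∧
      ∀ j : Fin t, t - (j : ℕ) ≤ n →
        (∀ i : Fin (t + 1), (i : ℕ) ≤ j → N i j = 0) ∧
        (∀ i : Fin (t + 1), ∀ l : ℕ, l + genDeg m i < genDeg m j.succ + 1 →
          (N i j).coeff l = 0) ∧
        (∀ i, N i j ≠ 0 → (N i j).natDegree < diff m j) ∧
        MvPowerSeries.X 1 ^ diff m j * g j.castSucc =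
          MvPowerSeries.X 0 * g j.succ - ∑ i, yEmb k (N i j) * g i := by
    intro n
    induction n with
    | zero =>
      -- Only the last entry is constrained at this stage; the other values are placeholders.
      refine ⟨fun _ => MvPowerSeries.X 1 ^ m (Fin.last t), 0, rfl, fun i hi => ?_, fun j hj => ?_⟩
      · have : i = Fin.last t := by ext; simp; omega
        subst this
        exact ⟨hlastJ, isStd_last m⟩
      · have := j.2
        omega
    | succ n ih =>
      obtain ⟨g, N, hlast, hg, hN⟩ := ih
      by_cases hn : n + 1 ≤ t
      swap
      · exact ⟨g, N, hlast, fun i hi => hg i (by omega), fun j hj => hN j (by omega)⟩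
      let j : Fin t := ⟨t - (n + 1), by omega⟩
      have hj : (j : ℕ) = t - (n + 1) := rfl
      obtain ⟨r, f, hfJ, hf, hr0, hrord, hrdeg, hrec⟩ := exists_column hm hJ j
        (fun i hi => (hg i (by omega)).1) (fun i hi => (hg i (by omega)).2)
      have hne : ∀ i : Fin (t + 1), t - (i : ℕ) ≤ n → i ≠ j.castSucc := by
        rintro i hi rfl
        simp at hi
        omega
      refine ⟨Function.update g j.castSucc f, fun i j' => if j' = j then r i else N i j', ?_,
        fun i hi => ?_, fun j' hj' => ?_⟩
      · rw [Function.update_of_ne (hne _ (by simp)), hlast]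
      · by_cases h : i = j.castSucc
        · subst h
          rw [Function.update_self]
          exact ⟨hfJ, hf⟩
        · rw [Function.update_of_ne h]
          refine hg i ?_
          have : (i : ℕ) ≠ j := fun h' => h (Fin.ext h')
          omega
      · by_cases h : j' = j
        · subst h
          simp only [if_true]
          refine ⟨hr0, hrord, hrdeg, ?_⟩
          rw [Function.update_self, Function.update_of_ne (Fin.castSucc_lt_succ).ne', hrec]
          congr 1
          refine Finset.sum_congr rfl fun i _ => ?_
          rcases lt_or_ge (j : ℕ) i with h1 | h1
          · rw [Function.update_of_ne]
            rintro rfl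
            simp at h1
          · rw [hr0 i h1, map_zero, zero_mul, zero_mul]
        · have hj'n : t - (j' : ℕ) ≤ n := by
            have : (j' : ℕ) ≠ j := fun h' => h (Fin.ext h')
            have := j'.2
            omega
          simp only [if_neg h]
          obtain ⟨h1, h2, h3, h4⟩ := hN j' hj'n
          refine ⟨h1, h2, h3, ?_⟩
          rw [Function.update_of_ne (hne _ (by simpa using hj'n)),
            Function.update_of_ne (hne _ (by simp only [Fin.val_succ]; omega)), h4]
          congr 1
          refine Finset.sum_congr rfl fun i _ => ?_
          rcases lt_or_ge (j' : ℕ) i with h5 | h5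
          · rw [Function.update_of_ne (hne _ (by omega))]
          · rw [h1 i h5, map_zero, zero_mul, zero_mul]
  obtain ⟨g, N, hlast, hg, hN⟩ := key t
  have hNj := fun j : Fin t => hN j (Nat.sub_le _ _)
  have hmem : N ∈ canonicalSet k m := by
    intro i j
    obtain ⟨h1, h2, h3, -⟩ := hNj j
    refine ⟨h1 i, fun hij hne => ⟨?_, h3 i hne⟩⟩
    by_contra! hlt
    rw [degMatrix_eq] at hlt
    have := h2 i (N i j).natTrailingDegree (by omega)
    exact hne (Polynomial.trailingCoeff_eq_zero.mp this)
  have hgeq : g = signedMinor (fullMatrix m N) :=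
    eq_signedMinor_of_rec hm (fun i j => (hNj j).1 i) hlast fun j => (hNj j).2.2.2
  refine ⟨N, hmem, eq_of_le_of_isLead hm ?_ (fun e he => (isLead_idealOf_iff hm hmem e).mpr he)
    (fun e he => (hJ e).mp he)⟩
  rw [idealOf_eq_span, Ideal.span_le]
  rintro _ ⟨i, rfl⟩
  rw [← hgeq]
  exact (hg i (Nat.sub_le _ _)).1

theorem bijOn_idealOf {τ : MonomialOrder (Fin 2)}
    (hτ : Finsupp.single 1 1 ≺[τ] Finsupp.single 0 1) (hm : IsLexSegment m) :
    Set.BijOn (idealOf m) (canonicalSet k m) (groebnerCell τ (monIdeal k m)) := by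
  refine ⟨fun N hN => ?_, injOn_idealOf hm, fun J hJ => ?_⟩
  · exact (mem_groebnerCell_iff hτ).mpr (isLead_idealOf_iff hm hN)
  · obtain ⟨N, hN, h⟩ := exists_canonical hm ((mem_groebnerCell_iff hτ).mp hJ)
    exact ⟨N, hN, h⟩

end Bijection

/-! ### Coordinates on the cell and the matrix of constant terms -/

section Affine

variable {k : Type*} [Field k] {t : ℕ} {m : Fin (t + 1) → ℕ}

/-- The coordinate with a given position. -/
def coordMk (i : Fin (t + 1)) (j : Fin t) (l : ℕ) (hl : IsFree m i j l) : Coord m :=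
  ⟨(i, j, l), hl⟩

theorem coeff_genericMatrix (i : Fin (t + 1)) (j : Fin t) (l : ℕ) (hl : IsFree m i j l) :
    (genericMatrix k m i j).coeff l = MvPolynomial.X (coordMk i j l hl) := by
  classical
  rw [genericMatrix, Polynomial.finsetSum_coeff, Finset.sum_eq_single l]
  · rw [dif_pos hl, Polynomial.coeff_monomial, if_pos rfl]
    rfl
  · intro l' _ hne
    split_ifs
    · rw [Polynomial.coeff_monomial, if_neg hne]
    · rw [Polynomial.coeff_zero]
  · intro h
    exact absurd (Finset.mem_range.mpr hl.2.2) h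

theorem coeff_genericMatrix_of_not (i : Fin (t + 1)) (j : Fin t) (l : ℕ)
    (hl : ¬ IsFree m i j l) : (genericMatrix k m i j).coeff l = 0 := by
  classical
  rw [genericMatrix, Polynomial.finsetSum_coeff]
  refine Finset.sum_eq_zero fun l' _ => ?_
  split_ifs with h
  · rw [Polynomial.coeff_monomial, if_neg]
    rintro rfl
    exact hl h
  · rw [Polynomial.coeff_zero]

theorem coeff_matrixAt (c : Coord m → k) (i : Fin (t + 1)) (j : Fin t) (l : ℕ)
    (hl : IsFree m i j l) : (matrixAt m c i j).coeff l = c (coordMk i j l hl) := by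
  rw [matrixAt, Matrix.map_apply, Polynomial.coeff_map, coeff_genericMatrix i j l hl,
    MvPolynomial.eval_X]

theorem coeff_matrixAt_of_not (c : Coord m → k) (i : Fin (t + 1)) (j : Fin t) (l : ℕ)
    (hl : ¬ IsFree m i j l) : (matrixAt m c i j).coeff l = 0 := by
  rw [matrixAt, Matrix.map_apply, Polynomial.coeff_map, coeff_genericMatrix_of_not i j l hl,
    map_zero]

theorem isFree_of_coeff_ne_zero {N : Matrix (Fin (t + 1)) (Fin t) (Polynomial k)}
    (hN : N ∈ canonicalSet k m) {i : Fin (t + 1)} {j : Fin t} {l : ℕ}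
    (h : (N i j).coeff l ≠ 0) : IsFree m i j l := by
  have h0 : N i j ≠ 0 := by
    intro h'
    rw [h', Polynomial.coeff_zero] at h
    exact h rfl
  have hij : (j : ℕ) < i := by
    by_contra! hle
    exact h0 ((hN i j).1 hle)
  obtain ⟨h1, h2⟩ := (hN i j).2 hij h0
  have h3 := Polynomial.natTrailingDegree_le_of_ne_zero h
  have h4 := Polynomial.le_natDegree_of_ne_zero h
  exact ⟨hij, by omega, by omega⟩

theorem bijOn_matrixAt : Set.BijOn (matrixAt (k := k) m) Set.univ (canonicalSet k m) := by
  classical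
  refine ⟨fun c _ i j => ?_, fun c _ c' _ h => ?_, fun N hN => ?_⟩
  · have hfree : ∀ l, (matrixAt m c i j).coeff l ≠ 0 → IsFree m i j l := fun l hl => by
      by_contra h
      exact hl (coeff_matrixAt_of_not c i j l h)
    refine ⟨fun hij => ?_, fun _ h0 => ⟨?_, ?_⟩⟩
    · ext l
      rw [Polynomial.coeff_zero]
      by_contra h
      exact absurd (hfree l h).1 (not_lt.mpr hij)
    · exact (hfree _ (mt Polynomial.trailingCoeff_eq_zero.mp h0)).2.1
    · exact (hfree _ (mt Polynomial.leadingCoeff_eq_zero.mp h0)).2.2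
  · funext s
    obtain ⟨⟨i, j, l⟩, hl⟩ := s
    have := congrArg (fun M => (M i j).coeff l) h
    exact (coeff_matrixAt c i j l hl).symm.trans (this.trans (coeff_matrixAt c' i j l hl))
  · refine ⟨fun s => (N s.1.1 s.1.2.1).coeff s.1.2.2, Set.mem_univ _, ?_⟩
    ext i j l
    by_cases hl : IsFree m i j l
    · rw [coeff_matrixAt _ i j l hl]
      rfl
    · rw [coeff_matrixAt_of_not _ i j l hl]
      by_contra h
      exact hl (isFree_of_coeff_ne_zero hN (Ne.symm h))

theorem bijOn_cellMap {τ : MonomialOrder (Fin 2)}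
    (hτ : Finsupp.single 1 1 ≺[τ] Finsupp.single 0 1) (hm : IsLexSegment m) :
    Set.BijOn (cellMap m) Set.univ (groebnerCell τ (monIdeal k m)) :=
  (bijOn_idealOf hτ hm).comp bijOn_matrixAt

/-- The constant terms of the generic matrix at a point. -/
noncomputable def constAt (m : Fin (t + 1) → ℕ) (c : Coord m → k) :
    Matrix (Fin (t + 1)) (Fin t) k :=
  (genericConst k m).map (MvPolynomial.eval c)

theorem constAt_apply (c : Coord m → k) (i : Fin (t + 1)) (j : Fin t) :
    constAt m c i j = (matrixAt m c i j).coeff 0 := by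
  rw [matrixAt, Matrix.map_apply, Polynomial.coeff_map]
  rfl

/-- All d_j are positive, so H vanishes modulo the maximal ideal. -/
theorem constantCoeff_fullMatrix (hm : StrictMono m) (c : Coord m → k) :
    (fullMatrix m (matrixAt m c)).map MvPowerSeries.constantCoeff = constAt m c := by
  ext i j
  rw [Matrix.map_apply, fullMatrix_apply, map_add, constAt_apply]
  have h1 : MvPowerSeries.constantCoeff (hbMatrix k m i j) = 0 := by
    rw [hbMatrix]
    split_ifs
    · rw [map_pow, MvPowerSeries.constantCoeff_X, zero_pow (diff_pos hm j).ne']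
    · rw [map_neg, MvPowerSeries.constantCoeff_X, neg_zero]
    · rw [map_zero]
  rw [h1, zero_add, ← MvPowerSeries.coeff_zero_eq_constantCoeff_apply, coeff_yEmb]
  simp

end Affine

/-! ### The number of generators -/

section Generators

variable {k : Type*} [Field k] {t : ℕ} {m : Fin (t + 1) → ℕ}

theorem mem_maximalIdeal_iff {f : R k} :
    f ∈ IsLocalRing.maximalIdeal (R k) ↔ MvPowerSeries.constantCoeff f = 0 := by
  rw [IsLocalRing.mem_maximalIdeal, mem_nonunits_iff, MvPowerSeries.isUnit_iff_constantCoeff,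
    isUnit_iff_ne_zero, not_not]

/-- J/𝔪J is k^{t+1} modulo the column space W of N̄: columns of H + N are syzygies, and conversely
the constant terms of every syzygy lie in W. -/
theorem spanFinrank_cellMap (hm : IsLexSegment m) (c : Coord m → k) :
    Submodule.spanFinrank (cellMap m c) + (constAt m c).rank = t + 1 := by
  classical
  have hN : matrixAt m c ∈ canonicalSet k m := bijOn_matrixAt.mapsTo (Set.mem_univ c)
  set M := fullMatrix m (matrixAt m c) with hM
  set g := signedMinor M with hg
  have hJ : cellMap m c = Ideal.span (Set.range g) := idealOf_eq_span m _
  set J := cellMap m c with hJdef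
  have hgJ : ∀ i, g i ∈ J := fun i => by rw [hJ]; exact Ideal.subset_span ⟨i, rfl⟩
  set W := LinearMap.range (constAt m c).mulVecLin with hW
  have hWrank : Module.finrank k W = (constAt m c).rank := rfl
  have hconst : M.map MvPowerSeries.constantCoeff = constAt m c :=
    constantCoeff_fullMatrix hm.2.2 c
  apply le_antisymm
  -- Combinations of the minors with coefficient vectors in a complement of W generate J by
  -- Nakayama.
  · obtain ⟨U, hU⟩ := Submodule.exists_isCompl W
    have hdim := Submodule.finrank_add_eq_of_isCompl hU
    rw [Module.finrank_fin_fun, hWrank] at hdim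
    let b := Module.finBasis k U
    let s : Fin (Module.finrank k U) → R k := fun a =>
      ∑ i, MvPowerSeries.C ((b a : Fin (t + 1) → k) i) * g i
    have hspan : J = Ideal.span (Set.range s) := by
      apply le_antisymm
      · refine Submodule.le_of_le_smul_of_le_jacobson_bot (I := IsLocalRing.maximalIdeal (R k))
          (IsNoetherian.noetherian _) (IsLocalRing.maximalIdeal_le_jacobson _) ?_
        conv_lhs => rw [hJ]
        rw [Ideal.span_le]
        rintro _ ⟨l, rfl⟩
        have hU' : ∀ u : Fin (t + 1) → k, u ∈ U →
            ∑ i, MvPowerSeries.C (u i) * g i ∈ Ideal.span (Set.range s) := by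
          intro u hu
          have h1 : u = ∑ a, b.repr ⟨u, hu⟩ a • (b a : Fin (t + 1) → k) := by
            conv_lhs => rw [← Subtype.coe_mk u hu, ← b.sum_repr ⟨u, hu⟩]
            rw [AddSubmonoidClass.coe_finsetSum]
            rfl
          have h2 : ∑ i, MvPowerSeries.C (u i) * g i =
              ∑ a, MvPowerSeries.C (b.repr ⟨u, hu⟩ a) * s a := by
            simp only [s, Finset.mul_sum]
            rw [Finset.sum_comm]
            refine Finset.sum_congr rfl fun i _ => ?_
            have h3 : u i = ∑ a, b.repr ⟨u, hu⟩ a * (b a : Fin (t + 1) → k) i := by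
              conv_lhs => rw [h1]
              simp
            rw [h3, map_sum, Finset.sum_mul]
            refine Finset.sum_congr rfl fun a _ => ?_
            rw [map_mul, mul_assoc]
          rw [h2]
          exact Ideal.sum_mem _ fun a _ => Ideal.mul_mem_left _ _ (Ideal.subset_span ⟨a, rfl⟩)
        -- Subtracting the syzygy (H + N)v from w = N̄v leaves coefficients with zero constant term.
        have hW' : ∀ w ∈ W, ∑ i, MvPowerSeries.C (w i) * g i ∈
            IsLocalRing.maximalIdeal (R k) • J := by
          rintro _ ⟨v, rfl⟩
          have h0 := sum_mul_mulVec (m := m) (matrixAt m c) (fun j => MvPowerSeries.C (v j))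
          rw [← hM, ← hg] at h0
          have h1 : ∑ i, MvPowerSeries.C ((constAt m c).mulVecLin v i) * g i =
              ∑ i, (MvPowerSeries.C ((constAt m c).mulVecLin v i) -
                M.mulVec (fun j => MvPowerSeries.C (v j)) i) * g i := by
            simp only [sub_mul, Finset.sum_sub_distrib, h0, sub_zero]
          rw [h1]
          refine Submodule.sum_mem _ fun i _ => Submodule.smul_mem_smul ?_ (hgJ i)
          rw [mem_maximalIdeal_iff, map_sub, MvPowerSeries.constantCoeff_C, sub_eq_zero, ← hconst]
          simp [Matrix.mulVec, dotProduct]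
        obtain ⟨w, hw, u, hu, hwu⟩ := Submodule.mem_sup.mp
          (hU.sup_eq_top ▸ Submodule.mem_top : (Pi.single l 1 : Fin (t + 1) → k) ∈ W ⊔ U)
        have hgl : g l = ∑ i, MvPowerSeries.C (u i) * g i +
            ∑ i, MvPowerSeries.C (w i) * g i := by
          have : ∀ i, MvPowerSeries.C (u i) * g i + MvPowerSeries.C (w i) * g i =
              if i = l then g i else 0 := by
            intro i
            rw [← add_mul, ← map_add, add_comm, ← Pi.add_apply, hwu, Pi.single_apply]
            split_ifs <;> simp
          rw [← Finset.sum_add_distrib]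
          simp [this]
        rw [hgl]
        exact Submodule.add_mem_sup (hU' u hu) (hW' w hw)
      · rw [Ideal.span_le]
        rintro _ ⟨a, rfl⟩
        exact J.sum_mem fun i _ => J.mul_mem_left _ (hgJ i)
    have hle : Submodule.spanFinrank J ≤ Module.finrank k U := by
      rw [hspan]
      refine (Submodule.spanFinrank_span_le_ncard_of_finite (Set.finite_range s)).trans ?_
      rw [← Set.image_univ]
      refine (Set.ncard_image_le Set.finite_univ).trans ?_
      rw [Set.ncard_univ, Nat.card_eq_fintype_card, Fintype.card_fin]
    omega
  · obtain ⟨S, hScard, hS⟩ := (IsNoetherian.noetherian J :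
      J.FG).exists_span_finset_card_eq_spanFinrank
    have hB : ∀ x ∈ S, ∃ B : Fin (t + 1) → R k, ∑ i, B i • g i = x := by
      intro x hx
      refine (Submodule.mem_span_range_iff_exists_fun _).mp ?_
      change x ∈ Ideal.span (Set.range g)
      rw [← hJ, ← hS]
      exact Submodule.subset_span hx
    choose! B hB using hB
    let B₀ : R k → Fin (t + 1) → k := fun x i => MvPowerSeries.constantCoeff (B x i)
    -- Rewriting each minor through S gives a syzygy; its constant terms express every unit vector
    -- modulo W by the constant terms of the coefficient vectors of S.
    have htop : W ⊔ Submodule.span k (S.image B₀ : Set (Fin (t + 1) → k)) = ⊤ := by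
      rw [eq_top_iff, ← (Pi.basisFun k (Fin (t + 1))).span_eq, Submodule.span_le]
      rintro _ ⟨i, rfl⟩
      rw [Pi.basisFun_apply]
      obtain ⟨C, -, hC⟩ := Submodule.mem_span_finset.mp (hS.symm ▸ hgJ i :
        g i ∈ Submodule.span (R k) (S : Set (R k)))
      have hrel : ∑ l, ((Pi.single i 1 : Fin (t + 1) → R k) l - ∑ x ∈ S, C x * B x l) * g l
          = 0 := by
        simp only [sub_mul, Finset.sum_sub_distrib, Finset.sum_mul]
        rw [Finset.sum_comm]
        have h1 : ∀ x ∈ S, ∑ l, C x * B x l * g l = C x • x := by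
          intro x hx
          have h2 := congrArg (fun y => C x * y) (hB x hx)
          simp only [Finset.mul_sum, smul_eq_mul] at h2
          rw [smul_eq_mul, ← h2]
          exact Finset.sum_congr rfl fun l _ => mul_assoc _ _ _
        rw [Finset.sum_congr rfl h1, hC, sub_eq_zero, Finset.sum_eq_single i]
        · simp
        · intro b _ hb
          rw [Pi.single_eq_of_ne hb, zero_mul]
        · simp
      obtain ⟨v, hv⟩ := exists_mulVec_eq_coeff_zero hm hN hrel
      rw [← hM, hconst] at hv
      have heq : (Pi.single i 1 : Fin (t + 1) → k) = (constAt m c).mulVecLin v +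
          ∑ x ∈ S, MvPowerSeries.constantCoeff (C x) • B₀ x := by
        funext l
        rw [Pi.add_apply, Matrix.mulVecLin_apply, ← hv l, map_sub, Finset.sum_apply, map_sum]
        simp only [map_mul, B₀, Pi.smul_apply, smul_eq_mul, sub_add_cancel]
        simp only [Pi.single_apply]
        split_ifs <;> simp
      rw [heq]
      refine Submodule.add_mem_sup ⟨v, rfl⟩ (Submodule.sum_mem _ fun x hx => ?_)
      exact Submodule.smul_mem _ _ (Submodule.subset_span (by
        simpa using ⟨x, hx, rfl⟩))
    have h1 := Submodule.finrank_add_le_finrank_add_finrank W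
      (Submodule.span k (S.image B₀ : Set (Fin (t + 1) → k)))
    rw [htop, finrank_top, Module.finrank_fin_fun, hWrank] at h1
    have h2 : Module.finrank k (Submodule.span k (S.image B₀ : Set (Fin (t + 1) → k))) ≤ S.card :=
      (finrank_span_finset_le_card _).trans Finset.card_image_le
    omega

theorem spanRank_cellMap_eq_iff (hm : IsLexSegment m) (c : Coord m → k) (d : ℕ) :
    Submodule.spanRank (cellMap m c) = (d : Cardinal) ↔ d + (constAt m c).rank = t + 1 := by
  have hfg : Submodule.FG (cellMap m c) := IsNoetherian.noetherian _
  have := spanFinrank_cellMap hm c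
  rw [hfg.spanRank_eq_spanFinrank, Nat.cast_inj]
  omega

end Generators

/-! ### Rank and minors -/

section RankMinors

variable {k : Type*} [Field k]

/-- Independent rows are chosen and then sorted, as minors are indexed by increasing maps. -/
theorem exists_strictMono_linearIndependent_row {p : ℕ} {ι : Type*} [Fintype ι]
    (A : Matrix (Fin p) ι k) {r : ℕ} (hr : r ≤ A.rank) :
    ∃ f : Fin r ↪o Fin p, LinearIndependent k (A.submatrix f id).row := by
  classical
  rw [Matrix.rank_eq_finrank_span_row] at hr
  obtain ⟨b, hb, -, hli⟩ := Submodule.exists_fun_fin_finrank_span_eq k (Set.range A.row)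
  choose f hf using hb
  let f' : Fin r → Fin p := fun a => f (Fin.castLE hr a)
  have hli' : LinearIndependent k (fun a => A.row (f' a)) := by
    have heq : (fun a => A.row (f' a)) = b ∘ Fin.castLE hr := funext fun a => hf _
    rw [heq]
    exact hli.comp (Fin.castLE hr) (Fin.castLE_injective hr)
  have hinj : Function.Injective f' := fun a a' h => hli'.injective (by simp only [h])
  have hmono : StrictMono (f' ∘ Tuple.sort f') :=
    (Tuple.monotone_sort f').strictMono_of_injective (hinj.comp (Tuple.sort f').injective)
  exact ⟨OrderEmbedding.ofStrictMono _ hmono, hli'.comp _ (Tuple.sort f').injective⟩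

/-- A matrix has rank less than `r` if and only if all its `r × r` minors vanish. -/
theorem rank_lt_iff_forall_minor_eq_zero {p q : ℕ} (A : Matrix (Fin p) (Fin q) k) (r : ℕ) :
    A.rank < r ↔ ∀ (f : Fin r ↪o Fin p) (g : Fin r ↪o Fin q), (A.submatrix f g).det = 0 := by
  classical
  constructor
  · intro h f g
    by_contra hne
    have h1 := Matrix.rank_of_isUnit (A.submatrix f g)
      ((Matrix.isUnit_iff_isUnit_det _).mpr (isUnit_iff_ne_zero.mpr hne))
    have h2 := Matrix.rank_submatrix_le A f g
    rw [h1, Fintype.card_fin] at h2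
    omega
  · intro h
    by_contra! hr
    obtain ⟨f, hf⟩ := exists_strictMono_linearIndependent_row A hr
    have h1 : r ≤ (A.submatrix f id).transpose.rank := by
      rw [Matrix.rank_transpose, hf.rank_matrix, Fintype.card_fin]
    obtain ⟨g, hg⟩ := exists_strictMono_linearIndependent_row _ h1
    have h2 : IsUnit ((A.submatrix f id).transpose.submatrix g id) :=
      Matrix.linearIndependent_rows_iff_isUnit.mp hg
    have h3 := (Matrix.isUnit_iff_isUnit_det _).mp h2
    have h4 : (A.submatrix f id).transpose.submatrix g id = (A.submatrix f g).transpose := rfl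
    rw [h4, Matrix.det_transpose, h f g] at h3
    exact not_isUnit_zero h3

/-- Evaluation commutes with determinants. For r = 0 both sides are false: the empty minor is 1. -/
theorem mem_zeroLocus_minorIdeal_iff {t : ℕ} {m : Fin (t + 1) → ℕ} (c : Coord m → k) (r : ℕ) :
    c ∈ MvPolynomial.zeroLocus k (minorIdeal r (genericConst k m)) ↔ (constAt m c).rank < r := by
  have hdet : ∀ (f : Fin r ↪o Fin (t + 1)) (g : Fin r ↪o Fin t),
      MvPolynomial.aeval c ((genericConst k m).submatrix f g).det =
        ((constAt m c).submatrix f g).det := by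
    intro f g
    rw [AlgHom.map_det]
    rfl
  rw [rank_lt_iff_forall_minor_eq_zero, MvPolynomial.mem_zeroLocus_iff]
  constructor
  · intro h f g
    rw [← hdet]
    exact h _ (Ideal.subset_span ⟨f, g, rfl⟩)
  · intro h
    have hle : minorIdeal r (genericConst k m) ≤ RingHom.ker (MvPolynomial.aeval (R := k) c) := by
      rw [minorIdeal, Ideal.span_le]
      rintro _ ⟨f, g, rfl⟩
      rw [SetLike.mem_coe, RingHom.mem_ker, hdet, h]
    exact fun p hp => hle hp

end RankMinors

section Strata

variable {k : Type*} [Field k] {t : ℕ} {m : Fin (t + 1) → ℕ}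

theorem bettiStratum_eq {τ : MonomialOrder (Fin 2)}
    (hτ : Finsupp.single 1 1 ≺[τ] Finsupp.single 0 1) (hm : IsLexSegment m) {d : ℕ}
    (hd : d ≤ t + 1) : bettiStratum τ (monIdeal k m) d =
      cellMap m '' (MvPolynomial.zeroLocus k (minorIdeal (t + 2 - d) (genericConst k m)) \
        MvPolynomial.zeroLocus k (minorIdeal (t + 1 - d) (genericConst k m))) := by
  have hbij := bijOn_cellMap (k := k) hτ hm
  have hiff : ∀ c : Coord m → k, Submodule.spanRank (cellMap m c) = (d : Cardinal) ↔
      c ∈ MvPolynomial.zeroLocus k (minorIdeal (t + 2 - d) (genericConst k m)) \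
        MvPolynomial.zeroLocus k (minorIdeal (t + 1 - d) (genericConst k m)) := by
    intro c
    rw [spanRank_cellMap_eq_iff hm, Set.mem_sdiff, mem_zeroLocus_minorIdeal_iff,
      mem_zeroLocus_minorIdeal_iff]
    omega
  ext J
  constructor
  · rintro ⟨hJ, hd⟩
    obtain ⟨c, -, rfl⟩ := hbij.surjOn hJ
    exact ⟨c, (hiff c).mp hd, rfl⟩
  · rintro ⟨c, hc, rfl⟩
    exact ⟨hbij.mapsTo (Set.mem_univ c), (hiff c).mpr hc⟩

end Strata

/-! ### The Hilbert function of a lex-segment ideal -/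

section Hilbert

variable {k : Type*} [Field k] {t : ℕ} {m : Fin (t + 1) → ℕ}

theorem inMon_iff_of_lt (hm : StrictMono m) {e : Fin 2 →₀ ℕ} {i : Fin t}
    (he : e 0 = t - (i + 1)) : InMon m e ↔ m i.succ ≤ e 1 := by
  have hi := i.2
  constructor
  · rintro ⟨i', h1, h2⟩
    refine le_trans (hm.monotone ?_) h2
    rw [Fin.le_def, Fin.val_succ]
    omega
  · intro h
    exact ⟨i.succ, by rw [Fin.val_succ, he], h⟩

theorem coeff_eq_zero_of_mem_monIdealR {f : R k} (hf : f ∈ monIdealR k m) {e : Fin 2 →₀ ℕ}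
    (he : ¬ InMon m e) : MvPowerSeries.coeff e f = 0 := by
  classical
  let I : Ideal (R k) :=
    { carrier := {f | ∀ e, ¬ InMon m e → MvPowerSeries.coeff e f = 0}
      zero_mem' := by simp
      add_mem' := by
        intro f g hf hg e he
        rw [map_add, hf e he, hg e he, add_zero]
      smul_mem' := by
        intro c f hf e he
        rw [smul_eq_mul, MvPowerSeries.coeff_mul]
        refine Finset.sum_eq_zero fun p hp => ?_
        rw [Finset.HasAntidiagonal.mem_antidiagonal] at hp
        subst hp
        rw [hf p.2 fun h => he (h.mono le_add_self), mul_zero] }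
  have hle : monIdealR k m ≤ I := by
    rw [monIdealR, monIdeal_eq, Ideal.map_le_iff_le_comap, Ideal.span_le]
    rintro _ ⟨_, ⟨i, rfl⟩, rfl⟩ e he
    change MvPowerSeries.coeff e (MvPolynomial.monomial (genExp m i) (1 : k) : R k) = 0
    rw [MvPolynomial.coeff_coe, MvPolynomial.coeff_monomial, if_neg]
    rintro rfl
    exact he (inMon_genExp m i)
  exact hle hf e he

theorem monomial_mem_monIdealR {e : Fin 2 →₀ ℕ} (he : InMon m e) (c : k) :
    MvPowerSeries.monomial e c ∈ monIdealR k m := by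
  have h1 : MvPowerSeries.monomial e c =
      MvPowerSeries.C c * MvPowerSeries.monomial e (1 : k) := by
    rw [← MvPowerSeries.smul_eq_C_mul, ← map_smul, smul_eq_mul, mul_one]
  rw [h1]
  refine Ideal.mul_mem_left _ _ ?_
  have := Ideal.mem_map_of_mem MvPolynomial.coeToMvPowerSeries.ringHom
    (monomial_mem_monIdeal (k := k).mpr he)
  rwa [MvPolynomial.coeToMvPowerSeries.ringHom_apply, MvPolynomial.coe_monomial] at this

/-- The exponent of degree `j` whose exponent of `x` is `t - (i + 1)`. -/
noncomputable def degExp {t : ℕ} (j : ℕ) (i : Fin t) : Fin 2 →₀ ℕ :=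
  Finsupp.single 0 (t - (i + 1)) + Finsupp.single 1 (j + (i + 1) - t)

theorem degExp_zero (j : ℕ) (i : Fin t) : degExp j i 0 = t - (i + 1) := by simp [degExp]

theorem degExp_one (j : ℕ) (i : Fin t) : degExp j i 1 = j + (i + 1) - t := by simp [degExp]

/-- The monomials of degree j outside L form a basis. For the exponent t - (i + 1) of x, such a
monomial exists iff t - (i + 1) ≤ j and its exponent of y is below m_{i+1}. The map to the quotient
and the map reading off these coefficients are surjections from 𝔪^j with the same kernel. -/
theorem hilbertFunction_monIdealR (hm : IsLexSegment m) (j : ℕ) :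
    hilbertFunction (monIdealR k m) j =
      (Finset.univ.filter fun i : Fin t => t ≤ j + 1 + i ∧ j < genDeg m i.succ).card := by
  classical
  let T := {i : Fin t // t ≤ j + 1 + i ∧ j < genDeg m i.succ}
  have hgd : ∀ i : Fin t, genDeg m i.succ = t - (i + 1) + m i.succ := fun i => by
    rw [genDeg, Fin.val_succ]
  set I := IsLocalRing.maximalIdeal (R k) ^ (j + 1) ⊔ monIdealR k m with hI
  let V : Ideal (R k ⧸ I) := (IsLocalRing.maximalIdeal (R k) ^ j).map (Ideal.Quotient.mk I)
  let A : Submodule k (R k) := (IsLocalRing.maximalIdeal (R k) ^ j).restrictScalars k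
  let Φ : A →ₗ[k] V :=
    { toFun := fun f => ⟨Ideal.Quotient.mk I f.1, Ideal.mem_map_of_mem _ f.2⟩
      map_add' := fun f g => rfl
      map_smul' := fun c f => rfl }
  let Ψ : A →ₗ[k] (T → k) :=
    { toFun := fun f s => MvPowerSeries.coeff (degExp j s.1) f.1
      map_add' := fun f g => by ext s; simp
      map_smul' := fun c f => by ext s; simp }
  have hΦ : Function.Surjective Φ := by
    rintro ⟨v, hv⟩
    obtain ⟨f, hf, rfl⟩ := (Ideal.mem_map_iff_of_surjective _ Ideal.Quotient.mk_surjective).mp hv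
    exact ⟨⟨f, hf⟩, rfl⟩
  have hmemA : ∀ f : R k, f ∈ A ↔ f ∈ ordGE k j := by
    intro f
    rw [← maximalIdeal_pow]
    rfl
  have hinj : ∀ s s' : Fin t, degExp j s = degExp j s' → s = s' := by
    intro s s' h
    have := DFunLike.congr_fun h 0
    rw [degExp_zero, degExp_zero] at this
    have := s.2
    have := s'.2
    exact Fin.ext (by omega)
  have hΨ : Function.Surjective Ψ := by
    intro c
    refine ⟨⟨∑ s : T, MvPowerSeries.monomial (degExp j s.1) (c s), ?_⟩, ?_⟩
    · rw [hmemA]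
      refine Ideal.sum_mem _ fun s _ e he => ?_
      rw [MvPowerSeries.coeff_monomial_ne]
      rintro rfl
      rw [degExp_zero, degExp_one] at he
      have := s.2.1
      have := s.1.2
      omega
    · funext s
      change MvPowerSeries.coeff (degExp j s.1) (∑ s : T, _) = c s
      rw [map_sum, Finset.sum_eq_single s]
      · rw [MvPowerSeries.coeff_monomial_same]
      · intro s' _ hne
        rw [MvPowerSeries.coeff_monomial_ne]
        intro h
        exact hne (Subtype.ext (hinj _ _ h.symm))
      · simp
  have hnot : ∀ s : T, ¬ InMon m (degExp j s.1) := by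
    rintro ⟨i, h1, h2⟩
    rw [inMon_iff_of_lt hm.2.2 (degExp_zero j i), degExp_one]
    rw [hgd] at h2
    omega
  have hker : LinearMap.ker Φ = LinearMap.ker Ψ := by
    ext ⟨f, hf⟩
    rw [LinearMap.mem_ker, LinearMap.mem_ker]
    have h0 : Φ ⟨f, hf⟩ = 0 ↔ f ∈ I := by
      rw [← Ideal.Quotient.eq_zero_iff_mem, Subtype.ext_iff]
      rfl
    rw [h0]
    constructor
    · intro hfI
      obtain ⟨a, ha, b, hb, rfl⟩ := Submodule.mem_sup.mp hfI
      funext s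
      change MvPowerSeries.coeff (degExp j s.1) (a + b) = 0
      rw [maximalIdeal_pow] at ha
      rw [map_add, coeff_eq_zero_of_mem_monIdealR hb (hnot s), add_zero]
      refine ha _ ?_
      rw [degExp_zero, degExp_one]
      have := s.1.2
      have := s.2.1
      omega
    · intro hfΨ
      rw [hmemA] at hf
      let ex : ℕ → (Fin 2 →₀ ℕ) := fun a => Finsupp.single 0 a + Finsupp.single 1 (j - a)
      have hex : ∀ a, ex a 0 = a ∧ ex a 1 = j - a := fun a => by simp [ex]
      -- The homogeneous part of degree j: if the coefficients outside L vanish, it lies in L, and f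
      -- - p has order above j.
      set p : R k := ∑ a ∈ Finset.range (j + 1),
        MvPowerSeries.monomial (ex a) (MvPowerSeries.coeff (ex a) f) with hp
      have hpI : p ∈ monIdealR k m := by
        refine Ideal.sum_mem _ fun a ha => ?_
        rw [Finset.mem_range] at ha
        by_cases hin : InMon m (ex a)
        · exact monomial_mem_monIdealR hin _
        · have hat : a < t := by
            by_contra! hle
            exact hin ⟨0, by simpa [(hex a).1] using hle, by rw [hm.2.1]; exact Nat.zero_le _⟩
          let i : Fin t := ⟨t - 1 - a, by omega⟩
          have hi : ex a = degExp j i := by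
            apply expo_ext
            · rw [(hex a).1, degExp_zero]; simp only [i]; omega
            · rw [(hex a).2, degExp_one]; simp only [i]; omega
          have h2 : j < genDeg m i.succ := by
            rw [hi, inMon_iff_of_lt hm.2.2 (degExp_zero j i), degExp_one] at hin
            rw [hgd]
            omega
          have h3 := congrFun hfΨ ⟨i, by simp only [i]; omega, h2⟩
          change MvPowerSeries.coeff (degExp j i) f = 0 at h3
          rw [hi, h3, map_zero]
          exact Ideal.zero_mem _
      have hrest : f - p ∈ IsLocalRing.maximalIdeal (R k) ^ (j + 1) := by
        rw [maximalIdeal_pow]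
        intro e he
        have hpe : ∀ a, ex a ≠ e → MvPowerSeries.coeff e
            (MvPowerSeries.monomial (ex a) (MvPowerSeries.coeff (ex a) f)) = 0 :=
          fun a h => MvPowerSeries.coeff_monomial_ne h.symm _
        rw [map_sub, hp, map_sum]
        rcases (Nat.lt_succ_iff.mp he).lt_or_eq with h1 | h1
        · rw [hf e h1, zero_sub, neg_eq_zero]
          refine Finset.sum_eq_zero fun a ha => hpe a ?_
          rintro rfl
          rw [(hex a).1, (hex a).2] at h1
          rw [Finset.mem_range] at ha
          omega
        · have he' : ex (e 0) = e := by
            apply expo_ext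
            · exact (hex _).1
            · rw [(hex _).2]; omega
          rw [Finset.sum_eq_single (e 0), he', MvPowerSeries.coeff_monomial_same, sub_self]
          · intro a _ ha
            refine hpe a fun h => ha ?_
            rw [← h, (hex a).1]
          · intro h
            rw [Finset.mem_range] at h
            omega
      rw [← sub_add_cancel f p]
      exact Submodule.add_mem_sup hrest hpI
  have e1 := (Φ.quotKerEquivOfSurjective hΦ).symm.trans
    ((Submodule.quotEquivOfEq _ _ hker).trans (Ψ.quotKerEquivOfSurjective hΨ))
  have h1 : hilbertFunction (monIdealR k m) j = Module.finrank k V := rfl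
  rw [h1, e1.finrank_eq, Module.finrank_fintype_fun_eq_card, Fintype.card_subtype]

end Hilbert

/-! ### Jumps of the Hilbert function and the dimension of the cell -/

section Jumps

variable {k : Type*} [Field k] {t : ℕ} {m : Fin (t + 1) → ℕ}

theorem le_genDeg (hm : IsLexSegment m) (i : Fin (t + 1)) : t ≤ genDeg m i := by
  have h := genDeg_mono hm.2.2 (Fin.zero_le i)
  refine le_trans ?_ h
  simp [genDeg]

theorem jump_of_lt (hm : IsLexSegment m) {j : ℕ} (hj : j + 1 < t) :
    jump (hilbertFunction (monIdealR k m)) j = 1 := by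
  classical
  have key : (Finset.univ.filter fun i : Fin t => t ≤ j + 1 + 1 + i ∧ j + 1 < genDeg m i.succ) =
      insert (⟨t - 2 - j, by omega⟩ : Fin t)
        (Finset.univ.filter fun i : Fin t => t ≤ j + 1 + i ∧ j < genDeg m i.succ) := by
    ext i
    have := le_genDeg hm i.succ
    have := i.2
    simp only [Finset.mem_filter, Finset.mem_univ, true_and, Finset.mem_insert, Fin.ext_iff]
    omega
  rw [jump, hilbertFunction_monIdealR hm, hilbertFunction_monIdealR hm, key,
    Finset.card_insert_of_notMem]
  · push_cast
    simp
  · simp only [Finset.mem_filter, Finset.mem_univ, true_and, not_and]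
    omega

/-- From degree t - 1 on, a power of x stops contributing exactly when the degree reaches that of
its generator, so h drops by the number of generators of that degree, x^t left out. -/
theorem jump_of_le (hm : IsLexSegment m) {j : ℕ} (hj : t ≤ j + 1) :
    jump (hilbertFunction (monIdealR k m)) j =
      (Finset.univ.filter fun i : Fin t => genDeg m i.succ = j + 1).card := by
  classical
  have key : (Finset.univ.filter fun i : Fin t => t ≤ j + 1 + i ∧ j < genDeg m i.succ) =
      (Finset.univ.filter fun i : Fin t => t ≤ j + 1 + 1 + i ∧ j + 1 < genDeg m i.succ) ∪
        (Finset.univ.filter fun i : Fin t => genDeg m i.succ = j + 1) := by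
    ext i
    simp only [Finset.mem_filter, Finset.mem_univ, true_and, Finset.mem_union]
    omega
  rw [jump, hilbertFunction_monIdealR hm, hilbertFunction_monIdealR hm, key,
    Finset.card_union_of_disjoint]
  · push_cast
    omega
  · rw [Finset.disjoint_filter]
    intro i _ h
    omega

theorem jump_le (hm : IsLexSegment m) (j : ℕ) :
    jump (hilbertFunction (monIdealR k m)) j ≤ t := by
  rcases lt_or_ge (j + 1) t with h | h
  · rw [jump_of_lt hm h]
    exact hm.1
  · rw [jump_of_le hm h]
    exact (Finset.card_le_univ _).trans (Fintype.card_fin t).le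

theorem bddAbove_jump (hm : IsLexSegment m) :
    BddAbove (Set.range (jump (hilbertFunction (monIdealR k m)))) :=
  ⟨t, by rintro _ ⟨j, rfl⟩; exact jump_le hm j⟩

theorem jump_le_maxJump (hm : IsLexSegment m) (j : ℕ) :
    jump (hilbertFunction (monIdealR k m)) j ≤ maxJump (hilbertFunction (monIdealR k m)) :=
  le_ciSup (bddAbove_jump hm) j

theorem exists_jump_eq_maxJump (hm : IsLexSegment m) :
    ∃ j, jump (hilbertFunction (monIdealR k m)) j =
      maxJump (hilbertFunction (monIdealR k m)) :=
  Nat.sSup_mem (Set.range_nonempty _) (bddAbove_jump hm)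

theorem maxJump_le (hm : IsLexSegment m) : maxJump (hilbertFunction (monIdealR k m)) ≤ t := by
  obtain ⟨j, hj⟩ := exists_jump_eq_maxJump (k := k) hm
  rw [← hj]
  exact jump_le hm j

theorem card_genDeg_eq_le_maxJump (hm : IsLexSegment m) (d : ℕ) :
    (Finset.univ.filter fun i : Fin t => genDeg m i.succ = d).card ≤
      maxJump (hilbertFunction (monIdealR k m)) := by
  rcases lt_or_ge d t with h | h
  · rw [Finset.filter_eq_empty_iff.mpr]
    · simp
    · intro i _
      have := le_genDeg hm i.succ
      omega
  · have ht := hm.1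
    have h1 := jump_le_maxJump (k := k) hm (d - 1)
    rwa [jump_of_le hm (by omega), Nat.sub_add_cancel (by omega)] at h1

/-- The maximal jump is the size of a largest set of generators, the first one left out, of the
same degree. -/
theorem exists_card_genDeg_eq_maxJump (hm : IsLexSegment m) :
    ∃ d, t ≤ d ∧ (Finset.univ.filter fun i : Fin t => genDeg m i.succ = d).card =
      maxJump (hilbertFunction (monIdealR k m)) := by
  obtain ⟨j, hj⟩ := exists_jump_eq_maxJump (k := k) hm
  rcases lt_or_ge (j + 1) t with h | h
  -- A jump in the rising part has height 1, which any single generator already accounts for.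
  · rw [jump_of_lt hm h] at hj
    let i : Fin t := ⟨0, hm.1⟩
    refine ⟨genDeg m i.succ, le_genDeg hm _, le_antisymm (card_genDeg_eq_le_maxJump hm _) ?_⟩
    rw [← hj, Nat.one_le_iff_ne_zero, Finset.card_ne_zero]
    exact ⟨i, by simp⟩
  · exact ⟨j + 1, h, by rw [← hj, jump_of_le hm h]⟩

/-- Otherwise, by monotonicity, the i - j > Δ generators with indices j + 1, …, i share one degree.
-/
theorem genDeg_lt_of_maxJump_lt (hm : IsLexSegment m) {i : Fin (t + 1)} {j : Fin t}
    (hij : (j : ℕ) + maxJump (hilbertFunction (monIdealR k m)) < i) :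
    genDeg m j.succ < genDeg m i := by
  by_contra! hle
  have hi := i.2
  have hmono := genDeg_mono hm.2.2
  let i' : Fin t := ⟨(i : ℕ) - 1, by omega⟩
  have hi' : i'.succ = i := Fin.ext (by simp [i']; omega)
  have hsub : Finset.Icc j i' ⊆
      Finset.univ.filter fun l : Fin t => genDeg m l.succ = genDeg m j.succ := by
    intro l hl
    rw [Finset.mem_Icc] at hl
    rw [Finset.mem_filter]
    refine ⟨Finset.mem_univ _, le_antisymm ?_ (hmono (Fin.succ_le_succ_iff.mpr hl.1))⟩
    refine le_trans (hmono (Fin.succ_le_succ_iff.mpr hl.2)) ?_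
    rwa [hi']
  have h1 := (Finset.card_le_card hsub).trans (card_genDeg_eq_le_maxJump (k := k) hm _)
  rw [Fin.card_Icc] at h1
  simp only [i'] at h1
  omega

theorem isFree_zero_iff (hm : StrictMono m) (i : Fin (t + 1)) (j : Fin t) :
    IsFree m i j 0 ↔ genDeg m j.succ < genDeg m i := by
  unfold IsFree
  rw [degMatrix_eq]
  constructor
  · rintro ⟨-, h, -⟩
    push_cast at h
    omega
  · intro h
    refine ⟨?_, by push_cast; omega, diff_pos hm j⟩
    by_contra! hle
    have := genDeg_mono hm (a := i) (b := j.succ) (by rw [Fin.le_def, Fin.val_succ]; omega)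
    omega

theorem constAt_eq_zero (hm : StrictMono m) (c : Coord m → k) {i : Fin (t + 1)} {j : Fin t}
    (h : genDeg m i ≤ genDeg m j.succ) : constAt m c i j = 0 := by
  rw [constAt_apply, coeff_matrixAt_of_not]
  rw [isFree_zero_iff hm]
  omega

theorem rank_add_le_rank_add_rank {p q : ℕ} (A B : Matrix (Fin p) (Fin q) k) :
    (A + B).rank ≤ A.rank + B.rank := by
  have hle : LinearMap.range (A + B).mulVecLin ≤
      LinearMap.range A.mulVecLin ⊔ LinearMap.range B.mulVecLin := by
    rintro _ ⟨v, rfl⟩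
    rw [Matrix.mulVecLin_add, LinearMap.add_apply]
    exact Submodule.add_mem_sup ⟨v, rfl⟩ ⟨v, rfl⟩
  exact (Submodule.finrank_mono hle).trans (Submodule.finrank_add_le_finrank_add_finrank _ _)

/-- Let d be a degree shared by Δ generators. Split N̄ into the rows of degree above d and the rest.
In the rest, a nonzero entry forces the degree of its column's generator below d. So the rank is at
most the number of generators, x^t left out, of degree different from d, which is t - Δ. -/
theorem rank_constAt_add_maxJump_le (hm : IsLexSegment m) (c : Coord m → k) :
    (constAt m c).rank + maxJump (hilbertFunction (monIdealR k m)) ≤ t := by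
  classical
  obtain ⟨d, htd, hd⟩ := exists_card_genDeg_eq_maxJump (k := k) hm
  set A := constAt m c with hA
  let A₁ : Matrix (Fin (t + 1)) (Fin t) k := Matrix.of fun i j => if d < genDeg m i then A i j else 0
  let A₂ : Matrix (Fin (t + 1)) (Fin t) k := Matrix.of fun i j => if d < genDeg m i then 0 else A i j
  have hsum : A = A₁ + A₂ := by
    ext i j
    simp only [A₁, A₂, Matrix.add_apply, Matrix.of_apply]
    split_ifs <;> simp
  have h1 : A₁.rank ≤ (Finset.univ.filter fun i : Fin t => d < genDeg m i.succ).card := by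
    refine (Matrix.rank_le_card_of_support_subset A₁
      ((Finset.univ.filter fun i : Fin t => d < genDeg m i.succ).map (Fin.succEmb t)) ?_).trans
      (Finset.card_map _).le
    intro i hi
    have hdi : d < genDeg m i := by
      by_contra h
      refine hi ?_
      funext j
      simp [Matrix.row, A₁, h]
    have hi0 : i ≠ 0 := by
      rintro rfl
      have := hm.2.1
      simp [genDeg] at hdi
      omega
    obtain ⟨i', rfl⟩ := Fin.exists_succ_eq.mpr hi0
    simp only [Finset.coe_map, Set.mem_image, Finset.mem_coe, Finset.mem_filter, Finset.mem_univ,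
      true_and]
    exact ⟨i', hdi, rfl⟩
  have h2 : A₂.rank ≤ (Finset.univ.filter fun j : Fin t => genDeg m j.succ < d).card := by
    rw [← Matrix.rank_transpose]
    refine Matrix.rank_le_card_of_support_subset _ _ ?_
    intro j hj
    simp only [Finset.coe_filter, Finset.mem_univ, true_and, Set.mem_ofPred_eq]
    by_contra! hle
    refine hj ?_
    funext i
    simp only [Matrix.row, Matrix.transpose_apply, Matrix.of_apply, A₂, Pi.zero_apply]
    split_ifs with h
    · rfl
    · exact constAt_eq_zero hm.2.2 c (by omega)
  have h3 := rank_add_le_rank_add_rank A₁ A₂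
  rw [← hsum] at h3
  have h4 : (Finset.univ.filter fun i : Fin t => d < genDeg m i.succ).card +
      (Finset.univ.filter fun i : Fin t => genDeg m i.succ < d).card +
      (Finset.univ.filter fun i : Fin t => genDeg m i.succ = d).card = t := by
    rw [← Finset.card_union_of_disjoint, ← Finset.card_union_of_disjoint]
    · rw [show (Finset.univ.filter fun i : Fin t => d < genDeg m i.succ) ∪
        (Finset.univ.filter fun i : Fin t => genDeg m i.succ < d) ∪
        (Finset.univ.filter fun i : Fin t => genDeg m i.succ = d) = Finset.univ from ?_]
      · rw [Finset.card_univ, Fintype.card_fin]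
      · ext i
        simp only [Finset.mem_union, Finset.mem_filter, Finset.mem_univ, true_and, iff_true]
        omega
    · rw [Finset.disjoint_left]
      intro i
      simp only [Finset.mem_union, Finset.mem_filter, Finset.mem_univ, true_and]
      omega
    · rw [Finset.disjoint_filter]
      intro i _ h
      omega
  omega

/-- The point of the affine space at which the coordinates on the `Δ`-th lower diagonal of the
constant terms are `1`, and all others `0`. -/
noncomputable def diagPoint (k : Type*) [Field k] (m : Fin (t + 1) → ℕ) (D : ℕ) : Coord m → k :=
  fun s => if (s.1.1 : ℕ) = s.1.2.1 + D + 1 ∧ s.1.2.2 = 0 then 1 else 0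

/-- The last t - Δ rows and first t - Δ columns of N̄ become the identity at `diagPoint`: their
diagonal entries are free by `genDeg_lt_of_maxJump_lt`, and all others evaluate to 0, free or not.
-/
theorem exists_minor_eval_eq_one (hm : IsLexSegment m) :
    ∃ p ∈ minorIdeal (t - maxJump (hilbertFunction (monIdealR k m))) (genericConst k m),
      MvPolynomial.aeval (diagPoint k m (maxJump (hilbertFunction (monIdealR k m)))) p = 1 := by
  classical
  set D := maxJump (hilbertFunction (monIdealR k m)) with hD
  have hDt : D ≤ t := maxJump_le hm
  let f : Fin (t - D) ↪o Fin (t + 1) := OrderEmbedding.ofStrictMono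
    (fun a => ⟨a + D + 1, by have := a.2; omega⟩) (fun a b h => by
      rw [Fin.lt_def] at h ⊢; simp only; omega)
  let g : Fin (t - D) ↪o Fin t := OrderEmbedding.ofStrictMono
    (fun a => ⟨a, by have := a.2; omega⟩) (fun a b h => by
      rw [Fin.lt_def] at h ⊢; simpa using h)
  have hf : ∀ a, (f a : ℕ) = a + D + 1 := fun a => rfl
  have hg : ∀ a, (g a : ℕ) = a := fun a => rfl
  refine ⟨((genericConst k m).submatrix f g).det, Ideal.subset_span ⟨f, g, rfl⟩, ?_⟩
  rw [AlgHom.map_det]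
  have hone : (MvPolynomial.aeval (diagPoint k m D)).mapMatrix
      ((genericConst k m).submatrix f g) = 1 := by
    ext a b
    change constAt m (diagPoint k m D) (f a) (g b) = _
    rw [constAt_apply]
    by_cases hfree : IsFree m (f a) (g b) 0
    · rw [coeff_matrixAt _ _ _ _ hfree, Matrix.one_apply]
      change (if (f a : ℕ) = g b + D + 1 ∧ (0 : ℕ) = 0 then (1 : k) else 0) = _
      rw [hf, hg]
      exact if_congr (by rw [Fin.ext_iff]; omega) rfl rfl
    · rw [coeff_matrixAt_of_not _ _ _ _ hfree, Matrix.one_apply, if_neg]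
      rintro rfl
      refine hfree ((isFree_zero_iff hm.2.2 _ _).mpr (genDeg_lt_of_maxJump_lt (k := k) hm ?_))
      rw [hf, hg, ← hD]
      omega
  rw [hone, Matrix.det_one]

end Jumps

/-! ### Counting the free coefficients -/

section Dimension

variable {k : Type*} [Field k] {t : ℕ} {m : Fin (t + 1) → ℕ}

theorem card_filter_lt_eq_choose {α : Type*} [LinearOrder α] (s : Finset α) :
    ((s ×ˢ s).filter fun p => p.1 < p.2).card = s.card.choose 2 := by
  induction s using Finset.induction_on_max with
  | empty => simp
  | insert a s ha ih =>
    have has : a ∉ s := fun h => lt_irrefl _ (ha a h)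
    have key : ((insert a s ×ˢ insert a s).filter fun p => p.1 < p.2) =
        ((s ×ˢ s).filter fun p => p.1 < p.2) ∪ s.image fun b => (b, a) := by
      ext ⟨p, q⟩
      simp only [Finset.mem_filter, Finset.mem_product, Finset.mem_insert, Finset.mem_union,
        Finset.mem_image, Prod.mk.injEq]
      constructor
      · rintro ⟨⟨rfl | hp, rfl | hq⟩, hpq⟩
        · exact absurd hpq (lt_irrefl _)
        · exact absurd hpq (ha q hq).asymm
        · exact Or.inr ⟨p, hp, rfl, rfl⟩
        · exact Or.inl ⟨⟨hp, hq⟩, hpq⟩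
      · rintro (⟨⟨hp, hq⟩, hpq⟩ | ⟨b, hb, rfl, rfl⟩)
        · exact ⟨⟨Or.inr hp, Or.inr hq⟩, hpq⟩
        · exact ⟨⟨Or.inr hb, Or.inl rfl⟩, ha b hb⟩
    rw [key, Finset.card_union_of_disjoint, ih,
      Finset.card_image_of_injective _ (Prod.mk_left_injective a), Finset.card_insert_of_notMem has,
      Nat.choose_succ_succ' _ 1, Nat.choose_one_right, add_comm]
    rw [Finset.disjoint_left]
    rintro ⟨p, q⟩ hp hq
    simp only [Finset.mem_filter, Finset.mem_product, Finset.mem_image, Prod.mk.injEq] at hp hq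
    obtain ⟨b, -, -, rfl⟩ := hq
    exact has hp.1.2

/-- Count the monomials outside L by their exponent of x: there are m_{i+1} of them over
x^{t-(i+1)}. -/
theorem finsum_hilbertFunction (hm : IsLexSegment m) :
    ∑ᶠ j, hilbertFunction (monIdealR k m) j = ∑ i : Fin t, m i.succ := by
  classical
  let B := ∑ i : Fin t, genDeg m i.succ
  have hB : ∀ i : Fin t, genDeg m i.succ ≤ B := fun i =>
    Finset.single_le_sum (f := fun i : Fin t => genDeg m i.succ) (fun _ _ => Nat.zero_le _)
      (Finset.mem_univ i)
  rw [finsum_eq_sum_of_support_subset (s := Finset.range B)]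
  · simp only [hilbertFunction_monIdealR hm, Finset.card_filter]
    rw [Finset.sum_comm]
    refine Finset.sum_congr rfl fun i _ => ?_
    rw [← Finset.card_filter]
    have : (Finset.range B).filter (fun j => t ≤ j + 1 + i ∧ j < genDeg m i.succ) =
        Finset.Ico (t - (i + 1)) (genDeg m i.succ) := by
      ext j
      have := hB i
      have := i.2
      simp only [Finset.mem_filter, Finset.mem_range, Finset.mem_Ico]
      omega
    rw [this, Nat.card_Ico, genDeg, Fin.val_succ]
    omega
  · intro j hj
    rw [Finset.coe_range, Set.mem_Iio]
    by_contra! hle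
    refine hj ?_
    rw [hilbertFunction_monIdealR hm, Finset.card_eq_zero, Finset.filter_eq_empty_iff]
    intro i _
    have := hB i
    omega

/-- Group the pairs of generators of equal degree by that degree: a degree with l generators
contributes `l.choose 2`, and l is the jump into it. Jumps below t - 1 have height 1 and contribute
0. -/
theorem sum_card_jump_mul_choose (hm : IsLexSegment m) :
    ∑ l ∈ Finset.Icc 2 t,
      Nat.card {i : ℕ // jump (hilbertFunction (monIdealR k m)) i = l} * l.choose 2 =
    (Finset.univ.filter fun p : Fin t × Fin t =>
      p.1 < p.2 ∧ genDeg m p.1.succ = genDeg m p.2.succ).card := by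
  classical
  set h := hilbertFunction (monIdealR k m) with hh
  let B := ∑ i : Fin t, genDeg m i.succ
  have hB : ∀ i : Fin t, genDeg m i.succ ≤ B := fun i =>
    Finset.single_le_sum (f := fun i : Fin t => genDeg m i.succ) (fun _ _ => Nat.zero_le _)
      (Finset.mem_univ i)
  have hcard : ∀ l ∈ Finset.Icc 2 t, Nat.card {i : ℕ // jump h i = l} * l.choose 2 =
      ∑ j ∈ Finset.range B, if jump h j = l then l.choose 2 else 0 := by
    intro l hl
    rw [Finset.mem_Icc] at hl
    rw [← Finset.sum_filter, Finset.sum_const, smul_eq_mul]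
    congr 1
    refine Nat.subtype_card _ fun j => ?_
    rw [Finset.mem_filter, Finset.mem_range]
    refine ⟨fun h => h.2, fun hj => ⟨?_, hj⟩⟩
    by_contra! hle
    rcases lt_or_ge (j + 1) t with h1 | h1
    · rw [jump_of_lt hm h1] at hj
      omega
    · rw [jump_of_le hm h1, Finset.filter_eq_empty_iff.mpr, Finset.card_empty] at hj
      · omega
      · intro i _
        have := hB i
        omega
  have hjump : ∀ j, ∑ l ∈ Finset.Icc 2 t, (if jump h j = l then l.choose 2 else 0) =
      (jump h j).choose 2 := by
    intro j
    rw [Finset.sum_ite_eq]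
    split_ifs with h1
    · rfl
    · rw [Finset.mem_Icc] at h1
      have := jump_le (k := k) hm j
      rw [Nat.choose_eq_zero_of_lt]
      by_contra! h2
      exact h1 ⟨h2, this⟩
  have hfib : ∀ j, (jump h j).choose 2 =
      ((Finset.univ.filter fun p : Fin t × Fin t =>
        p.1 < p.2 ∧ genDeg m p.1.succ = genDeg m p.2.succ).filter
          fun p => genDeg m p.1.succ - 1 = j).card := by
    intro j
    have ht := hm.1
    rcases lt_or_ge (j + 1) t with h1 | h1
    · rw [jump_of_lt hm h1, Finset.filter_eq_empty_iff.mpr]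
      · rfl
      · intro p _
        have := le_genDeg hm p.1.succ
        omega
    · rw [jump_of_le hm h1, ← card_filter_lt_eq_choose]
      congr 1
      ext ⟨p, q⟩
      have := le_genDeg hm p.succ
      simp only [Finset.mem_filter, Finset.mem_product, Finset.mem_univ, true_and]
      constructor
      · rintro ⟨⟨h2, h3⟩, h4⟩
        exact ⟨⟨h4, by rw [h2, h3]⟩, by omega⟩
      · rintro ⟨⟨h2, h3⟩, h4⟩
        exact ⟨⟨by omega, by omega⟩, h2⟩
  rw [Finset.sum_congr rfl hcard, Finset.sum_comm, Finset.sum_congr rfl fun j _ => hjump j,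
    Finset.sum_congr rfl fun j _ => hfib j]
  refine (Finset.card_eq_sum_card_fiberwise fun p hp => ?_).symm
  have := hB p.1
  have := le_genDeg hm p.1.succ
  have := hm.1
  simp only [Finset.coe_range, Set.mem_Iio]
  omega

theorem sum_diff_lt (hm : IsLexSegment m) (i : Fin (t + 1)) :
    ∑ j : Fin t, (if (j : ℕ) < i then diff m j else 0) = m i := by
  classical
  induction i using Fin.induction with
  | zero => simp [hm.2.1]
  | succ p ih =>
    rw [← add_diff hm.2.2 p, ← ih]
    have : ∀ j : Fin t, (if (j : ℕ) < p.succ then diff m j else 0) =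
        (if (j : ℕ) < p.castSucc then diff m j else 0) + if j = p then diff m p else 0 := by
      intro j
      rw [Fin.val_succ, Fin.val_castSucc]
      by_cases h : j = p
      · subst h
        simp
      · have : (j : ℕ) ≠ p := fun h' => h (Fin.ext h')
        rw [if_neg h, add_zero]
        exact if_congr (by omega) rfl rfl
    simp only [this, Finset.sum_add_distrib]
    simp

/-- The coordinates as a dependent sum. -/
def coordEquiv (m : Fin (t + 1) → ℕ) :
    Coord m ≃ Σ p : Fin (t + 1) × Fin t, {l : ℕ // IsFree m p.1 p.2 l} where
  toFun s := ⟨(s.1.1, s.1.2.1), s.1.2.2, s.2⟩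
  invFun s := ⟨(s.1.1, s.1.2, s.2.1), s.2.2⟩
  left_inv _ := rfl
  right_inv _ := rfl

instance finite_isFree (p : Fin (t + 1) × Fin t) : Finite {l : ℕ // IsFree m p.1 p.2 l} :=
  (((Set.finite_Iio (diff m p.2)).subset fun _ hl => hl.2.2 :
    {l : ℕ | IsFree m p.1 p.2 l}.Finite)).to_subtype

theorem finite_coord (m : Fin (t + 1) → ℕ) : Finite (Coord m) :=
  Finite.of_equiv _ (coordEquiv m).symm

/-- Below the diagonal the lower bound on the order is at most 1, so only the constant term can be
forbidden, and it is exactly when the two degrees agree. -/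
theorem card_isFree_add (hm : IsLexSegment m) (i : Fin (t + 1)) (j : Fin t) :
    Nat.card {l : ℕ // IsFree m i j l} +
      (if (j : ℕ) < i ∧ genDeg m j.succ = genDeg m i then 1 else 0) =
      if (j : ℕ) < i then diff m j else 0 := by
  classical
  by_cases hij : (j : ℕ) < i
  swap
  · rw [if_neg hij, if_neg (fun h => hij h.1), add_zero,
      Nat.subtype_card (p := IsFree m i j) ∅, Finset.card_empty]
    intro l
    simp only [Finset.notMem_empty, false_iff]
    exact fun h => hij h.1
  have hle := genDeg_mono hm.2.2 (a := j.succ) (b := i) (by rw [Fin.le_def, Fin.val_succ]; omega)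
  have hd := diff_pos hm.2.2 j
  rw [if_pos hij]
  by_cases heq : genDeg m j.succ = genDeg m i
  · rw [if_pos ⟨hij, heq⟩, Nat.subtype_card (p := IsFree m i j) (Finset.Ico 1 (diff m j)),
      Nat.card_Ico]
    · omega
    · intro l
      rw [Finset.mem_Ico, IsFree, degMatrix_eq]
      omega
  · rw [if_neg fun h => heq h.2, Nat.subtype_card (p := IsFree m i j) (Finset.range (diff m j)),
      Finset.card_range, add_zero]
    intro l
    rw [Finset.mem_range, IsFree, degMatrix_eq]
    omega

/-- Ignoring forbidden constant terms, row i has m_i coefficients, n in total. The forbidden ones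
are the t entries with i = j + 1, where the degrees agree trivially, and one for each pair of later
generators of equal degree. -/
theorem card_coord (hm : IsLexSegment m) :
    (Nat.card (Coord m) : ℤ) = cellDim (hilbertFunction (monIdealR k m)) t := by
  classical
  have h1 : Nat.card (Coord m) =
      ∑ i : Fin (t + 1), ∑ j : Fin t, Nat.card {l : ℕ // IsFree m i j l} := by
    rw [Nat.card_congr (coordEquiv m), Nat.card_sigma, Fintype.sum_prod_type]
  have h2 : Nat.card (Coord m) + ∑ i : Fin (t + 1), ∑ j : Fin t,
      (if (j : ℕ) < i ∧ genDeg m j.succ = genDeg m i then 1 else 0) = ∑ i : Fin t, m i.succ := by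
    rw [h1, ← Finset.sum_add_distrib]
    simp only [← Finset.sum_add_distrib, card_isFree_add hm, sum_diff_lt hm]
    rw [Fin.sum_univ_succ, hm.2.1, zero_add]
  have h3 : ∑ i : Fin (t + 1), ∑ j : Fin t,
      (if (j : ℕ) < i ∧ genDeg m j.succ = genDeg m i then 1 else 0) =
      t + (Finset.univ.filter fun p : Fin t × Fin t =>
        p.1 < p.2 ∧ genDeg m p.1.succ = genDeg m p.2.succ).card := by
    rw [Fin.sum_univ_succ, Finset.card_filter, Fintype.sum_prod_type_right]
    have h4 : ∀ i j : Fin t,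
        (if (j : ℕ) < i.succ ∧ genDeg m j.succ = genDeg m i.succ then 1 else 0) =
        (if j = i then 1 else 0) +
          if j < i ∧ genDeg m j.succ = genDeg m i.succ then 1 else 0 := by
      intro i j
      by_cases h : j = i
      · subst h
        simp
      · have : (j : ℕ) ≠ i := fun h' => h (Fin.ext h')
        rw [if_neg h, zero_add]
        refine if_congr (and_congr ?_ Iff.rfl) rfl rfl
        rw [Fin.val_succ, Fin.lt_def]
        omega
    simp only [h4, Finset.sum_add_distrib]
    simp
  rw [h3] at h2
  have h5 := sum_card_jump_mul_choose (k := k) hm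
  have h6 : ∑ l ∈ Finset.Icc 2 t,
      (Nat.card {i : ℕ // jump (hilbertFunction (monIdealR k m)) i = l} : ℤ) * (l.choose 2 : ℤ) =
      ((Finset.univ.filter fun p : Fin t × Fin t =>
        p.1 < p.2 ∧ genDeg m p.1.succ = genDeg m p.2.succ).card : ℤ) := by
    rw [← h5]
    push_cast
    rfl
  rw [cellDim, finsum_hilbertFunction hm, h6, ← h2]
  push_cast
  ring

end Dimension

/-! ### Coordinate subspaces and Krull dimensions -/

section CoordinateSubspace

variable {σ : Type*} {k : Type*} [Field k]

open Classical in
/-- The homomorphism of polynomial rings that sends the variables in `S` to zero. -/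
noncomputable def killVars (k : Type*) [Field k] (S : Set σ) :
    MvPolynomial σ k →ₐ[k] MvPolynomial (Sᶜ : Set σ) k :=
  MvPolynomial.aeval fun s =>
    if hs : s ∈ S then 0 else MvPolynomial.X (⟨s, hs⟩ : (Sᶜ : Set σ))

theorem killVars_X_of_mem {S : Set σ} {s : σ} (hs : s ∈ S) :
    killVars k S (MvPolynomial.X s) = 0 := by
  rw [killVars, MvPolynomial.aeval_X, dif_pos hs]

theorem killVars_X_of_notMem {S : Set σ} {s : σ} (hs : s ∉ S) :
    killVars k S (MvPolynomial.X s) = MvPolynomial.X (⟨s, hs⟩ : (Sᶜ : Set σ)) := by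
  rw [killVars, MvPolynomial.aeval_X, dif_neg hs]

theorem span_X_le_ker_killVars (k : Type*) [Field k] (S : Set σ) :
    Ideal.span (MvPolynomial.X '' S : Set (MvPolynomial σ k)) ≤ RingHom.ker (killVars k S) := by
  rw [Ideal.span_le]
  rintro _ ⟨s, hs, rfl⟩
  exact killVars_X_of_mem hs

/-- The quotient of a polynomial ring by some of the variables is a polynomial ring. -/
noncomputable def quotientSpanXEquiv (k : Type*) [Field k] (S : Set σ) :
    (MvPolynomial σ k ⧸ Ideal.span (MvPolynomial.X '' S : Set (MvPolynomial σ k))) ≃ₐ[k]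
      MvPolynomial (Sᶜ : Set σ) k :=
  AlgEquiv.ofAlgHom
    (Ideal.Quotient.liftₐ _ (killVars k S) fun _ ha => span_X_le_ker_killVars k S ha)
    (MvPolynomial.aeval fun s : (Sᶜ : Set σ) => Ideal.Quotient.mk _ (MvPolynomial.X s.1))
    (by
      refine MvPolynomial.algHom_ext fun s => ?_
      rw [AlgHom.comp_apply, MvPolynomial.aeval_X, AlgHom.id_apply]
      exact killVars_X_of_notMem s.2)
    (by
      refine Ideal.Quotient.algHom_ext _ (MvPolynomial.algHom_ext fun s => ?_)
      change MvPolynomial.aeval _ (killVars k S (MvPolynomial.X s)) =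
        Ideal.Quotient.mk _ (MvPolynomial.X s)
      by_cases hs : s ∈ S
      · rw [killVars_X_of_mem hs, map_zero, eq_comm, Ideal.Quotient.eq_zero_iff_mem]
        exact Ideal.subset_span ⟨s, hs, rfl⟩
      · rw [killVars_X_of_notMem hs, MvPolynomial.aeval_X])

theorem mem_zeroLocus_span_X_iff {S : Set σ} {c : σ → k} :
    c ∈ MvPolynomial.zeroLocus k (Ideal.span (MvPolynomial.X '' S : Set (MvPolynomial σ k))) ↔
      ∀ s ∈ S, c s = 0 := by
  rw [MvPolynomial.mem_zeroLocus_iff]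
  constructor
  · intro h s hs
    have := h _ (Ideal.subset_span ⟨s, hs, rfl⟩)
    rwa [MvPolynomial.aeval_X] at this
  · intro h
    have hle : Ideal.span (MvPolynomial.X '' S : Set (MvPolynomial σ k)) ≤
        RingHom.ker (MvPolynomial.aeval (R := k) c) := by
      rw [Ideal.span_le]
      rintro _ ⟨s, hs, rfl⟩
      rw [SetLike.mem_coe, RingHom.mem_ker, MvPolynomial.aeval_X, h s hs]
    exact fun p hp => hle hp

variable {t : ℕ} {m : Fin (t + 1) → ℕ}

theorem genericConst_of_isFree {i : Fin (t + 1)} {j : Fin t} (h : IsFree m i j 0) :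
    genericConst k m i j = MvPolynomial.X (coordMk i j 0 h) :=
  coeff_genericMatrix i j 0 h

theorem genericConst_of_not {i : Fin (t + 1)} {j : Fin t} (h : ¬ IsFree m i j 0) :
    genericConst k m i j = 0 :=
  coeff_genericMatrix_of_not i j 0 h

theorem minorIdeal_one_genericConst (k : Type*) [Field k] (m : Fin (t + 1) → ℕ) :
    minorIdeal 1 (genericConst k m) =
      Ideal.span (MvPolynomial.X '' {s : Coord m | s.1.2.2 = 0}) := by
  apply le_antisymm
  · rw [minorIdeal, Ideal.span_le]
    rintro _ ⟨f, g, rfl⟩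
    rw [Matrix.det_fin_one, Matrix.submatrix_apply]
    by_cases h : IsFree m (f 0) (g 0) 0
    · rw [genericConst_of_isFree h]
      exact Ideal.subset_span ⟨_, rfl, rfl⟩
    · rw [genericConst_of_not h]
      exact Ideal.zero_mem _
  · rw [Ideal.span_le]
    rintro _ ⟨⟨⟨i, j, l⟩, hs⟩, hl, rfl⟩
    change l = 0 at hl
    subst hl
    refine Ideal.subset_span ⟨OrderEmbedding.ofStrictMono (fun _ => i) (Subsingleton.strictMono _),
      OrderEmbedding.ofStrictMono (fun _ => j) (Subsingleton.strictMono _), ?_⟩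
    rw [Matrix.det_fin_one, Matrix.submatrix_apply]
    exact (genericConst_of_isFree hs).symm

end CoordinateSubspace

/-! ### Krull dimension of nonempty open subsets of affine space -/

section KrullDimension

variable {σ : Type*} [Finite σ] {k : Type*} [Field k]

theorem ringKrullDim_mvPolynomial_field (σ : Type*) [Finite σ] (k : Type*) [Field k] :
    ringKrullDim (MvPolynomial σ k) = Nat.card σ := by
  rw [MvPolynomial.ringKrullDim_of_isNoetherianRing, ringKrullDim_eq_zero_of_field, zero_add]

/-- The ideal of a rational point of the affine space has maximal height. -/
theorem card_le_height_ker_aeval (c : σ → k) :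
    (Nat.card σ : ℕ∞) ≤ (RingHom.ker (MvPolynomial.aeval (R := k) c)).height := by
  classical
  let e := Finite.equivFin σ
  -- Substitute c for the first i variables; the kernels are primes and form a strict chain.
  let φ : ℕ → MvPolynomial σ k →ₐ[k] MvPolynomial σ k := fun i =>
    MvPolynomial.aeval fun s => if (e s : ℕ) < i then MvPolynomial.C (c s) else MvPolynomial.X s
  have hφX : ∀ i s, φ i (MvPolynomial.X s) =
      if (e s : ℕ) < i then MvPolynomial.C (c s) else MvPolynomial.X s :=
    fun i s => MvPolynomial.aeval_X _ _
  have hφC : ∀ i a, φ i (MvPolynomial.C a) = MvPolynomial.C a := fun i a =>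
    MvPolynomial.algHom_C _ _
  have hcomp : ∀ i i', i ≤ i' → (φ i').comp (φ i) = φ i' := by
    intro i i' hii
    refine MvPolynomial.algHom_ext fun s => ?_
    rw [AlgHom.comp_apply, hφX]
    split_ifs with h
    · rw [hφC, hφX, if_pos (h.trans_le hii)]
    · rfl
  have heval : ∀ i, (MvPolynomial.aeval (R := k) c).comp (φ i) = MvPolynomial.aeval c := by
    intro i
    refine MvPolynomial.algHom_ext fun s => ?_
    rw [AlgHom.comp_apply, hφX]
    split_ifs with h
    · rw [MvPolynomial.aeval_X]
      exact MvPolynomial.algHom_C _ _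
    · rfl
  let P : Fin (Nat.card σ + 1) → PrimeSpectrum (MvPolynomial σ k) := fun i =>
    ⟨RingHom.ker (φ i), RingHom.ker_isPrime _⟩
  have hP : StrictMono P := by
    intro i i' hii
    rw [Fin.lt_def] at hii
    refine lt_of_le_of_ne (fun f hf => ?_) fun heq => ?_
    · change φ i' f = 0
      rw [← hcomp i i' hii.le, AlgHom.comp_apply, show φ i f = 0 from hf, map_zero]
    · let s := e.symm ⟨i, by omega⟩
      have hs : (e s : ℕ) = i := by simp [s]
      have h1 : MvPolynomial.X s - MvPolynomial.C (c s) ∈ RingHom.ker (φ i') := by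
        rw [RingHom.mem_ker, map_sub, hφX, hφC, if_pos (by omega), sub_self]
      have h2 : RingHom.ker (φ i) = RingHom.ker (φ i') := congrArg PrimeSpectrum.asIdeal heq
      rw [← h2, RingHom.mem_ker, map_sub, hφX, hφC, if_neg (by omega)] at h1
      -- At a point whose coordinates are all c s + 1, the polynomial X_s - c_s takes the value 1.
      have h3 := congrArg (MvPolynomial.aeval fun _ : σ => c s + 1) h1
      rw [map_sub, map_zero, MvPolynomial.aeval_X, MvPolynomial.algHom_C] at h3
      simp at h3
  have : (RingHom.ker (MvPolynomial.aeval (R := k) c)).IsPrime := RingHom.ker_isPrime _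
  rw [PrimeSpectrum.height_eq_orderHeight ⟨_, this⟩]
  refine Order.length_le_height (p := LTSeries.mk _ P hP) ?_
  intro f hf
  change MvPolynomial.aeval c f = 0
  have hf' : φ (Fin.last (Nat.card σ)) f = 0 := hf
  rw [← heval (Fin.last (Nat.card σ)), AlgHom.comp_apply, hf', map_zero]

/-- The complement of the zero locus of an ideal which does not vanish at some rational point has
the dimension of the affine space. -/
theorem topologicalKrullDim_compl_zeroLocus {I : Ideal (MvPolynomial σ k)} {c : σ → k}
    {p : MvPolynomial σ k} (hp : p ∈ I) (hc : MvPolynomial.aeval c p ≠ 0) :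
    topologicalKrullDim ((PrimeSpectrum.zeroLocus (I : Set (MvPolynomial σ k)))ᶜ :
      Set (PrimeSpectrum (MvPolynomial σ k))) = Nat.card σ := by
  apply le_antisymm
  · refine (topologicalKrullDim_subspace_le _ _).trans ?_
    rw [PrimeSpectrum.topologicalKrullDim_eq_ringKrullDim, ringKrullDim_mvPolynomial_field]
  -- The spectrum of the local ring at the rational point c embeds into the open set, because p is a
  -- unit there; its dimension is the height of the ideal of c.
  · let M := RingHom.ker (MvPolynomial.aeval (R := k) c)
    have hM : M.IsPrime := RingHom.ker_isPrime _
    let L := Localization.AtPrime M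
    have hmem : ∀ y : PrimeSpectrum L, PrimeSpectrum.comap (algebraMap (MvPolynomial σ k) L) y ∈
        (PrimeSpectrum.zeroLocus (I : Set (MvPolynomial σ k)))ᶜ := by
      intro y hy
      have h1 : algebraMap (MvPolynomial σ k) L p ∈ y.asIdeal := hy hp
      have h2 : IsUnit (algebraMap (MvPolynomial σ k) L p) :=
        IsLocalization.map_units L (⟨p, hc⟩ : M.primeCompl)
      exact y.2.ne_top (Ideal.eq_top_of_isUnit_mem _ h1 h2)
    have hind := (PrimeSpectrum.localization_comap_isInducing L M.primeCompl).codRestrict hmem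
    refine le_trans ?_ hind.topologicalKrullDim_le
    rw [PrimeSpectrum.topologicalKrullDim_eq_ringKrullDim,
      IsLocalization.AtPrime.ringKrullDim_eq_height M L]
    exact_mod_cast card_le_height_ker_aeval c

/-- If f vanishes off the zero locus, then f p vanishes at every point, hence is 0 over an infinite
field. So f = 0: the complement is Zariski dense. -/
theorem ringKrullDim_quotient_vanishingIdeal_compl [Infinite k] {I : Ideal (MvPolynomial σ k)}
    {p : MvPolynomial σ k} (hp : p ∈ I) (hp0 : p ≠ 0) :
    ringKrullDim (MvPolynomial σ k ⧸
      MvPolynomial.vanishingIdeal k (MvPolynomial.zeroLocus k I)ᶜ) = Nat.card σ := by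
  have hbot : MvPolynomial.vanishingIdeal k (MvPolynomial.zeroLocus k I)ᶜ = ⊥ := by
    rw [eq_bot_iff]
    intro f hf
    have hfp : f * p = 0 := by
      refine MvPolynomial.funext fun x => ?_
      rw [map_mul, map_zero]
      by_cases hx : x ∈ MvPolynomial.zeroLocus k I
      · have : MvPolynomial.eval x p = 0 := hx p hp
        rw [this, mul_zero]
      · have : MvPolynomial.eval x f = 0 := hf x hx
        rw [this, zero_mul]
    exact (mul_eq_zero.mp hfp).resolve_right hp0
  rw [ringKrullDim_eq_of_ringEquiv ((Ideal.quotEquivOfEq hbot).trans (RingEquiv.quotientBot _)),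
    ringKrullDim_mvPolynomial_field]

end KrullDimension

end BettiStrata

theorem theorem3 {k : Type*} [Field k]
    (τ : MonomialOrder (Fin 2)) (hτ : Finsupp.single 1 1 ≺[τ] Finsupp.single 0 1)
    (h : ℕ → ℕ) {t : ℕ} (m : Fin (t + 1) → ℕ) (hm : IsLexSegment m)
    (hh : hilbertFunction (monIdealR k m) = h) :
    -- the cell is an affine space of dimension `D`, via canonical Hilbert-Burch matrices
    (Finite (Coord m) ∧ (Nat.card (Coord m) : ℤ) = cellDim h t ∧
      Set.BijOn (matrixAt (k := k) m) Set.univ (canonicalSet k m) ∧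
      Set.BijOn (idealOf m) (canonicalSet k m) (groebnerCell τ (monIdeal k m))) ∧
    -- the Betti strata
    (∀ d : ℕ, maxJump h + 1 ≤ d → d ≤ t + 1 →
      bettiStratum τ (monIdeal k m) d =
        cellMap m '' (MvPolynomial.zeroLocus k (minorIdeal (t + 2 - d) (genericConst k m)) \
          MvPolynomial.zeroLocus k (minorIdeal (t + 1 - d) (genericConst k m)))) ∧
    -- the stratum of the largest number of generators is an affine space: a coordinate subspace
    (∃ S : Set (Coord m),
      minorIdeal 1 (genericConst k m) = Ideal.span (MvPolynomial.X '' S) ∧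
      Nonempty ((MvPolynomial (Coord m) k ⧸ minorIdeal 1 (genericConst k m)) ≃ₐ[k]
        MvPolynomial (Sᶜ : Set (Coord m)) k) ∧
      bettiStratum τ (monIdeal k m) (t + 1) = cellMap m '' {c | ∀ s ∈ S, c s = 0}) ∧
    -- the stratum of the smallest number of generators is the complement of a closed subset,
    bettiStratum τ (monIdeal k m) (maxJump h + 1) =
      cellMap m '' (MvPolynomial.zeroLocus k (minorIdeal (t - maxJump h) (genericConst k m)))ᶜ ∧
    -- and has dimension `D`: as an open subscheme of the affine space,
    topologicalKrullDim
      ((PrimeSpectrum.zeroLocus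
        (minorIdeal (t - maxJump h) (genericConst k m) : Set (MvPolynomial (Coord m) k)))ᶜ :
          Set (PrimeSpectrum (MvPolynomial (Coord m) k))) = Nat.card (Coord m) ∧
    -- and, over an infinite field, as a set of points: the coordinate ring of its Zariski closure
    -- has Krull dimension `D`
    (Infinite k →
      ringKrullDim (MvPolynomial (Coord m) k ⧸ MvPolynomial.vanishingIdeal k
        (MvPolynomial.zeroLocus k (minorIdeal (t - maxJump h) (genericConst k m)))ᶜ) =
          Nat.card (Coord m)) := by
  subst hh
  have hΔ := maxJump_le (k := k) hm
  obtain ⟨p, hp, hp1⟩ := exists_minor_eval_eq_one (k := k) hm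
  have hfin := finite_coord m
  have hone := minorIdeal_one_genericConst k m
  refine ⟨⟨hfin, card_coord hm, bijOn_matrixAt, bijOn_idealOf hτ hm⟩,
    fun d _ hd => bettiStratum_eq hτ hm hd,
    ⟨{s : Coord m | s.1.2.2 = 0}, hone, ?_, ?_⟩, ?_,
    topologicalKrullDim_compl_zeroLocus hp (hp1 ▸ one_ne_zero), fun _ =>
    ringKrullDim_quotient_vanishingIdeal_compl hp ?_⟩
  · rw [hone]
    exact ⟨quotientSpanXEquiv k _⟩
  · rw [bettiStratum_eq hτ hm le_rfl]
    congr 1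
    ext c
    have h1 : t + 2 - (t + 1) = 1 := by omega
    have h0 : t + 1 - (t + 1) = 0 := by omega
    rw [Set.mem_sdiff, h0, mem_zeroLocus_minorIdeal_iff c 0, h1, hone, mem_zeroLocus_span_X_iff]
    simp
  · rw [bettiStratum_eq hτ hm (by omega)]
    congr 1
    ext c
    -- The rank never exceeds t - Δ, so membership in the larger zero locus is automatic.
    have hrank := rank_constAt_add_maxJump_le (k := k) hm c
    rw [Set.mem_sdiff, Set.mem_compl_iff, mem_zeroLocus_minorIdeal_iff,
      mem_zeroLocus_minorIdeal_iff, mem_zeroLocus_minorIdeal_iff]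
    omega
  · rintro rfl
    rw [map_zero] at hp1
    exact zero_ne_one hp1
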